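/- Let $\mathbb D=\{z\in\mathbb C:|z|<1\}$. Let $\hat H$ be the class of harmonic mappings $f=h+\overline g$ on $\mathbb D$, where $h(z)=z+\sum_{n\ge2}A_nz^n$ and $g(z)=\sum_{n\ge1}B_nz^n$ are analytic in $\mathbb D$ and $|B_1|<1$. Let $K_{\hat H^o}$ be the class of those $f=h+\overline g\in\hat H$ that are univalent and sense-preserving ($|g'|<|h'|$) in $\mathbb D$, satisfy $g'(0)=0$, and map $\mathbb D$ onto a convex domain. For $0\le\alpha<1$ let $HK(\alpha)$ be the class of those $f\in\hat H$ such that, for every $0<r<1$ and every real $\theta$, $\frac{\partial}{\partial\theta}f(re^{i\theta})\ne0$ and $$\frac{\partial}{\partial\theta}\arg\Big(\frac{\partial}{\partial\theta}f(re^{i\theta})\Big)>\alpha ,$$ where $\arg$ denotes a differentiable branch of the argument along the circle $|z|=r$ (as a function of $\theta\in\mathbb R$). For $i=1,2$ let $\alpha_i,\gamma_i>0$, $\beta_i,\delta_i\ge0$ with $\beta_i+\delta_i>0$, and let $$W_i(z)=z\,\Gamma(\alpha_i)\Gamma(\gamma_i)\sum_{n=0}^\infty\frac{z^n}{\Gamma(\alpha_i+n\beta_i)\Gamma(\gamma_i+n\delta_i)},\qquad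 z\in\mathbb C,$$ be the normalized four-parameter Wright function. Let $\sigma\in\mathbb C$ with $|\sigma|<1$, and for $f=h+\overline g\in\hat H$ put $L(f)=h*W_1+\overline{\sigma\,(g*W_2)}$, where $*$ is the Hadamard product (convolution) $\big(\sum p_nz^n\big)*\big(\sum q_nz^n\big)=\sum p_nq_nz^n$. Theorem. Let $0\le\alpha<1$ and $f=h+\overline g\in K_{\hat H^o}$. If $$\Big(W_1'''(1)+(4-\alpha)W_1''(1)+2(1-\alpha)\big(W_1'(1)-1\big)\Big)+|\sigma|\Big(W_2'''(1)+(2+\alpha)W_2''(1)\Big)\le 2(1-\alpha),$$ then $L(f)\in HK(\alpha)$. -/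

import Mathlib

open Complex Metric Set
open scoped ComplexConjugate

noncomputable section

/-- `f` is a normalized harmonic mapping of the open unit disc with analytic part `h` and
co-analytic part `g`: on the disc `f = h + conj g`, where `h` and `g` are analytic with
`h(z) = z + ∑_{n ≥ 2} a_n z^n`, `g(z) = ∑_{n ≥ 1} b_n z^n` and `|b_1| < 1`. -/
structure IsHarmonicDecomposition (f h g : ℂ → ℂ) : Prop where
  analytic_h : DifferentiableOn ℂ h (ball 0 1)
  analytic_g : DifferentiableOn ℂ g (ball 0 1)
  h_zero : h 0 = 0
  deriv_h_zero : deriv h 0 = 1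
  g_zero : g 0 = 0
  norm_deriv_g_zero : ‖deriv g 0‖ < 1
  eq_on_disc : ∀ z ∈ ball (0 : ℂ) 1, f z = h z + conj (g z)

/-- The class of normalized harmonic mappings of the unit disc. -/
def ClassH : Set (ℂ → ℂ) :=
  {f | ∃ h g, IsHarmonicDecomposition f h g}

/-- The normalized harmonic mappings that are sense-preserving (`|g'| < |h'|` on the disc),
univalent on the disc and satisfy `g'(0) = 0`. -/
def ClassSHo : Set (ℂ → ℂ) :=
  {f | InjOn f (ball 0 1) ∧ ∃ h g, IsHarmonicDecomposition f h g ∧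
    (∀ z ∈ ball (0 : ℂ) 1, ‖deriv g z‖ < ‖deriv h z‖) ∧ deriv g 0 = 0}

/-- The convex harmonic mappings with `g'(0) = 0`: those that map the unit disc onto a
convex domain. -/
def ClassKHo : Set (ℂ → ℂ) :=
  {f | f ∈ ClassSHo ∧ Convex ℝ (f '' ball 0 1)}

/-- The tangent vector `∂/∂θ f(r e^{iθ})`. -/
def circleTangent (f : ℂ → ℂ) (r θ : ℝ) : ℂ :=
  deriv (fun t : ℝ => f (r * exp (t * I))) θ

/-- Harmonic convex functions of order `a`: on each circle `|z| = r`, `0 < r < 1`, the tangent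
vector does not vanish and has a differentiable argument `φ`, with `φ'(θ) > a` for every `θ`. -/
def ClassHK (a : ℝ) : Set (ℂ → ℂ) :=
  {f | f ∈ ClassH ∧ ∀ r : ℝ, 0 < r → r < 1 →
    (∀ θ : ℝ, circleTangent f r θ ≠ 0) ∧
    ∃ φ : ℝ → ℝ, Differentiable ℝ φ ∧
      (∀ θ : ℝ, circleTangent f r θ = ‖circleTangent f r θ‖ * exp (φ θ * I)) ∧
      ∀ θ : ℝ, a < deriv φ θ}

/-- The four-parameter Wright function `∑ z^n / (Γ(α + nβ) Γ(γ + nδ))`. -/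
def wright (α β γ δ : ℝ) (z : ℂ) : ℂ :=
  ∑' n : ℕ, z ^ n / ((Real.Gamma (α + n * β) * Real.Gamma (γ + n * δ) : ℝ) : ℂ)

/-- The normalized Wright function `z Γ(α) Γ(γ) ∑ z^n / (Γ(α + nβ) Γ(γ + nδ))`. -/
def wrightNormalized (α β γ δ : ℝ) (z : ℂ) : ℂ :=
  z * Real.Gamma α * Real.Gamma γ * wright α β γ δ z

/-- The `n`-th Taylor coefficient at the origin. -/
def taylorCoeffZero (p : ℂ → ℂ) (n : ℕ) : ℂ :=
  iteratedDeriv n p 0 / (n.factorial : ℂ)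

/-- The convolution (Hadamard product) of two power series centred at the origin. -/
def hadamardConv (p q : ℂ → ℂ) (z : ℂ) : ℂ :=
  ∑' n : ℕ, taylorCoeffZero p n * taylorCoeffZero q n * z ^ n

/-- For `f = h + conj g`, the map `L(f) = h * W₁ + conj (σ (g * W₂))`, where `*` is convolution. -/
def convOperator (W₁ W₂ : ℂ → ℂ) (σ : ℂ) (h g : ℂ → ℂ) (z : ℂ) : ℂ :=
  hadamardConv h W₁ z + conj (σ * hadamardConv g W₂ z)

end

/-! The theorem combines two facts about coefficients. A normalized convex harmonic map satisfies
`|A_n| ≤ (n+1)/2` and `|B_n| ≤ (n-1)/2` (`IsConvexHarmonic.norm_taylorCoeffZero_le`). A harmonic map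
with coefficients `c_n`, `d_n`, where `c_1 = 1` and `d_1 = 0`, lies in `HK(a)` once `∑_{n≥2}
n(n-a)|c_n| + n(n+a)|d_n| ≤ 1-a` (`CoeffCondition.mem_classHK`). For `L(f)` the coefficients are
those of `f` times nonnegative Wright coefficients, and the resulting sum is half of the left side
of the hypothesis, because `m(m+1)(m-a)` and `m(m-1)(m+a)` are combinations of falling factorials,
that is, of derivatives at `1`.

The coefficient bounds are the deep part. Write `Re f = Re(h+g)`. By convexity the sets where `Re f`
exceeds, or stays below, a given level are connected, and planar topology
(`exists_eq_of_interlacing`) then forbids boundary values that lie alternately above and below a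
level at four cyclically ordered points. Hence the boundary values rise on one arc and fall on the
complementary one. The vector field `i(λ+2bz+\bar λ z²)` that is tangent to the circle and vanishes
at the two arc ends flows from the minimum to the maximum, and an integration by parts in Schwarz'
formula shows that `Re(h+g)` increases along it throughout the disc
(`IsConvexHarmonic.exists_direction`). To have bounded functions with radial limits almost
everywhere, this is carried out on an exhaustion of the image by compactly contained convex domains,
whose preimages are parametrized by the Riemann mapping theorem; the parametrizations tend to the
identity and the pairs `(λ, b)` stay in a compact set.

Every rotation `\bar u h + u g` has such a field, and `u ↦ -u` changes the sign of `b`.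
Connectedness of the line of angles yields a rotation with fields of both signs; a positive
combination of these has `b = 0`, unless the two fields are opposite, and then the derivative is an
explicit rational function. In both cases `\bar u h' + u g'` has coefficients of modulus at most
`n+1`. Since `|g'| < |h'|`, the quotient `(\bar u h' - u g')/(\bar u h' + u g')` has positive real
part and value `1` at the origin, so its other coefficients have modulus at most `2`; multiplying
the two series gives the bounds for `h` and `g` separately. -/

/-! ### Plane topology: crossing paths in the closed disc. -/

/-- The argument of `1 - e^{iτ}` for `τ ∈ (0, 2π)`. -/
lemma arg_one_sub_exp {τ : ℝ} (h0 : 0 < τ) (h1 : τ < 2 * Real.pi) :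
    (1 - exp (τ * I)).arg = (τ - Real.pi) / 2 := by
  have hs : 0 < Real.sin (τ / 2) := Real.sin_pos_of_pos_of_lt_pi (by linarith) (by linarith)
  have key : 1 - exp (τ * I) = ((2 * Real.sin (τ / 2) : ℝ) : ℂ) *
      (cos (((τ - Real.pi) / 2 : ℝ) : ℂ) + sin (((τ - Real.pi) / 2 : ℝ) : ℂ) * I) := by
    have e1 : (τ - Real.pi) / 2 = τ / 2 - Real.pi / 2 := by ring
    have e2 : Real.cos τ = 1 - 2 * Real.sin (τ / 2) ^ 2 := by
      have := Real.cos_two_mul (τ / 2)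
      rw [show 2 * (τ / 2) = τ by ring] at this
      linarith [Real.sin_sq_add_cos_sq (τ / 2)]
    have e3 : Real.sin τ = 2 * Real.sin (τ / 2) * Real.cos (τ / 2) := by
      rw [← Real.sin_two_mul]; congr 1; ring
    rw [e1, exp_mul_I, ← ofReal_cos, ← ofReal_sin, ← ofReal_cos, ← ofReal_sin,
      Real.cos_sub_pi_div_two, Real.sin_sub_pi_div_two, e2, e3]
    push_cast
    ring
  rw [key, arg_mul_cos_add_sin_mul_I (by linarith) ⟨by linarith, by linarith⟩]

lemma arg_one_sub_exp_neg {τ : ℝ} (h0 : 0 < τ) (h1 : τ < 2 * Real.pi) :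
    (1 - exp ((-τ : ℝ) * I)).arg = -((τ - Real.pi) / 2) := by
  have : exp ((-τ : ℝ) * I) = exp ((2 * Real.pi - τ : ℝ) * I) := by
    rw [← exp_periodic ((-τ : ℝ) * I)]
    congr 1; push_cast; ring
  rw [this, arg_one_sub_exp (by linarith) (by linarith)]; ring

/-- A continuous logarithm of `κ (1 - \bar p w)` along a path `w` in the closed disc that avoids the
boundary point `p` changes like the principal branch. -/
lemma continuous_log_sub_eq {p κ : ℂ} (hp : ‖p‖ = 1) {w l : ℝ → ℂ}
    (hw : Continuous w) (hl : Continuous l) (hw1 : ∀ t, ‖w t‖ ≤ 1) (hwp : ∀ t, w t ≠ p)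
    (hexp : ∀ t, exp (l t) = κ * (1 - conj p * w t)) (a b : ℝ) :
    l b - l a = log (1 - conj p * w b) - log (1 - conj p * w a) := by
  have hpp : conj p * p = 1 := by
    rw [mul_comm, mul_conj, normSq_eq_norm_sq, hp]; simp
  have hre : ∀ t, 0 < (1 - conj p * w t).re := by
    intro t
    have h1 : ‖conj p * w t‖ ≤ 1 := by simpa [hp] using hw1 t
    have h2 : (conj p * w t).re ≤ 1 := (re_le_norm _).trans h1
    have h3 : (conj p * w t).re ≠ 1 := by
      intro h
      have h4 : conj p * w t = 1 := by
        have h5 := normSq_apply (conj p * w t)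
        rw [normSq_eq_norm_sq, h] at h5
        apply Complex.ext
        · simpa using h
        · simp only [one_im]
          nlinarith [norm_nonneg (conj p * w t)]
      apply hwp t
      calc w t = (conj p * p) * w t := by rw [hpp, one_mul]
        _ = p * (conj p * w t) := by ring
        _ = p := by rw [h4, mul_one]
    have := lt_of_le_of_ne h2 h3
    simp only [sub_re, one_re]; linarith
  have hslit : ∀ t, 1 - conj p * w t ∈ slitPlane := fun t => Or.inl (hre t)
  have hne : ∀ t, 1 - conj p * w t ≠ 0 := fun t => slitPlane_ne_zero (hslit t)
  have hm : Continuous fun t => l t - log (1 - conj p * w t) :=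
    hl.sub ((continuous_const.sub (continuous_const.mul hw)).clog hslit)
  -- The difference of the two logarithms is continuous and its exponential is the constant `κ`;
  -- since `exp` is a covering map, the difference is constant.
  have hconst := isCoveringMap_exp.const_of_comp hm (fun s t => by
    ext
    simp only [exp_sub, exp_log (hne _), hexp]
    rw [mul_div_cancel_right₀ _ (hne _), mul_div_cancel_right₀ _ (hne _)]) a b
  have h := hconst
  linear_combination -h

lemma Convex.isSimplyConnected {E : Type*} [AddCommGroup E] [Module ℝ E] [TopologicalSpace E]
    [ContinuousAdd E] [ContinuousSMul ℝ E] {s : Set E} (hs : Convex ℝ s) (hne : s.Nonempty) :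
    IsSimplyConnected s := by
  have := hs.contractibleSpace hne
  exact inferInstanceAs (SimplyConnectedSpace s)

/-- Two paths in the closed unit disc that join interlacing pairs of boundary points meet. -/
theorem exists_eq_of_interlacing {θ₁ θ₂ θ₃ θ₄ : ℝ} (h12 : θ₁ < θ₂) (h23 : θ₂ < θ₃) (h34 : θ₃ < θ₄)
    (h41 : θ₄ < θ₁ + 2 * Real.pi) {γ η : ℝ → ℂ} (hγ : Continuous γ) (hη : Continuous η)
    (hγ1 : ∀ t, ‖γ t‖ ≤ 1) (hη1 : ∀ t, ‖η t‖ ≤ 1)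
    (hγ0 : γ 0 = exp (θ₁ * I)) (hγe : γ 1 = exp (θ₃ * I))
    (hη0 : η 0 = exp (θ₂ * I)) (hηe : η 1 = exp (θ₄ * I)) : ∃ s t, γ s = η t := by
  by_contra! hne
  -- If the paths never meet, `γ s - η t` has a continuous logarithm on the whole plane of
  -- parameters. On each edge of the unit square one of the paths rests at a boundary point, so the
  -- increment is computed by the principal branch.
  obtain ⟨L, hLc, hL⟩ := exists_continuousOn_eqOn_exp_comp (X := ℝ × ℝ) (U := univ)
    (convex_univ.isSimplyConnected univ_nonempty) isOpen_univ (g := fun x => γ x.1 - η x.2)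
    (by fun_prop) (by rintro ⟨x, -, hx⟩; exact hne _ _ (sub_eq_zero.1 hx))
  rw [continuousOn_univ] at hLc
  have hL' : ∀ s t, exp (L (s, t)) = γ s - η t := fun s t => hL (mem_univ (s, t))
  have hn : ∀ θ : ℝ, ‖exp (θ * I)‖ = 1 := norm_exp_ofReal_mul_I
  have hc : ∀ θ φ : ℝ, conj (exp (θ * I)) * exp (φ * I) = exp ((φ - θ : ℝ) * I) := by
    intro θ φ
    rw [← exp_conj, ← exp_add]; congr 1; simp; ring
  have hcc : ∀ θ : ℝ, exp (θ * I) * conj (exp (θ * I)) = 1 := by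
    intro θ; rw [mul_conj, normSq_eq_norm_sq, hn]; simp
  have s1 := continuous_log_sub_eq (κ := exp (θ₁ * I)) (hn θ₁) hη
    (l := fun t => L (0, t)) (by fun_prop) hη1 (fun t h => hne 0 t (by rw [hγ0, h]))
    (fun t => by rw [hL', hγ0]; linear_combination (η t) * hcc θ₁) 0 1
  have s2 := continuous_log_sub_eq (κ := -exp (θ₄ * I)) (hn θ₄) hγ
    (l := fun s => L (s, 1)) (by fun_prop) hγ1 (fun s h => hne s 1 (by rw [hηe, h]))
    (fun s => by rw [hL', hηe]; linear_combination -(γ s) * hcc θ₄) 0 1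
  have s3 := continuous_log_sub_eq (κ := exp (θ₃ * I)) (hn θ₃) hη
    (l := fun t => L (1, t)) (by fun_prop) hη1 (fun t h => hne 1 t (by rw [hγe, h]))
    (fun t => by rw [hL', hγe]; linear_combination (η t) * hcc θ₃) 0 1
  have s4 := continuous_log_sub_eq (κ := -exp (θ₂ * I)) (hn θ₂) hγ
    (l := fun s => L (s, 0)) (by fun_prop) hγ1 (fun s h => hne s 0 (by rw [hη0, h]))
    (fun s => by rw [hL', hη0]; linear_combination -(γ s) * hcc θ₂) 0 1
  simp only [hγ0, hγe, hη0, hηe, hc] at s1 s2 s3 s4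
  -- Going from `(0,0)` to `(1,1)` along the two halves of the boundary must give the same
  -- increment, but the imaginary parts differ by `2π`: the increments at `s = 1` and at `t = 0`
  -- each carry an extra `-π`, because there the opposite end points lie on both sides of the fixed
  -- point.
  have key := congrArg im (show
    (L (0, 1) - L (0, 0)) + (L (1, 1) - L (0, 1)) = (L (1, 0) - L (0, 0)) + (L (1, 1) - L (1, 0))
    by ring)
  rw [s1, s2, s3, s4] at key
  simp only [add_im, sub_im, log_im] at key
  rw [show θ₃ - θ₄ = -(θ₄ - θ₃) by ring, show θ₁ - θ₄ = -(θ₄ - θ₁) by ring,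
    show θ₁ - θ₂ = -(θ₂ - θ₁) by ring, show θ₂ - θ₃ = -(θ₃ - θ₂) by ring,
    arg_one_sub_exp (τ := θ₄ - θ₁) (by linarith) (by linarith),
    arg_one_sub_exp (τ := θ₂ - θ₁) (by linarith) (by linarith),
    arg_one_sub_exp (τ := θ₄ - θ₃) (by linarith) (by linarith),
    arg_one_sub_exp (τ := θ₃ - θ₂) (by linarith) (by linarith),
    arg_one_sub_exp_neg (τ := θ₄ - θ₁) (by linarith) (by linarith),
    arg_one_sub_exp_neg (τ := θ₂ - θ₁) (by linarith) (by linarith),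
    arg_one_sub_exp_neg (τ := θ₄ - θ₃) (by linarith) (by linarith),
    arg_one_sub_exp_neg (τ := θ₃ - θ₂) (by linarith) (by linarith)] at key
  linarith [Real.pi_pos]

/-- A continuous function on the disc whose super- and sublevel sets at height `c` are path connected
has no four interlacing radial limits alternately above and below `c`. -/
theorem not_interlacing_radial_limits {u : ℂ → ℝ} (c : ℝ)
    (hup : ∀ z ∈ ball (0 : ℂ) 1, ∀ w ∈ ball (0 : ℂ) 1, c < u z → c < u w →
      JoinedIn {x ∈ ball (0 : ℂ) 1 | c < u x} z w)
    (hlo : ∀ z ∈ ball (0 : ℂ) 1, ∀ w ∈ ball (0 : ℂ) 1, u z < c → u w < c →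
      JoinedIn {x ∈ ball (0 : ℂ) 1 | u x < c} z w)
    {v : ℝ → ℝ} {θ₁ θ₂ θ₃ θ₄ : ℝ} (h12 : θ₁ < θ₂) (h23 : θ₂ < θ₃) (h34 : θ₃ < θ₄)
    (h41 : θ₄ < θ₁ + 2 * Real.pi)
    (hv : ∀ θ ∈ ({θ₁, θ₂, θ₃, θ₄} : Set ℝ),
      Filter.Tendsto (fun r : ℝ => u (r * exp (θ * I))) (nhdsWithin 1 (Iio 1)) (nhds (v θ)))
    (h1 : c < v θ₁) (h2 : v θ₂ < c) (h3 : c < v θ₃) (h4 : v θ₄ < c) : False := by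
  -- When the radial limit lies in an open set `S`, the end of the radius can be appended to a path
  -- in `{u ∈ S}`, which then reaches the boundary point itself.
  have seg : ∀ (S : Set ℝ) (hS : IsOpen S) (θ : ℝ),
      Filter.Tendsto (fun r : ℝ => u (r * exp (θ * I))) (nhdsWithin 1 (Iio 1)) (nhds (v θ)) →
      v θ ∈ S → ∃ z ∈ ball (0 : ℂ) 1, u z ∈ S ∧
        segment ℝ z (exp (θ * I)) ⊆ {x ∈ ball (0 : ℂ) 1 | u x ∈ S} ∪ {exp (θ * I)} := by
    intro S hS θ hθ hvS
    have hev := hθ.eventually (hS.mem_nhds hvS)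
    rw [eventually_nhdsWithin_iff, Metric.eventually_nhds_iff] at hev
    obtain ⟨ε, hε, hev⟩ := hev
    have key : ∀ r : ℝ, max 0 (1 - ε / 2) ≤ r → r < 1 →
        (r : ℂ) * exp (θ * I) ∈ {x ∈ ball (0 : ℂ) 1 | u x ∈ S} := by
      intro r hr0 hr1
      have h0 : 0 ≤ r := (le_max_left _ _).trans hr0
      refine ⟨?_, hev ?_ hr1⟩
      · simpa [norm_exp_ofReal_mul_I, abs_of_nonneg h0] using hr1
      · rw [Real.dist_eq, abs_lt]
        have := (le_max_right 0 (1 - ε / 2)).trans hr0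
        constructor <;> linarith
    have hm : max 0 (1 - ε / 2) < 1 := max_lt one_pos (by linarith)
    refine ⟨(max 0 (1 - ε / 2) : ℝ) * exp (θ * I), (key _ le_rfl hm).1, (key _ le_rfl hm).2, ?_⟩
    rintro x ⟨s, t, hs, ht, hst, rfl⟩
    have hx : s • (((max 0 (1 - ε / 2) : ℝ) : ℂ) * exp (θ * I)) + t • exp (θ * I) =
        ((s * max 0 (1 - ε / 2) + t : ℝ) : ℂ) * exp (θ * I) := by
      simp only [real_smul]; push_cast; ring
    rw [hx]
    rcases hs.eq_or_lt with rfl | hs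
    · right; simp [show t = 1 by linarith]
    · left
      refine key _ ?_ ?_
      · nlinarith
      · nlinarith
  have path : ∀ (S : Set ℝ) (hS : IsOpen S)
      (hj : ∀ z ∈ ball (0 : ℂ) 1, ∀ w ∈ ball (0 : ℂ) 1, u z ∈ S → u w ∈ S →
        JoinedIn {x ∈ ball (0 : ℂ) 1 | u x ∈ S} z w) (θ φ : ℝ),
      Filter.Tendsto (fun r : ℝ => u (r * exp (θ * I))) (nhdsWithin 1 (Iio 1)) (nhds (v θ)) →
      Filter.Tendsto (fun r : ℝ => u (r * exp (φ * I))) (nhdsWithin 1 (Iio 1)) (nhds (v φ)) →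
      v θ ∈ S → v φ ∈ S →
      JoinedIn ({x ∈ ball (0 : ℂ) 1 | u x ∈ S} ∪ {exp (θ * I), exp (φ * I)})
        (exp (θ * I)) (exp (φ * I)) := by
    intro S hS hj θ φ hθ hφ hvθ hvφ
    obtain ⟨z, hz, hzS, hzs⟩ := seg S hS θ hθ hvθ
    obtain ⟨w, hw, hwS, hws⟩ := seg S hS φ hφ hvφ
    refine ((JoinedIn.of_segment_subset (hzs.trans ?_)).symm.trans
      ((hj z hz w hw hzS hwS).mono subset_union_left)).trans
      (JoinedIn.of_segment_subset (hws.trans ?_))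
    · exact union_subset_union_right _ (by simp)
    · exact union_subset_union_right _ (by simp)
  obtain ⟨γ, hγ⟩ := path (Ioi c) isOpen_Ioi hup θ₁ θ₃ (hv _ (by simp)) (hv _ (by simp)) h1 h3
  obtain ⟨η, hη⟩ := path (Iio c) isOpen_Iio hlo θ₂ θ₄ (hv _ (by simp)) (hv _ (by simp)) h2 h4
  have hn : ∀ θ : ℝ, ‖exp (θ * I)‖ = 1 := norm_exp_ofReal_mul_I
  have hle : ∀ (S : Set ℝ) (θ φ : ℝ) (x : ℂ),
      x ∈ {x ∈ ball (0 : ℂ) 1 | u x ∈ S} ∪ {exp (θ * I), exp (φ * I)} → ‖x‖ ≤ 1 := by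
    rintro S θ φ x (hx | rfl | rfl)
    · exact (mem_ball_zero_iff.1 hx.1).le
    · exact (hn _).le
    · exact (hn _).le
  have hγ' : ∀ t : ℝ, γ.extend t ∈ {x ∈ ball (0 : ℂ) 1 | u x ∈ Ioi c} ∪
      {exp (θ₁ * I), exp (θ₃ * I)} := fun t => hγ _
  have hη' : ∀ t : ℝ, η.extend t ∈ {x ∈ ball (0 : ℂ) 1 | u x ∈ Iio c} ∪
      {exp (θ₂ * I), exp (θ₄ * I)} := fun t => hη _
  obtain ⟨s, t, hst⟩ := exists_eq_of_interlacing h12 h23 h34 h41 γ.continuous_extend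
    η.continuous_extend (fun t => hle _ _ _ _ (hγ' t)) (fun t => hle _ _ _ _ (hη' t))
    (by simp) (by simp) (by simp) (by simp)
  have hexp : ∀ θ φ : ℝ, θ < φ → φ < θ + 2 * Real.pi → exp (θ * I) ≠ exp (φ * I) := by
    intro θ φ h h' he
    have h'' : exp ((φ - θ : ℝ) * I) = 1 := by
      rw [ofReal_sub, sub_mul, exp_sub, he, div_self (exp_ne_zero _)]
    have e2 := exp_eq_one_iff.1 h''
    obtain ⟨n, hn⟩ := e2
    have e3 := congrArg im hn
    simp at e3
    have h5 : (0 : ℝ) < n := by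
      by_contra hneg
      nlinarith [Real.pi_pos]
    have h6 : (n : ℝ) < 1 := by
      by_contra hneg
      nlinarith [Real.pi_pos]
    have h7 : (0 : ℤ) < n := by exact_mod_cast h5
    have h8 : n < 1 := by exact_mod_cast h6
    omega
  have a := hγ' s
  have b := hη' t
  rw [hst] at a
  have nb : ∀ θ : ℝ, exp (θ * I) ∉ ball (0 : ℂ) 1 := by
    intro θ; simp [hn]
  -- A common point cannot be interior, since `u` would be both above and below `c` there, and the
  -- four end points on the circle are distinct.
  rcases a with a | a | a <;> rcases b with b | b | b
  · exact lt_asymm (mem_Ioi.1 a.2) (mem_Iio.1 b.2)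
  · exact nb _ (b ▸ a.1)
  · exact nb _ (b ▸ a.1)
  · exact nb _ (a ▸ b.1)
  · exact hexp θ₁ θ₂ h12 (by linarith) (a.symm.trans b)
  · exact hexp θ₁ θ₄ (by linarith) h41 (a.symm.trans b)
  · exact nb _ (a ▸ b.1)
  · exact hexp θ₂ θ₃ h23 (by linarith) (b.symm.trans a)
  · exact hexp θ₃ θ₄ h34 (by linarith) (a.symm.trans b)

/-! ### Normal families: the theorems of Hurwitz and Montel. -/

/-- Hurwitz: a locally uniform limit of nowhere vanishing holomorphic functions vanishes nowhere or
identically. -/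
theorem ne_zero_of_tendstoLocallyUniformlyOn {ι : Type*} {l : Filter ι} [l.NeBot] {U : Set ℂ}
    (hU : IsOpen U) (hc : IsPreconnected U) {F : ι → ℂ → ℂ} {f : ℂ → ℂ}
    (hF : TendstoLocallyUniformlyOn F f l U) (hd : ∀ i, DifferentiableOn ℂ (F i) U)
    (hne : ∀ i, ∀ z ∈ U, F i z ≠ 0) (hf : ∃ z ∈ U, f z ≠ 0) : ∀ z ∈ U, f z ≠ 0 := by
  intro z₀ hz₀ hfz
  have hfd : DifferentiableOn ℂ f U := hF.differentiableOn (.of_forall hd) hU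
  have han : AnalyticOnNhd ℂ f U := hfd.analyticOnNhd hU
  rcases (han z₀ hz₀).eventually_eq_zero_or_eventually_ne_zero with h | h
  · obtain ⟨z, hz, hz'⟩ := hf
    exact hz' (han.eqOn_zero_of_preconnected_of_eventuallyEq_zero hc hz₀ h hz)
  rw [eventually_nhdsWithin_iff] at h
  obtain ⟨r, hr, hrs⟩ := Metric.nhds_basis_closedBall.mem_iff.1
    (Filter.inter_mem h (hU.mem_nhds hz₀))
  have hsub : closedBall z₀ r ⊆ U := fun z hz => (hrs hz).2
  have hsne : (sphere z₀ r).Nonempty := NormedSpace.sphere_nonempty.2 hr.le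
  obtain ⟨x, hx, hxmin⟩ := (isCompact_sphere z₀ r).exists_isMinOn hsne
    ((hfd.continuousOn.mono (sphere_subset_closedBall.trans hsub)).norm)
  have hm : 0 < ‖f x‖ := by
    rw [norm_pos_iff]
    refine (hrs (sphere_subset_closedBall hx)).1 ?_
    rintro rfl
    simp at hx; exact hr.ne hx
  have hunif := (tendstoLocallyUniformlyOn_iff_forall_isCompact hU).1 hF _ hsub
    (isCompact_closedBall z₀ r)
  obtain ⟨i, hi⟩ := ((Metric.tendstoUniformlyOn_iff.1 hunif) (‖f x‖ / 2) (by linarith)).exists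
  have h0 : ‖F i z₀‖ < ‖f x‖ / 2 := by
    have := hi z₀ (mem_closedBall_self hr.le)
    rwa [hfz, dist_zero_left] at this
  -- The maximum principle for `1 / F i`: on the circle it is at most `2 / ‖f x‖`, where `‖f x‖` is
  -- the minimum of `|f|` there, whereas at the centre it would be larger.
  have hdc : DiffContOnCl ℂ (fun z => (F i z)⁻¹) (ball z₀ r) := by
    refine DifferentiableOn.diffContOnCl ?_
    rw [closure_ball _ hr.ne']
    exact ((hd i).mono hsub).inv fun z hz => hne i z (hsub hz)
  have hb := norm_le_of_forall_mem_frontier_norm_le isBounded_ball hdc (C := 2 / ‖f x‖)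
    (by
      intro z hz
      rw [frontier_ball _ hr.ne'] at hz
      have h1 := hi z (sphere_subset_closedBall hz)
      have h2 : ‖f x‖ ≤ ‖f z‖ := hxmin hz
      have h3 : ‖f z‖ ≤ dist (f z) (F i z) + ‖F i z‖ := by
        rw [dist_eq_norm]
        simpa using norm_add_le (f z - F i z) (F i z)
      rw [norm_inv, inv_le_comm₀ (by linarith) (by positivity), inv_div]
      linarith) (subset_closure (mem_ball_self hr))
  rw [norm_inv, inv_le_comm₀ (norm_pos_iff.2 (hne i z₀ hz₀)) (by positivity), inv_div] at hb
  linarith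

/-- A locally uniform limit of injective holomorphic functions is injective or constant. -/
theorem injOn_of_tendstoLocallyUniformlyOn {ι : Type*} {l : Filter ι} [l.NeBot] {U : Set ℂ}
    (hU : IsOpen U) (hc : IsPreconnected U) {F : ι → ℂ → ℂ} {f : ℂ → ℂ}
    (hF : TendstoLocallyUniformlyOn F f l U) (hd : ∀ i, DifferentiableOn ℂ (F i) U)
    (hinj : ∀ i, InjOn (F i) U) (hf : ∃ z ∈ U, ∃ w ∈ U, f z ≠ f w) : InjOn f U := by
  intro z hz w hw hzw
  by_contra hne
  have hfd : DifferentiableOn ℂ f U := hF.differentiableOn (.of_forall hd) hU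
  obtain ⟨r, hr, hrU⟩ := Metric.isOpen_iff.1 hU z hz
  -- The ball around `z` must miss `w`, so that `F i - F i w` has no zero in it by injectivity.
  set ρ := min r (dist z w) with hρ
  have hρ0 : 0 < ρ := lt_min hr (dist_pos.2 hne)
  have hsub : ball z ρ ⊆ U := (ball_subset_ball (min_le_left _ _)).trans hrU
  have hwn : w ∉ ball z ρ := by
    rw [mem_ball, dist_comm, not_lt]; exact min_le_right _ _
  have hlim : Filter.Tendsto (fun i => F i w) l (nhds (f w)) := hF.tendsto_at hw
  have hF' : TendstoLocallyUniformlyOn (fun i x => F i x - F i w) (fun x => f x - f w) l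
      (ball z ρ) := by
    have h1 := hF.mono hsub
    have h2 : TendstoLocallyUniformlyOn (fun i (_ : ℂ) => F i w) (fun _ => f w) l (ball z ρ) := by
      refine TendstoUniformlyOn.tendstoLocallyUniformlyOn ?_
      exact (hlim.tendstoUniformlyOn_const _)
    simpa [Pi.sub_def] using! h1.sub h2
  refine ne_zero_of_tendstoLocallyUniformlyOn isOpen_ball (convex_ball z ρ).isPreconnected hF'
    (fun i => ((hd i).mono hsub).sub_const _) (fun i x hx h0 => ?_) ?_ z (mem_ball_self hρ0)
    (by rw [hzw, sub_self])
  · have := hinj i (hsub hx) hw (sub_eq_zero.1 h0)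
    exact hwn (this ▸ hx)
  · by_contra! hall
    obtain ⟨a, ha, b, hb, hab⟩ := hf
    have hz' := (hfd.sub_const (f w)).analyticOnNhd hU
    have := hz'.eqOn_zero_of_preconnected_of_eventuallyEq_zero hc hz
      (Filter.mem_of_superset (ball_mem_nhds z hρ0) hall)
    exact hab ((sub_eq_zero.1 (this ha)).trans (sub_eq_zero.1 (this hb)).symm)

/-- Montel: a sequence of holomorphic functions bounded by `1` converges locally uniformly along some
ultrafilter. -/
theorem exists_tendstoLocallyUniformlyOn_of_norm_le_one {U : Set ℂ} (hU : IsOpen U)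
    {F : ℕ → ℂ → ℂ} (hd : ∀ n, DifferentiableOn ℂ (F n) U) (hb : ∀ n, ∀ z ∈ U, ‖F n z‖ ≤ 1) :
    ∃ (l : Ultrafilter ℕ) (f : ℂ → ℂ), (l : Filter ℕ) ≤ Filter.atTop ∧
      TendstoLocallyUniformlyOn F f l U := by
  have hR : ∀ x : U, ∃ R > 0, ball (x : ℂ) R ⊆ U := fun x => Metric.isOpen_iff.1 hU x x.2
  choose R hR0 hRU using hR
  -- The Lipschitz bounds on small balls come from the Schwarz lemma, since functions bounded by `1`
  -- oscillate by at most `2` (the constant `3` is slack). They survive pointwise limits, so `P` is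
  -- compact by Tychonoff, and they give the equicontinuity needed for Arzelà–Ascoli.
  let P : Set (U → ℂ) := {g | (∀ x, g x ∈ closedBall 0 1) ∧
    ∀ x y : U, (y : ℂ) ∈ ball (x : ℂ) (R x) → dist (g y) (g x) ≤ 3 / R x * dist (y : ℂ) x}
  have hPcont : ∀ g ∈ P, Continuous g := by
    intro g hg
    rw [continuous_iff_continuousAt]
    intro x
    rw [ContinuousAt, tendsto_iff_dist_tendsto_zero]
    refine squeeze_zero' (.of_forall fun _ => dist_nonneg) (g := fun y : U =>
      3 / R x * dist (y : ℂ) x) ?_ ?_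
    · have : ∀ᶠ y : U in nhds x, (y : ℂ) ∈ ball (x : ℂ) (R x) :=
        continuous_subtype_val.continuousAt.eventually (ball_mem_nhds _ (hR0 x))
      filter_upwards [this] with y hy using hg.2 x y hy
    · have : Continuous fun y : U => 3 / R x * dist (y : ℂ) x := by fun_prop
      simpa using this.tendsto x
  have hPclosed : IsClosed P := by
    have : P = (⋂ x, {g : U → ℂ | g x ∈ closedBall 0 1}) ∩
        ⋂ x : U, ⋂ y : U, ⋂ (_ : (y : ℂ) ∈ ball (x : ℂ) (R x)),
          {g : U → ℂ | dist (g y) (g x) ≤ 3 / R x * dist (y : ℂ) x} := by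
      ext g; simp [P]
    rw [this]
    refine (isClosed_iInter fun x => isClosed_closedBall.preimage (continuous_apply x)).inter
      (isClosed_iInter fun x => isClosed_iInter fun y => isClosed_iInter fun _ => ?_)
    exact isClosed_le (by fun_prop) continuous_const
  have hPcompact : IsCompact P :=
    (isCompact_univ_pi (fun _ : U => isCompact_closedBall (0 : ℂ) 1)).of_isClosed_subset hPclosed
      (fun g hg x _ => hg.1 x)
  let S : Set C(U, ℂ) := {g | ⇑g ∈ P}
  have hS : IsCompact S := by
    refine ArzelaAscoli.isCompact_of_equicontinuous S ?_ ?_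
    · convert hPcompact
      ext g
      constructor
      · rintro ⟨g, hg, rfl⟩; exact hg
      · intro hg; exact ⟨⟨g, hPcont g hg⟩, hg, rfl⟩
    · intro x
      rw [Metric.equicontinuousAt_iff]
      intro ε hε
      refine ⟨min (R x) (ε * R x / 3), lt_min (hR0 x) (by have := hR0 x; positivity), ?_⟩
      intro y hy g
      have h1 : (y : ℂ) ∈ ball (x : ℂ) (R x) := lt_of_lt_of_le hy (min_le_left _ _)
      have h2 : dist (y : ℂ) x < ε * R x / 3 := lt_of_lt_of_le hy (min_le_right _ _)
      rw [dist_comm]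
      refine (g.2.2 x y h1).trans_lt ?_
      have := hR0 x
      calc 3 / R x * dist (y : ℂ) x < 3 / R x * (ε * R x / 3) := by gcongr
        _ = ε := by field_simp
  let G : ℕ → C(U, ℂ) := fun n => ⟨fun x => F n x, ((hd n).continuousOn).domRestrict⟩
  have hG : ∀ n, G n ∈ S := by
    intro n
    refine ⟨fun x => mem_closedBall_zero_iff.2 (hb n x x.2), fun x y hy => ?_⟩
    refine dist_le_div_mul_dist_of_mapsTo_ball ((hd n).mono (hRU x)) (fun z hz => ?_) hy
    have h1 := hb n z (hRU x hz)
    have h2 := hb n x x.2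
    rw [mem_closedBall, dist_eq_norm]
    exact (norm_sub_le _ _).trans (by linarith)
  obtain ⟨g, -, hg⟩ := hS.exists_mapClusterPt (f := Filter.atTop) (u := G)
    (by
      rw [Filter.le_principal_iff, Filter.mem_map]
      exact Filter.univ_mem' hG)
  obtain ⟨l, hl, hlg⟩ := mapClusterPt_iff_ultrafilter.1 hg
  have := hU.locallyCompactSpace
  rw [ContinuousMap.tendsto_iff_tendstoLocallyUniformly] at hlg
  classical
  refine ⟨l, fun z => if h : z ∈ U then g ⟨z, h⟩ else 0, hl, ?_⟩
  rw [tendstoLocallyUniformlyOn_iff_tendstoLocallyUniformly_comp_coe]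
  convert hlg using 1
  · rfl
  · ext z
    simp

/-! ### The Riemann mapping theorem by Koebe's extremal argument. -/

/-- The disc automorphism `z ↦ (z - w) / (1 - \bar w z)`. -/
noncomputable def discMobius (w z : ℂ) : ℂ := (z - w) / (1 - conj w * z)

lemma one_sub_conj_mul_ne_zero {w z : ℂ} (hw : ‖w‖ < 1) (hz : ‖z‖ < 1) : 1 - conj w * z ≠ 0 := by
  intro h
  have h1 : conj w * z = 1 := (sub_eq_zero.1 h).symm
  have h2 := congrArg norm h1
  simp only [norm_mul, RCLike.norm_conj, norm_one] at h2
  nlinarith [norm_nonneg w, norm_nonneg z]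

lemma norm_discMobius_lt_one {w z : ℂ} (hw : ‖w‖ < 1) (hz : ‖z‖ < 1) : ‖discMobius w z‖ < 1 := by
  have hne := one_sub_conj_mul_ne_zero hw hz
  rw [discMobius, norm_div, div_lt_one (norm_pos_iff.2 hne)]
  refine lt_of_pow_lt_pow_left₀ 2 (norm_nonneg _) ?_
  have h1 : ‖w‖ ^ 2 < 1 := by nlinarith [norm_nonneg w]
  have h2 : ‖z‖ ^ 2 < 1 := by nlinarith [norm_nonneg z]
  rw [← normSq_eq_norm_sq, normSq_apply] at h1 h2
  rw [← normSq_eq_norm_sq, ← normSq_eq_norm_sq, normSq_apply, normSq_apply]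
  simp only [sub_re, sub_im, one_re, one_im, mul_re, mul_im, conj_re, conj_im]
  nlinarith

lemma hasDerivAt_discMobius {w z : ℂ} (hw : ‖w‖ < 1) (hz : ‖z‖ < 1) :
    HasDerivAt (discMobius w) ((1 - conj w * w) / (1 - conj w * z) ^ 2) z := by
  have h := ((hasDerivAt_id z).sub_const w).div
    (((hasDerivAt_id z).const_mul (conj w)).const_sub 1) (one_sub_conj_mul_ne_zero hw hz)
  refine h.congr_deriv ?_
  simp only [id]
  ring

lemma discMobius_injOn {w : ℂ} (hw : ‖w‖ < 1) : InjOn (discMobius w) (ball 0 1) := by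
  intro a ha b hb hab
  rw [mem_ball_zero_iff] at ha hb
  have h1 := one_sub_conj_mul_ne_zero hw ha
  have h2 := one_sub_conj_mul_ne_zero hw hb
  rw [discMobius, discMobius, div_eq_div_iff h1 h2] at hab
  have h3 : (1 - conj w * w) * (a - b) = 0 := by linear_combination hab
  rcases mul_eq_zero.1 h3 with h | h
  · exact absurd h (one_sub_conj_mul_ne_zero hw hw)
  · exact sub_eq_zero.1 h

/-- A continuous square root of a nonvanishing function is differentiable. -/
lemma hasDerivAt_of_sq_eq {U : Set ℂ} (hU : IsOpen U) {κ G : ℂ → ℂ} (hκ : ContinuousOn κ U)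
    (hsq : ∀ z ∈ U, κ z ^ 2 = G z) {z G' : ℂ} (hz : z ∈ U) (hne : κ z ≠ 0)
    (hG : HasDerivAt G G' z) : HasDerivAt κ (G' / (2 * κ z)) z := by
  rw [hasDerivAt_iff_tendsto_slope] at hG ⊢
  have hc : ContinuousAt κ z := hκ.continuousAt (hU.mem_nhds hz)
  have h2 : Filter.Tendsto (fun x => κ x + κ z) (nhdsWithin z {z}ᶜ) (nhds (2 * κ z)) := by
    rw [two_mul]
    exact (hc.tendsto.mono_left nhdsWithin_le_nhds).add tendsto_const_nhds
  have hne2 : 2 * κ z ≠ 0 := by simpa using hne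
  refine (hG.div h2 hne2).congr' ?_
  filter_upwards [h2.eventually_ne hne2, nhdsWithin_le_nhds (hU.mem_nhds hz)] with x hx hxU
  have : κ x ^ 2 - κ z ^ 2 = (κ x - κ z) * (κ x + κ z) := by ring
  rw [Pi.div_apply, slope_def_field, slope_def_field, ← hsq x hxU, ← hsq z hz, this]
  field_simp

/-- The injective holomorphic maps of `U` into the unit disc fixing the origin. -/
structure IsConformalIntoDisc (U : Set ℂ) (φ : ℂ → ℂ) : Prop where
  diff : DifferentiableOn ℂ φ U
  mapsTo : MapsTo φ U (ball 0 1)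
  injOn : InjOn φ U
  -- Implied by injectivity, but convenient to carry along: Hurwitz' theorem applied to the
  -- derivatives passes it to limits.
  deriv_ne : ∀ z ∈ U, deriv φ z ≠ 0
  zero : φ 0 = 0

/-- Koebe's square root transformation: a map that omits a value of the disc does not have maximal
derivative at the origin. -/
lemma IsConformalIntoDisc.exists_norm_deriv_lt {U : Set ℂ} (hU : IsOpen U)
    (hUc : IsSimplyConnected U) (h0 : (0 : ℂ) ∈ U) {φ : ℂ → ℂ} (hφ : IsConformalIntoDisc U φ)
    {w : ℂ} (hw : ‖w‖ < 1) (hwφ : ∀ z ∈ U, φ z ≠ w) :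
    ∃ Φ, IsConformalIntoDisc U Φ ∧ ‖deriv φ 0‖ < ‖deriv Φ 0‖ := by
  have hφ1 : ∀ z ∈ U, ‖φ z‖ < 1 := fun z hz => mem_ball_zero_iff.1 (hφ.mapsTo hz)
  have hφd : ∀ z ∈ U, HasDerivAt φ (deriv φ z) z := fun z hz =>
    (hφ.diff.differentiableAt (hU.mem_nhds hz)).hasDerivAt
  have hw0 : w ≠ 0 := fun h => hwφ 0 h0 (by rw [hφ.zero, h])
  set G : ℂ → ℂ := fun z => discMobius w (φ z) with hGdef
  have hGd : ∀ z ∈ U, HasDerivAt G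
      ((1 - conj w * w) / (1 - conj w * φ z) ^ 2 * deriv φ z) z := fun z hz =>
    (hasDerivAt_discMobius hw (hφ1 z hz)).comp z (hφd z hz)
  have hG0 : ∀ z ∈ U, G z ≠ 0 := fun z hz =>
    div_ne_zero (sub_ne_zero.2 (hwφ z hz)) (one_sub_conj_mul_ne_zero hw (hφ1 z hz))
  obtain ⟨κ, hκc, hκ⟩ := exists_continuousOn_pow_eq hUc hU (g := G)
    (fun z hz => (hGd z hz).continuousAt.continuousWithinAt)
    (by rintro ⟨z, hz, h⟩; exact hG0 z hz h) two_ne_zero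
  have hκne : ∀ z ∈ U, κ z ≠ 0 := by
    intro z hz h
    apply hG0 z hz
    rw [← hκ z, h]; simp
  have hκd := fun z (hz : z ∈ U) =>
    hasDerivAt_of_sq_eq hU hκc (fun z _ => hκ z) hz (hκne z hz) (hGd z hz)
  have hκ1 : ∀ z ∈ U, ‖κ z‖ < 1 := by
    intro z hz
    have h1 : ‖κ z‖ ^ 2 < 1 := by
      rw [← norm_pow, hκ z]; exact norm_discMobius_lt_one hw (hφ1 z hz)
    nlinarith [norm_nonneg (κ z)]
  have hk := hκ1 0 h0
  have hΦd := fun z (hz : z ∈ U) => (hasDerivAt_discMobius hk (hκ1 z hz)).comp z (hκd z hz)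
  have h1w : ∀ v : ℂ, ‖v‖ < 1 → 1 - conj v * v ≠ 0 := fun v hv => one_sub_conj_mul_ne_zero hv hv
  refine ⟨fun z => discMobius (κ 0) (κ z), ⟨?_, ?_, ?_, ?_, ?_⟩, ?_⟩
  · exact fun z hz => (hΦd z hz).differentiableAt.differentiableWithinAt
  · exact fun z hz => mem_ball_zero_iff.2 (norm_discMobius_lt_one hk (hκ1 z hz))
  · intro a ha b hb hab
    have h1 := discMobius_injOn hk (mem_ball_zero_iff.2 (hκ1 a ha))
      (mem_ball_zero_iff.2 (hκ1 b hb)) hab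
    have h2 : G a = G b := by rw [← hκ a, ← hκ b, h1]
    exact hφ.injOn ha hb (discMobius_injOn hw (hφ.mapsTo ha) (hφ.mapsTo hb) h2)
  · intro z hz
    have := (hΦd z hz).deriv
    simp only [Function.comp_def] at this
    rw [this]
    refine mul_ne_zero (div_ne_zero (h1w _ hk) (pow_ne_zero _
      (one_sub_conj_mul_ne_zero hk (hκ1 z hz)))) (div_ne_zero (mul_ne_zero (div_ne_zero (h1w _ hw)
      (pow_ne_zero _ (one_sub_conj_mul_ne_zero hw (hφ1 z hz)))) (hφ.deriv_ne z hz))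
      (mul_ne_zero two_ne_zero (hκne z hz)))
  · simp [discMobius]
  · have := (hΦd 0 h0).deriv
    simp only [Function.comp_def] at this
    rw [this]
    have hκw : ‖κ 0‖ ^ 2 = ‖w‖ := by
      rw [← norm_pow, hκ 0]; simp [hGdef, discMobius, hφ.zero]
    have hcs : ∀ v : ℂ, conj v * v = ((‖v‖ ^ 2 : ℝ) : ℂ) := by
      intro v; rw [mul_comm, mul_conj, normSq_eq_norm_sq]
    have hn : ∀ t : ℝ, t < 1 → ‖(1 : ℂ) - (t : ℂ)‖ = 1 - t := by
      intro t ht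
      rw [← ofReal_one, ← ofReal_sub, norm_real, Real.norm_of_nonneg (by linarith)]
    have hk0 : 0 < ‖κ 0‖ := norm_pos_iff.2 (hκne 0 h0)
    have hd0 : 0 < ‖deriv φ 0‖ := norm_pos_iff.2 (hφ.deriv_ne 0 h0)
    have e1 : ‖κ 0‖ ^ 2 < 1 := by nlinarith
    have e2 : ‖w‖ ^ 2 < 1 := by nlinarith [norm_nonneg w]
    simp only [norm_mul, norm_div, norm_pow, hcs, hφ.zero, mul_zero, sub_zero, one_pow,
      div_one, hn _ e1, hn _ e2, norm_ofNat]
    set k := ‖κ 0‖ with hkdef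
    have e3 : 0 < 1 - k ^ 2 := by linarith
    -- With `k² = ‖w‖` the derivative at the origin is multiplied by `(1 + k²) / (2k)`, which
    -- exceeds `1` because `k ≠ 1`.
    have : (1 - k ^ 2) / (1 - k ^ 2) ^ 2 * ((1 - ‖w‖ ^ 2) * ‖deriv φ 0‖ / (2 * k)) =
        (1 + k ^ 2) / (2 * k) * ‖deriv φ 0‖ := by
      rw [← hκw]; field_simp; ring
    rw [this]
    have h2 : 1 < (1 + k ^ 2) / (2 * k) := by
      rw [lt_div_iff₀ (by positivity)]; nlinarith
    nlinarith

/-- The Riemann mapping theorem for simply connected domains inside the unit disc. -/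
theorem exists_isConformalIntoDisc_surjOn {U : Set ℂ} (hU : IsOpen U) (hUc : IsSimplyConnected U)
    (h0 : (0 : ℂ) ∈ U) (hUD : U ⊆ ball 0 1) :
    ∃ φ, IsConformalIntoDisc U φ ∧ SurjOn φ U (ball 0 1) := by
  have hpre : IsPreconnected U := hUc.isPathConnected.isConnected.isPreconnected
  have hid : IsConformalIntoDisc U id :=
    ⟨differentiableOn_id, hUD, injOn_id _, fun z _ => by simp, rfl⟩
  obtain ⟨r, hr, hrU⟩ := Metric.isOpen_iff.1 hU 0 h0
  -- The Riemann map is the member of the family that maximizes the derivative at `0`. The identity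
  -- shows that the supremum is at least `1`, so the limit is not constant.
  let A : Set ℝ := {x | ∃ φ, IsConformalIntoDisc U φ ∧ x = ‖deriv φ 0‖}
  have hA1 : (1 : ℝ) ∈ A := ⟨id, hid, by simp⟩
  have hAb : BddAbove A := by
    refine ⟨1 / r, ?_⟩
    rintro _ ⟨φ, hφ, rfl⟩
    refine norm_deriv_le_div_of_mapsTo_ball (hφ.diff.mono hrU) (fun z hz => ?_) hr
    rw [hφ.zero]; exact ball_subset_closedBall (hφ.mapsTo (hrU hz))
  obtain ⟨x, -, hx, hxA⟩ := exists_seq_tendsto_sSup ⟨1, hA1⟩ hAb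
  choose F hF hFx using hxA
  obtain ⟨l, f, hl, hlf⟩ := exists_tendstoLocallyUniformlyOn_of_norm_le_one hU
    (fun n => (hF n).diff) (fun n z hz => (mem_ball_zero_iff.1 ((hF n).mapsTo hz)).le)
  have hfd : DifferentiableOn ℂ f U := hlf.differentiableOn (.of_forall fun n => (hF n).diff) hU
  have hder := hlf.deriv (.of_forall fun n => (hF n).diff) hU
  have hd0 : ‖deriv f 0‖ = sSup A := by
    have h1 := (hder.tendsto_at h0).norm
    refine tendsto_nhds_unique h1 ((hx.mono_left hl).congr fun n => ?_)
    rw [hFx]; rfl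
  have hsup : ∀ φ, IsConformalIntoDisc U φ → ‖deriv φ 0‖ ≤ ‖deriv f 0‖ := fun φ hφ => by
    rw [hd0]; exact le_csSup hAb ⟨φ, hφ, rfl⟩
  have hf1 : deriv f 0 ≠ 0 := by
    have := hsup id hid
    rw [← norm_pos_iff]
    simp at this; linarith
  have hnc : ∀ c, ∃ z ∈ U, f z ≠ c := by
    intro c
    by_contra! h
    apply hf1
    have : f =ᶠ[nhds 0] fun _ => c := Filter.mem_of_superset (hU.mem_nhds h0) h
    rw [this.deriv_eq, deriv_const]
  have hle : ∀ z ∈ U, ‖f z‖ ≤ 1 := fun z hz =>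
    le_of_tendsto (hlf.tendsto_at hz).norm
      (.of_forall fun n => (mem_ball_zero_iff.1 ((hF n).mapsTo hz)).le)
  have hf : IsConformalIntoDisc U f := by
    refine ⟨hfd, fun z hz => ?_, ?_, ?_, ?_⟩
    · rw [mem_ball_zero_iff]
      refine lt_of_le_of_ne (hle z hz) fun h => ?_
      obtain ⟨y, hy, hyz⟩ := hnc (f z)
      refine hyz (eqOn_of_isPreconnected_of_isMaxOn_norm hpre hU hfd hz (fun y hy => ?_) hy)
      simp only [Function.comp_apply, mem_ofPred_eq, h]
      exact hle y hy
    · obtain ⟨y, hy, hyz⟩ := hnc (f 0)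
      exact injOn_of_tendstoLocallyUniformlyOn hU hpre hlf (fun n => (hF n).diff)
        (fun n => (hF n).injOn) ⟨y, hy, 0, h0, hyz⟩
    · exact ne_zero_of_tendstoLocallyUniformlyOn hU hpre hder (fun n => (hF n).diff.deriv hU)
        (fun n => (hF n).deriv_ne) ⟨0, h0, hf1⟩
    · refine tendsto_nhds_unique (hlf.tendsto_at h0) ?_
      simp only [(hF _).zero, tendsto_const_nhds]
  refine ⟨f, hf, fun w hw => ?_⟩
  by_contra hwf
  obtain ⟨Φ, hΦ, hlt⟩ := hf.exists_norm_deriv_lt hU hUc h0 (mem_ball_zero_iff.1 hw)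
    (fun z hz h => hwf ⟨z, hz, h⟩)
  exact absurd (hsup Φ hΦ) (not_le.2 hlt)

/-- The inverse Riemann map of a simply connected domain inside the unit disc, normalized to have
positive derivative at the origin. -/
theorem exists_riemann_map {U : Set ℂ} (hU : IsOpen U) (hUc : IsSimplyConnected U)
    (h0 : (0 : ℂ) ∈ U) (hUD : U ⊆ ball 0 1) {r : ℝ} (hr : 0 < r) (hrU : ball 0 r ⊆ U) :
    ∃ ψ φ : ℂ → ℂ, DifferentiableOn ℂ ψ (ball 0 1) ∧ ContinuousOn φ U ∧
      MapsTo ψ (ball 0 1) U ∧ MapsTo φ U (ball 0 1) ∧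
      (∀ z ∈ ball (0 : ℂ) 1, φ (ψ z) = z) ∧ (∀ z ∈ U, ψ (φ z) = z) ∧
      ψ 0 = 0 ∧ ∃ t : ℝ, r ≤ t ∧ deriv ψ 0 = t := by
  obtain ⟨φ, hφ, hsurj⟩ := exists_isConformalIntoDisc_surjOn hU hUc h0 hUD
  have hd0 := hφ.deriv_ne 0 h0
  set d := deriv φ 0 with hd
  set ε : ℂ := (‖d‖ : ℂ) / d with hε
  have hnd : (‖d‖ : ℂ) ≠ 0 := by simpa using hd0
  have hεn : ‖ε‖ = 1 := by simp [hε, hd0]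
  have hε0 : ε ≠ 0 := by rw [← norm_pos_iff, hεn]; exact one_pos
  set χ : ℂ → ℂ := fun z => ε * φ z with hχ
  have hχd : ∀ z ∈ U, HasDerivAt χ (ε * deriv φ z) z := fun z hz =>
    (hφ.diff.differentiableAt (hU.mem_nhds hz)).hasDerivAt.const_mul ε
  have hχc : ContinuousOn χ U := fun z hz => (hχd z hz).continuousAt.continuousWithinAt
  have hχm : MapsTo χ U (ball 0 1) := fun z hz => by
    have := hφ.mapsTo hz
    simpa [hχ, hεn] using this
  have hχi : InjOn χ U := fun a ha b hb h => hφ.injOn ha hb (mul_left_cancel₀ hε0 h)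
  have hχs : SurjOn χ U (ball 0 1) := fun w hw => by
    obtain ⟨z, hz, hzw⟩ := hsurj (show ε⁻¹ * w ∈ ball 0 1 by simpa [hεn] using hw)
    exact ⟨z, hz, by simp [hχ, hzw, hε0]⟩
  set ψ := Function.invFunOn χ U with hψ
  have hψm : MapsTo ψ (ball 0 1) U := fun w hw => Function.invFunOn_mem (hχs hw)
  have hχψ : ∀ z ∈ ball (0 : ℂ) 1, χ (ψ z) = z := fun z hz => Function.invFunOn_eq (hχs hz)
  have hψχ : ∀ z ∈ U, ψ (χ z) = z := fun z hz =>
    hχi (hψm (hχm hz)) hz (hχψ _ (hχm hz))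
  have hstrict : ∀ z ∈ U, HasStrictDerivAt χ (ε * deriv φ z) z := fun z hz => by
    have han : AnalyticAt ℂ χ z :=
      ((hφ.diff.const_mul ε).analyticOnNhd hU) z hz
    have := han.hasStrictDerivAt
    rwa [(hχd z hz).deriv] at this
  have hne : ∀ z ∈ U, ε * deriv φ z ≠ 0 := fun z hz => mul_ne_zero hε0 (hφ.deriv_ne z hz)
  have hψd : ∀ w ∈ ball (0 : ℂ) 1, HasDerivAt ψ (ε * deriv φ (ψ w))⁻¹ w := by
    intro w hw
    have hz := hψm hw
    have hcont : ContinuousAt ψ w := by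
      rw [ContinuousAt, Filter.tendsto_def]
      intro s hs
      have h1 : χ '' (s ∩ U) ∈ nhds (χ (ψ w)) := by
        rw [← (hstrict _ hz).map_nhds_eq (hne _ hz)]
        exact Filter.image_mem_map (Filter.inter_mem hs (hU.mem_nhds hz))
      rw [hχψ w hw] at h1
      filter_upwards [h1]
      rintro _ ⟨a, ⟨has, haU⟩, rfl⟩
      rw [mem_preimage, hψχ a haU]; exact has
    refine HasDerivAt.of_local_left_inverse hcont (hχd _ hz) (hne _ hz) ?_
    filter_upwards [isOpen_ball.mem_nhds hw] with y hy using hχψ y hy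
  have hχ0 : χ 0 = 0 := by simp [hχ, hφ.zero]
  have hψ0 : ψ 0 = 0 := by
    have := hψχ 0 h0
    rwa [hχ0] at this
  refine ⟨ψ, χ, fun w hw => (hψd w hw).differentiableAt.differentiableWithinAt, hχc, hψm, hχm,
    hχψ, hψχ, hψ0, ‖d‖⁻¹, ?_, ?_⟩
  -- The Schwarz lemma on `ball 0 r ⊆ U`. The lower bound `r ≤ ψ'(0)` is what later forces the
  -- exhausting maps to tend to the identity.
  · have h1 : ‖d‖ ≤ 1 / r := by
      refine norm_deriv_le_div_of_mapsTo_ball (hφ.diff.mono hrU) (fun z hz => ?_) hr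
      rw [hφ.zero]; exact ball_subset_closedBall (hφ.mapsTo (hrU hz))
    rw [le_inv_comm₀ hr (norm_pos_iff.2 hd0)]
    simpa using h1
  · rw [(hψd 0 (mem_ball_self one_pos)).deriv, hψ0, ← hd, hε]
    field_simp
    push_cast
    field_simp

/-! ### Schwarz' formula with radial boundary values. -/

/-- Schwarz' formula for the derivative in terms of the boundary values of the real part. -/
lemma deriv_eq_circleAverage_re {G : ℂ → ℂ} {R : ℝ} (hR : 1 < R)
    (hG : DifferentiableOn ℂ G (ball 0 R)) {z : ℂ} (hz : z ∈ ball (0 : ℂ) 1) :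
    deriv G z = Real.circleAverage
      (fun ζ => (2 * ζ / (ζ - z) ^ 2) • (((G ζ).re : ℝ) : ℂ)) 0 1 := by
  have hsub : closedBall (0 : ℂ) 1 ⊆ ball 0 R := closedBall_subset_ball hR
  have hGa : AnalyticOnNhd ℂ G (ball 0 R) := hG.analyticOnNhd isOpen_ball
  have hharm : InnerProductSpace.HarmonicOnNhd (fun w => (G w).re) (closedBall 0 1) :=
    fun w hw => (hGa w (hsub hw)).harmonicAt_re
  have hcont : ContinuousOn (fun w => (G w).re) (sphere 0 |1|) := by
    rw [abs_one]
    exact continuous_re.comp_continuousOn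
      (hG.continuousOn.mono (sphere_subset_closedBall.trans hsub))
  have hint : CircleIntegrable (fun w => (G w).re) 0 1 := hcont.circleIntegrable'
  have hint' : CircleIntegrable (fun w => (((G w).re : ℝ) : ℂ)) 0 1 :=
    (continuous_ofReal.comp_continuousOn hcont).circleIntegrable'
  set K : ℂ → ℂ := fun w => Real.circleAverage
    (fun ζ => herglotzRieszKernel 0 w ζ • (((G ζ).re : ℝ) : ℂ)) 0 1 with hK
  have hKd := hasDerivAt_circleAverage_herglotzRieszKernel_smul hint' hz
  have hKa : AnalyticOnNhd ℂ K (ball 0 1) :=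
    analyticOnNhd_circleAverage_herglotzRieszKernel_smul hint'
  have hre : ∀ w ∈ ball (0 : ℂ) 1, (G w - K w).re = 0 := by
    intro w hw
    rw [sub_re, hK]
    simp only
    rw [re_circleAverage_herglotzRieszKernel_smul hint hw,
      hharm.circleAverage_re_herglotzRieszKernel_smul hw, sub_self]
  -- The Herglotz integral `K` has the same real part as `G`, so both differ by a constant and have
  -- the same derivative.
  have hconst := ((hGa.mono (ball_subset_closedBall.trans hsub)).sub
    hKa).eq_const_of_re_eq_const hre isOpen_ball
    ⟨nonempty_ball.2 one_pos, (convex_ball (0 : ℂ) 1).isPreconnected⟩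
  obtain ⟨c, hc⟩ := hconst
  have heq : G =ᶠ[nhds z] fun w => K w + c := by
    filter_upwards [isOpen_ball.mem_nhds hz] with w hw
    have := hc w hw
    simp only [Pi.sub_apply] at this
    rw [← this]; ring
  rw [heq.deriv_eq]
  exact (hKd.add_const c).deriv

/-- The radial limit of `u` at `e^{iθ}` exists. -/
def HasRadialLimit (u : ℂ → ℝ) (θ y : ℝ) : Prop :=
  Filter.Tendsto (fun r : ℝ => u (r * exp (θ * I))) (nhdsWithin 1 (Iio 1)) (nhds y)

/-- The formula on the closed disc applies to the dilations `G(ρ_n z)`, `ρ_n = 1 - 1/(n+2)`. The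
bound `M` on the real part provides the dominating function as `ρ_n → 1`. -/
lemma deriv_eq_integral_radial_limit {G : ℂ → ℂ} (hG : DifferentiableOn ℂ G (ball 0 1)) {M : ℝ}
    (hM : ∀ z ∈ ball (0 : ℂ) 1, |(G z).re| ≤ M) {v : ℝ → ℝ}
    (hv : ∀ᵐ θ, HasRadialLimit (fun z => (G z).re) θ (v θ)) {z : ℂ} (hz : z ∈ ball (0 : ℂ) 1) :
    deriv G z = (2 * Real.pi)⁻¹ • ∫ θ in (0 : ℝ)..2 * Real.pi,
      (2 * exp (θ * I) / (exp (θ * I) - z) ^ 2) * (v θ : ℂ) := by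
  have hz1 : ‖z‖ < 1 := mem_ball_zero_iff.1 hz
  set ρ : ℕ → ℝ := fun n => 1 - 1 / ((n : ℝ) + 2) with hρ
  have hn2 : ∀ n : ℕ, (0 : ℝ) < (n : ℝ) + 2 := fun n => by positivity
  have hρ1 : ∀ n, ρ n < 1 := fun n => by
    simp only [hρ]; have := hn2 n; have : 0 < 1 / ((n : ℝ) + 2) := by positivity
    linarith
  have hρ0 : ∀ n, 0 < ρ n := fun n => by
    simp only [hρ]
    have := hn2 n
    have : 1 / ((n : ℝ) + 2) < 1 := by
      rw [div_lt_one this]; have : (0 : ℝ) ≤ n := Nat.cast_nonneg n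
      linarith
    linarith
  have hρt : Filter.Tendsto ρ Filter.atTop (nhds 1) := by
    have h1 : Filter.Tendsto (fun n : ℕ => 1 / ((n : ℝ) + 2)) Filter.atTop (nhds 0) := by
      simp only [one_div]
      exact (Filter.tendsto_atTop_add_const_right _ _ tendsto_natCast_atTop_atTop).inv_tendsto_atTop
    simpa [hρ] using h1.const_sub 1
  have hρt' : Filter.Tendsto ρ Filter.atTop (nhdsWithin 1 (Iio 1)) :=
    tendsto_nhdsWithin_iff.2 ⟨hρt, .of_forall hρ1⟩
  have hex : ∀ θ : ℝ, ‖exp (θ * I)‖ = 1 := norm_exp_ofReal_mul_I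
  have hmem : ∀ n θ, (ρ n : ℂ) * exp ((θ : ℝ) * I) ∈ ball (0 : ℂ) 1 := fun n θ => by
    simp [hex, abs_of_pos (hρ0 n), hρ1 n]
  have hformula : ∀ n, (ρ n : ℂ) * deriv G (ρ n * z) = (2 * Real.pi)⁻¹ •
      ∫ θ in (0 : ℝ)..2 * Real.pi, (2 * exp (θ * I) / (exp (θ * I) - z) ^ 2) *
        (((G (ρ n * exp (θ * I))).re : ℝ) : ℂ) := by
    intro n
    have hmaps : ∀ w ∈ ball (0 : ℂ) (1 / ρ n), (ρ n : ℂ) * w ∈ ball (0 : ℂ) 1 := fun w hw => by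
      rw [mem_ball_zero_iff] at hw ⊢
      rw [norm_mul, norm_real, Real.norm_of_nonneg (hρ0 n).le]
      rwa [lt_div_iff₀ (hρ0 n), mul_comm] at hw
    have h1 := deriv_eq_circleAverage_re (G := fun w => G (ρ n * w)) (R := 1 / ρ n)
      (by rw [lt_div_iff₀ (hρ0 n)]; simpa using hρ1 n)
      (hG.comp (by fun_prop) hmaps) hz
    have h2 : HasDerivAt (fun w => G (ρ n * w)) (deriv G (ρ n * z) * ρ n) z := by
      have hz' : (ρ n : ℂ) * z ∈ ball (0 : ℂ) 1 := hmaps z (by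
        rw [mem_ball_zero_iff]; refine hz1.trans ?_
        rw [lt_div_iff₀ (hρ0 n)]; simpa using hρ1 n)
      have h3 := (hG.differentiableAt (isOpen_ball.mem_nhds hz')).hasDerivAt
      have h4 := (hasDerivAt_id z).const_mul (ρ n : ℂ)
      have := HasDerivAt.comp z h3 h4
      simpa [Function.comp_def] using this
    rw [h2.deriv, mul_comm] at h1
    rw [h1, Real.circleAverage_def]
    simp [circleMap]
  have hlhs : Filter.Tendsto (fun n => (ρ n : ℂ) * deriv G (ρ n * z)) Filter.atTop
      (nhds (deriv G z)) := by
    have hρc : Filter.Tendsto (fun n => (ρ n : ℂ)) Filter.atTop (nhds 1) := by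
      simpa [Function.comp_def] using (continuous_ofReal.tendsto 1).comp hρt
    have hc : ContinuousAt (deriv G) z :=
      ((hG.deriv isOpen_ball).continuousOn).continuousAt (isOpen_ball.mem_nhds hz)
    have h2 : Filter.Tendsto (fun n => (ρ n : ℂ) * z) Filter.atTop (nhds z) := by
      simpa using hρc.mul_const z
    simpa using hρc.mul (hc.tendsto.comp h2)
  have hden : ∀ θ : ℝ, 1 - ‖z‖ ≤ ‖exp (θ * I) - z‖ := fun θ => by
    have := norm_sub_norm_le (exp (θ * I)) z
    rwa [hex] at this
  have hkb : ∀ θ : ℝ, ‖2 * exp (θ * I) / (exp (θ * I) - z) ^ 2‖ ≤ 2 / (1 - ‖z‖) ^ 2 := fun θ => by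
    rw [norm_div, norm_mul, hex, norm_pow, norm_ofNat, mul_one]
    have : 0 < 1 - ‖z‖ := by linarith
    gcongr
    exact hden θ
  have hkc : Continuous fun θ : ℝ => 2 * exp (θ * I) / (exp (θ * I) - z) ^ 2 := by
    refine Continuous.div (by fun_prop) (by fun_prop) fun θ => pow_ne_zero _ ?_
    rw [← norm_pos_iff]; linarith [hden θ]
  have hrhs : Filter.Tendsto (fun n => (2 * Real.pi)⁻¹ •
      ∫ θ in (0 : ℝ)..2 * Real.pi, (2 * exp (θ * I) / (exp (θ * I) - z) ^ 2) *
        (((G (ρ n * exp (θ * I))).re : ℝ) : ℂ)) Filter.atTop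
      (nhds ((2 * Real.pi)⁻¹ • ∫ θ in (0 : ℝ)..2 * Real.pi,
        (2 * exp (θ * I) / (exp (θ * I) - z) ^ 2) * (v θ : ℂ))) := by
    refine Filter.Tendsto.const_smul ?_ _
    refine intervalIntegral.tendsto_integral_filter_of_dominated_convergence
      (fun _ => 2 / (1 - ‖z‖) ^ 2 * M) (.of_forall fun n => ?_) (.of_forall fun n => ?_)
      (by simp) ?_
    · refine Continuous.aestronglyMeasurable (hkc.mul (continuous_ofReal.comp ?_))
      refine continuous_re.comp ?_
      exact hG.continuousOn.comp_continuous (by fun_prop) (hmem n)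
    · refine .of_forall fun θ _ => ?_
      rw [norm_mul, norm_real]
      gcongr
      · exact hkb θ
      · exact hM _ (hmem n θ)
    · filter_upwards [hv] with θ hθ _
      exact ((continuous_ofReal.tendsto _).comp (hθ.comp hρt')).const_mul _
  refine tendsto_nhds_unique hlhs ?_
  simp only [hformula]
  exact hrhs

/-! ### Monotone boundary data and the variation kernel. -/

open MeasureTheory in
/-- Integrating a monotone function against the derivative of a nonnegative function that vanishes
at both ends of an interval gives a nonpositive value. -/
lemma integral_deriv_mul_monotone_nonpos {a b : ℝ} (hab : a ≤ b) {W W' : ℝ → ℝ}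
    (hW : ∀ x, HasDerivAt W (W' x) x) (hW' : Continuous W') (ha : W a = 0) (hb : W b = 0)
    (hpos : ∀ x ∈ Icc a b, 0 ≤ W x) {g : ℝ → ℝ} (hg : Monotone g) :
    ∫ x in a..b, W' x * g x ≤ 0 := by
  have hftc : ∀ s t, ∫ x in s..t, W' x = W t - W s := fun s t =>
    intervalIntegral.integral_eq_sub_of_hasDerivAt (fun x _ => hW x) (hW'.intervalIntegrable _ _)
  -- Layer-cake decomposition: the superlevel sets of `g` are, up to null sets, intervals `(t, b]`,
  -- on which `W'` integrates to `W b - W t = -W t`. This replaces integration by parts against the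
  -- measure `dg`.
  have hlevel : ∀ c, ∫ x in Ioc a b, W' x * (if c < g x then 1 else 0) ≤ 0 := by
    intro c
    set T := {x ∈ Ioc a b | c < g x} with hT
    have hTm : MeasurableSet T := measurableSet_Ioc.inter (measurableSet_lt measurable_const
      hg.measurable)
    have h1 : ∫ x in Ioc a b, W' x * (if c < g x then 1 else 0) = ∫ x in T, W' x := by
      have : T = Ioc a b ∩ {x | c < g x} := rfl
      rw [this, ← setIntegral_indicator (measurableSet_lt measurable_const hg.measurable)]
      congr 1; ext x
      by_cases h : c < g x <;> simp [indicator, h]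
    rw [h1]
    rcases T.eq_empty_or_nonempty with h | hne
    · rw [h]; simp
    have hbdd : BddBelow T := ⟨a, fun x hx => hx.1.1.le⟩
    set t := sInf T with ht
    have hat : a ≤ t := le_csInf hne fun x hx => hx.1.1.le
    have htb : t ≤ b := by
      obtain ⟨x, hx⟩ := hne
      exact (csInf_le hbdd hx).trans hx.1.2
    have hae : T =ᵐ[volume] Ioc t b := by
      have hsub : Ioc t b ⊆ T := by
        intro x hx
        obtain ⟨y, hy, hyx⟩ := exists_lt_of_csInf_lt hne hx.1
        exact ⟨⟨hat.trans_lt hx.1, hx.2⟩, hy.2.trans_le (hg hyx.le)⟩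
      have hsub2 : T ⊆ Icc t b := fun x hx => ⟨csInf_le hbdd hx, hx.1.2⟩
      refine Filter.EventuallyLE.antisymm ?_ hsub.eventuallyLE
      exact hsub2.eventuallyLE.trans (Ioc_ae_eq_Icc (μ := volume)).symm.le
    rw [setIntegral_congr_set hae, ← intervalIntegral.integral_of_le htb, hftc, hb]
    linarith [hpos t ⟨hat, htb⟩]
  have hrep : ∀ x ∈ Ioc a b, ∫ c in Ioc (g a) (g b), (if c < g x then (1 : ℝ) else 0) =
      g x - g a := by
    intro x hx
    have h1 : (fun c => if c < g x then (1 : ℝ) else 0) = indicator (Iio (g x)) fun _ => 1 := by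
      ext c; simp [indicator]
    rw [h1, setIntegral_indicator measurableSet_Iio]
    have h2 : Ioc (g a) (g b) ∩ Iio (g x) = Ioo (g a) (g x) := by
      ext c
      simp only [mem_inter_iff, mem_Ioc, mem_Iio, mem_Ioo]
      exact ⟨fun h => ⟨h.1.1, h.2⟩, fun h => ⟨⟨h.1, h.2.le.trans (hg hx.2)⟩, h.2⟩⟩
    rw [h2]
    simp [measureReal_def, hg hx.1.le]
  obtain ⟨C, hC⟩ := (isCompact_Icc (a := a) (b := b)).exists_bound_of_continuousOn hW'.continuousOn
  have hgi : IntervalIntegrable g volume a b := hg.intervalIntegrable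
  -- Subtracting the constant `g a` is free because `W'` has integral zero; the difference `g x - g
  -- a` is then an integral of indicators over levels, and Fubini applies.
  have hsplit : ∫ x in a..b, W' x * g x = ∫ x in a..b, W' x * (g x - g a) := by
    have h1 : IntervalIntegrable (fun x => W' x * g x) volume a b :=
      hgi.continuousOn_mul hW'.continuousOn
    have h2 : ∫ x in a..b, W' x * g a = 0 := by
      rw [intervalIntegral.integral_mul_const, hftc, ha, hb]; simp
    have h2i : IntervalIntegrable (fun x => W' x * g a) volume a b :=
      (hW'.mul continuous_const).intervalIntegrable _ _
    simp only [mul_sub]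
    rw [intervalIntegral.integral_sub h1 (h2i), h2,
      sub_zero]
  rw [hsplit, intervalIntegral.integral_of_le hab]
  have h3 : ∫ x in Ioc a b, W' x * (g x - g a) =
      ∫ x in Ioc a b, ∫ c in Ioc (g a) (g b), W' x * (if c < g x then 1 else 0) := by
    refine setIntegral_congr_fun measurableSet_Ioc fun x hx => ?_
    rw [integral_const_mul, hrep x hx]
  rw [h3, integral_integral_swap]
  · exact integral_nonpos fun c => hlevel c
  · have hm : MeasurableSet {p : ℝ × ℝ | p.2 < g p.1} :=
      measurableSet_lt measurable_snd (hg.measurable.comp measurable_fst)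
    have hmeas : Measurable (Function.uncurry fun x c => W' x * (if c < g x then (1 : ℝ) else 0)) :=
      (hW'.measurable.comp measurable_fst).mul (Measurable.ite hm measurable_const measurable_const)
    rw [Measure.prod_restrict]
    refine Measure.integrableOn_of_bounded (M := C) ?_ hmeas.aestronglyMeasurable ?_
    · rw [Measure.prod_prod]
      exact ENNReal.mul_ne_top (by simp) (by simp)
    · refine ae_restrict_of_forall_mem (measurableSet_Ioc.prod measurableSet_Ioc) ?_
      rintro ⟨x, c⟩ ⟨hx, -⟩
      have h4 := hC x (Ioc_subset_Icc_self hx)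
      simp only [Function.uncurry]
      split_ifs
      · simpa using h4
      · simpa using (norm_nonneg _).trans h4

/-- The product of the tangential speed `2 Re (\bar λ ζ) + 2 b`, `ζ = e^{iθ}`, of the vector field
`i (λ + 2 b z + \bar λ z²)` with the Herglotz kernel. -/
noncomputable def herglotzWeight (l : ℂ) (b : ℝ) (z : ℂ) (θ : ℝ) : ℂ :=
  (((2 * (conj l * exp (θ * I)).re + 2 * b : ℝ)) : ℂ) *
    ((exp (θ * I) + z) / (exp (θ * I) - z))

lemma exp_mul_I_sub_ne_zero {z : ℂ} (hz : ‖z‖ < 1) (θ : ℝ) : exp (θ * I) - z ≠ 0 := by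
  intro h
  have h1 : exp (θ * I) = z := sub_eq_zero.1 h
  have h2 := norm_exp_ofReal_mul_I θ
  rw [h1] at h2; linarith

/-- The identity that drives the argument. The last term is purely imaginary, so in real parts the
kernel of Schwarz' formula, multiplied by the field at `z`, becomes an exact derivative along the
circle. The primitive is the tangential speed of the field times a positive Poisson kernel, hence
its sign is that of the speed. -/
lemma hasDerivAt_herglotzWeight (l : ℂ) (b : ℝ) {z : ℂ} (hz : ‖z‖ < 1) (θ : ℝ) :
    HasDerivAt (herglotzWeight l b z)
      (-(I * (l + 2 * b * z + conj l * z ^ 2)) * (2 * exp (θ * I) / (exp (θ * I) - z) ^ 2) +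
        ((2 * (conj l * exp (θ * I)).re : ℝ) : ℂ) * I) θ := by
  have hre : ∀ t : ℝ, ((2 * (conj l * exp (t * I)).re : ℝ) : ℂ) =
      conj l * exp (t * I) + l * (exp (t * I))⁻¹ := by
    intro t
    have h1 := add_conj (conj l * exp (t * I))
    rw [← h1, map_mul, conj_conj, ← exp_conj, ← exp_neg]
    simp
  have hW : herglotzWeight l b z = fun t : ℝ =>
      (conj l * exp (t * I) + l * (exp (t * I))⁻¹ + 2 * b) *
        ((exp (t * I) + z) / (exp (t * I) - z)) := by
    ext t
    rw [herglotzWeight, ofReal_add, hre]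
    push_cast; ring
  have hE : HasDerivAt (fun t : ℝ => exp (t * I)) (exp (θ * I) * I) θ := by
    have := ((hasDerivAt_id (θ : ℂ)).mul_const I).cexp.comp_ofReal
    simpa using this
  have hne := exp_mul_I_sub_ne_zero hz θ
  have h0 := exp_ne_zero (θ * I)
  rw [hW, hre]
  have h1 := ((hE.const_mul (conj l)).add ((hE.inv h0).const_mul l)).add_const (2 * b : ℂ)
  have h2 := (hE.add_const z).div (hE.sub_const z) hne
  refine (h1.mul h2).congr_deriv ?_
  simp only [Pi.add_apply, Pi.div_apply, Pi.inv_apply]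
  generalize exp (θ * I) = E at *
  field_simp
  ring

lemma re_herglotz_kernel_pos {z : ℂ} (hz : ‖z‖ < 1) (θ : ℝ) :
    0 < ((exp (θ * I) + z) / (exp (θ * I) - z)).re := by
  have hne := exp_mul_I_sub_ne_zero hz θ
  rw [div_re, ← add_div]
  refine div_pos ?_ (normSq_pos.2 hne)
  have h1 : ‖exp (θ * I)‖ ^ 2 = 1 := by rw [norm_exp_ofReal_mul_I]; simp
  have h2 : ‖z‖ ^ 2 < 1 := by nlinarith [norm_nonneg z]
  rw [← normSq_eq_norm_sq, normSq_apply] at h1 h2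
  simp only [add_re, sub_re, add_im, sub_im]
  nlinarith

lemma herglotzWeight_re (l : ℂ) (b : ℝ) (z : ℂ) (θ : ℝ) : (herglotzWeight l b z θ).re =
    (2 * (conj l * exp (θ * I)).re + 2 * b) * ((exp (θ * I) + z) / (exp (θ * I) - z)).re := by
  rw [herglotzWeight, re_ofReal_mul]

/-- The tangential speed of the field with zeros `e^{ip}` and `e^{iq}`. -/
lemma tangential_speed (p q θ : ℝ) :
    2 * (conj (exp (((p + q) / 2 : ℝ) * I)) * exp (θ * I)).re + 2 * (-Real.cos ((q - p) / 2)) =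
      4 * (Real.sin ((θ - p) / 2) * Real.sin ((q - θ) / 2)) := by
  have h1 : conj (exp (((p + q) / 2 : ℝ) * I)) * exp (θ * I) =
      exp ((θ - (p + q) / 2 : ℝ) * I) := by
    rw [← exp_conj, ← exp_add]; congr 1
    simp only [map_mul, conj_ofReal, conj_I]; push_cast; ring
  rw [h1, exp_ofReal_mul_I_re]
  have e1 : θ - (p + q) / 2 = (θ - p) / 2 - (q - θ) / 2 := by ring
  have e2 : (q - p) / 2 = (θ - p) / 2 + (q - θ) / 2 := by ring
  rw [e1, e2, Real.cos_sub, Real.cos_add]; ring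

/-- The derivative of the weight is, up to sign, the real part of the variation kernel. -/
noncomputable def weightDeriv (l : ℂ) (b : ℝ) (z : ℂ) (θ : ℝ) : ℝ :=
  -((I * (l + 2 * b * z + conj l * z ^ 2)) * (2 * exp (θ * I) / (exp (θ * I) - z) ^ 2)).re

lemma hasDerivAt_herglotzWeight_re (l : ℂ) (b : ℝ) {z : ℂ} (hz : ‖z‖ < 1) (θ : ℝ) :
    HasDerivAt (fun t => (herglotzWeight l b z t).re) (weightDeriv l b z θ) θ := by
  have h1 := hasDerivAt_herglotzWeight l b hz θ
  have h2 := reCLM.hasFDerivAt.comp_hasDerivAt θ h1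
  refine h2.congr_deriv ?_
  rw [reCLM_apply, add_re, re_ofReal_mul, I_re, mul_zero, add_zero, neg_mul, neg_re, weightDeriv]

lemma continuous_variation_kernel {z : ℂ} (hz : ‖z‖ < 1) :
    Continuous fun θ : ℝ => 2 * exp (θ * I) / (exp (θ * I) - z) ^ 2 :=
  Continuous.div (by fun_prop) (by fun_prop) fun θ => pow_ne_zero _ (exp_mul_I_sub_ne_zero hz θ)

lemma continuous_weightDeriv (l : ℂ) (b : ℝ) {z : ℂ} (hz : ‖z‖ < 1) :
    Continuous (weightDeriv l b z) :=
  (continuous_re.comp (continuous_const.mul (continuous_variation_kernel hz))).neg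

lemma weightDeriv_periodic (l : ℂ) (b : ℝ) (z : ℂ) :
    Function.Periodic (weightDeriv l b z) (2 * Real.pi) := by
  intro θ
  have : exp ((θ + 2 * Real.pi : ℝ) * I) = exp (θ * I) := by
    rw [← exp_periodic (θ * I)]; congr 1; push_cast; ring
  simp only [weightDeriv, this]

lemma abs_weightDeriv_le {l : ℂ} (hl : ‖l‖ = 1) {b : ℝ} (hb : |b| ≤ 1) {z : ℂ} (hz : ‖z‖ < 1)
    (θ : ℝ) : |weightDeriv l b z θ| ≤ 8 / (1 - ‖z‖) ^ 2 := by
  have hex := norm_exp_ofReal_mul_I θ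
  have hden : 1 - ‖z‖ ≤ ‖exp (θ * I) - z‖ := by
    have := norm_sub_norm_le (exp (θ * I)) z
    rwa [hex] at this
  have hpos : 0 < 1 - ‖z‖ := by linarith
  rw [weightDeriv, abs_neg]
  refine (abs_re_le_norm _).trans ?_
  rw [norm_mul, norm_mul, norm_I, one_mul, norm_div, norm_mul, hex, norm_pow, norm_ofNat, mul_one]
  have h1 : ‖l + 2 * b * z + conj l * z ^ 2‖ ≤ 4 := by
    refine (norm_add₃_le).trans ?_
    simp only [norm_mul, norm_pow, RCLike.norm_conj, hl, norm_real, norm_ofNat, Real.norm_eq_abs]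
    have : |b| * ‖z‖ ≤ 1 := mul_le_one₀ hb (norm_nonneg _) hz.le
    have : ‖z‖ ^ 2 ≤ 1 := pow_le_one₀ (norm_nonneg _) hz.le
    nlinarith
  calc ‖l + 2 * b * z + conj l * z ^ 2‖ * (2 / ‖exp (θ * I) - z‖ ^ 2)
      ≤ 4 * (2 / (1 - ‖z‖) ^ 2) := by gcongr
    _ = _ := by ring

/-- The boundary data of a bounded harmonic function without interlacing values: `v` is periodic,
and no four cyclically ordered points of `S` carry values alternately above and below a level. -/
structure NoInterlacing (S : Set ℝ) (v : ℝ → ℝ) : Prop where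
  ae : ∀ᵐ θ, θ ∈ S
  mem_periodic : Function.Periodic (fun θ => θ ∈ S) (2 * Real.pi)
  periodic : Function.Periodic v (2 * Real.pi)
  not_interlacing : ∀ c, ∀ θ₁ ∈ S, ∀ θ₂ ∈ S, ∀ θ₃ ∈ S, ∀ θ₄ ∈ S, θ₁ < θ₂ → θ₂ < θ₃ → θ₃ < θ₄ →
    θ₄ < θ₁ + 2 * Real.pi → c < v θ₁ → v θ₂ < c → c < v θ₃ → v θ₄ < c → False

/-- Supplies a level strictly inside `(A, B)`, so that the points carrying the values `A` and `B`
complete an interlacing quadruple. -/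
lemma clamp_lt_clamp {A B x y : ℝ} (h : max A (min y B) < max A (min x B)) :
    ∃ c, A < c ∧ y < c ∧ c < x ∧ c < B := by
  have h1 : max A y < min x B := by
    rw [max_lt_iff] at h
    obtain ⟨h1, h2⟩ := h
    rcases le_total A (min x B) with h3 | h3
    · rw [max_eq_right h3] at h1 h2
      refine max_lt h1 ?_
      rcases le_total y B with h4 | h4
      · rwa [min_eq_left h4] at h2
      · rw [min_eq_right h4] at h2
        exact absurd (h2.trans_le (min_le_right _ _)) (lt_irrefl _)
    · rw [max_eq_left h3] at h1; exact absurd h1 (lt_irrefl _)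
  obtain ⟨c, hc1, hc2⟩ := exists_between h1
  exact ⟨c, (le_max_left _ _).trans_lt hc1, (le_max_right _ _).trans_lt hc1,
    hc2.trans_le (min_le_left _ _), hc2.trans_le (min_le_right _ _)⟩

namespace NoInterlacing
variable {S : Set ℝ} {v : ℝ → ℝ}

lemma mem_add (h : NoInterlacing S v) (p : ℝ) (hp : p ∈ S) : p + 2 * Real.pi ∈ S :=
  (h.mem_periodic p).mpr hp

/-- A drop from `x` to `y` across a level between `v p` and `v q` would make `x, y, q, p + 2π`
interlacing; for `antitoneOn_clamp` the quadruple is `q, x, y, p + 2π`. Without clamping, values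
outside `[v p, v q]` would escape this argument. -/
lemma monotoneOn_clamp (h : NoInterlacing S v) {p q : ℝ} (hp : p ∈ S) (hq : q ∈ S)
    (hqp : q < p + 2 * Real.pi) (hv : v p < v q) :
    MonotoneOn (fun θ => max (v p) (min (v θ) (v q))) (S ∩ Icc p q) := by
  intro x hx y hy hxy
  by_contra hlt
  obtain ⟨c, h1, h2, h3, h4⟩ := clamp_lt_clamp (not_le.1 hlt)
  have hxy' : x < y := lt_of_le_of_ne hxy (by rintro rfl; exact lt_asymm h2 h3)
  have hpx : p < x := lt_of_le_of_ne hx.2.1 (by rintro rfl; exact lt_asymm h1 h3)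
  have hyq : y < q := lt_of_le_of_ne hy.2.2 (by rintro rfl; exact lt_asymm h2 h4)
  exact h.not_interlacing c x hx.1 y hy.1 q hq _ (h.mem_add p hp) hxy' hyq hqp (by linarith)
    h3 h2 h4 (by rwa [h.periodic])

lemma antitoneOn_clamp (h : NoInterlacing S v) {p q : ℝ} (hp : p ∈ S) (hq : q ∈ S)
    (hpq : p < q) :
    AntitoneOn (fun θ => max (v p) (min (v θ) (v q))) (S ∩ Icc q (p + 2 * Real.pi)) := by
  intro x hx y hy hxy
  by_contra hlt
  obtain ⟨c, h1, h2, h3, h4⟩ := clamp_lt_clamp (not_le.1 hlt)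
  have hxy' : x < y := lt_of_le_of_ne hxy (by rintro rfl; exact lt_asymm h2 h3)
  have hqx : q < x := lt_of_le_of_ne hx.2.1 (by rintro rfl; exact lt_asymm h2 h4)
  have hyp : y < p + 2 * Real.pi := lt_of_le_of_ne hy.2.2 (by
    rintro rfl; rw [h.periodic] at h3; exact lt_asymm h1 h3)
  exact h.not_interlacing c q hq x hx.1 y hy.1 _ (h.mem_add p hp) hqx hxy' hyp (by linarith)
    h4 h2 h3 (by rwa [h.periodic])

-- Here `p` and `q` nearly minimize and maximize `v`. The weight vanishes at `p` and `q`, is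
-- nonnegative on `[p, q]`, where the clamped data rise, and nonpositive on `[q, p + 2π]`, where
-- they fall, so the clamped data contribute at most zero. Clamping costs at most `ε` pointwise,
-- hence the right-hand side.
open MeasureTheory in
lemma integral_weightDeriv_mul_le (h : NoInterlacing S v) (hvm : AEStronglyMeasurable v)
    {p q : ℝ} (hp : p ∈ S) (hq : q ∈ S) (hpq : p < q) (hqp : q < p + 2 * Real.pi) (hv : v p < v q)
    {ε : ℝ} (hε : ∀ θ ∈ S, v p - ε ≤ v θ ∧ v θ ≤ v q + ε) (hε0 : 0 ≤ ε) {z : ℂ} (hz : ‖z‖ < 1) :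
    ∫ θ in (0 : ℝ)..2 * Real.pi, weightDeriv (exp (((p + q) / 2 : ℝ) * I))
      (-Real.cos ((q - p) / 2)) z θ * v θ ≤ 2 * Real.pi * (8 / (1 - ‖z‖) ^ 2 * ε) := by
  set l := exp (((p + q) / 2 : ℝ) * I) with hl
  set b := -Real.cos ((q - p) / 2) with hb
  have hl1 : ‖l‖ = 1 := norm_exp_ofReal_mul_I _
  have hb1 : |b| ≤ 1 := by rw [hb, abs_neg]; exact Real.abs_cos_le_one _
  set C := 8 / (1 - ‖z‖) ^ 2 with hC
  have hC0 : 0 ≤ C := by positivity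
  set N := weightDeriv l b z with hN
  set W := fun t => (herglotzWeight l b z t).re with hW
  have hWd : ∀ t, HasDerivAt W (N t) t := hasDerivAt_herglotzWeight_re l b hz
  have hNc : Continuous N := continuous_weightDeriv l b hz
  have hWs : ∀ t, W t = 4 * (Real.sin ((t - p) / 2) * Real.sin ((q - t) / 2)) *
      ((exp (t * I) + z) / (exp (t * I) - z)).re := fun t => by
    rw [hW]; simp only; rw [herglotzWeight_re, tangential_speed]
  have hWp : W p = 0 := by rw [hWs]; simp
  have hWq : W q = 0 := by rw [hWs]; simp
  have hWp' : W (p + 2 * Real.pi) = 0 := by rw [hWs]; simp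
  set w := fun θ => max (v p) (min (v θ) (v q)) with hw
  have hwb : ∀ θ, v p ≤ w θ ∧ w θ ≤ v q := fun θ =>
    ⟨le_max_left _ _, max_le hv.le (min_le_right _ _)⟩
  have hwm : AEStronglyMeasurable w :=
    (aestronglyMeasurable_const.sup (hvm.inf aestronglyMeasurable_const))
  have hwi : ∀ s t, IntervalIntegrable w volume s t := fun s t => by
    rw [intervalIntegrable_iff]
    refine Measure.integrableOn_of_bounded (M := max |v p| |v q|) (by simp)
      hwm (.of_forall fun θ => ?_)
    exact abs_le_max_abs_abs (hwb θ).1 (hwb θ).2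
  have hdiff : ∀ θ ∈ S, |v θ - w θ| ≤ ε := by
    intro θ hθ
    obtain ⟨h1, h2⟩ := hε θ hθ
    rw [abs_le, hw]
    simp only
    rcases le_total (v θ) (v q) with h3 | h3
    · rw [min_eq_left h3]
      rcases le_total (v p) (v θ) with h4 | h4
      · rw [max_eq_right h4]; constructor <;> linarith
      · rw [max_eq_left h4]; constructor <;> linarith
    · rw [min_eq_right h3, max_eq_right hv.le]; constructor <;> linarith
  have hvi : ∀ s t, IntervalIntegrable v volume s t := fun s t => by
    have h1 : IntervalIntegrable (fun θ => v θ - w θ) volume s t := by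
      rw [intervalIntegrable_iff]
      refine Measure.integrableOn_of_bounded (M := ε) (by simp)
        (hvm.sub hwm) (ae_restrict_of_ae ?_)
      filter_upwards [h.ae] with θ hθ using hdiff θ hθ
    simpa using h1.add (hwi s t)
  have hmono : ∀ s t, s ≤ t → MonotoneOn w (S ∩ Icc s t) → W s = 0 → W t = 0 →
      (∀ x ∈ Icc s t, 0 ≤ W x) → ∫ θ in s..t, N θ * w θ ≤ 0 := by
    intro s t hst hm hs ht hpos
    -- The data are monotone only on the full-measure set `S`; a monotone extension to the line has
    -- the same integral.
    obtain ⟨g, hg, hgw⟩ := hm.exists_monotone_extension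
      ⟨v p, by rintro _ ⟨θ, -, rfl⟩; exact (hwb θ).1⟩ ⟨v q, by rintro _ ⟨θ, -, rfl⟩; exact (hwb θ).2⟩
    rw [intervalIntegral.integral_congr_ae (g := fun θ => N θ * g θ)]
    · exact integral_deriv_mul_monotone_nonpos hst hWd hNc hs ht hpos hg
    · filter_upwards [h.ae] with θ hθ hθ2
      rw [uIoc_of_le hst] at hθ2
      rw [hgw ⟨hθ, Ioc_subset_Icc_self hθ2⟩]
  have hanti : ∀ s t, s ≤ t → AntitoneOn w (S ∩ Icc s t) → W s = 0 → W t = 0 →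
      (∀ x ∈ Icc s t, W x ≤ 0) → ∫ θ in s..t, N θ * w θ ≤ 0 := by
    intro s t hst hm hs ht hpos
    obtain ⟨g, hg, hgw⟩ := (hm.neg).exists_monotone_extension
      ⟨-v q, by rintro _ ⟨θ, -, rfl⟩; exact neg_le_neg (hwb θ).2⟩
      ⟨-v p, by rintro _ ⟨θ, -, rfl⟩; exact neg_le_neg (hwb θ).1⟩
    rw [intervalIntegral.integral_congr_ae (g := fun θ => -N θ * g θ)]
    · exact integral_deriv_mul_monotone_nonpos hst (W := fun x => -W x) (fun x => (hWd x).neg)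
        hNc.neg (by simp [hs]) (by simp [ht]) (fun x hx => neg_nonneg.2 (hpos x hx)) hg
    · filter_upwards [h.ae] with θ hθ hθ2
      rw [uIoc_of_le hst] at hθ2
      have h1 : -w θ = g θ := hgw ⟨hθ, Ioc_subset_Icc_self hθ2⟩
      rw [← h1]; ring
  have i1 := hmono p q hpq.le (h.monotoneOn_clamp hp hq hqp hv) hWp hWq (by
    intro x hx
    rw [hWs]
    have s1 : 0 ≤ Real.sin ((x - p) / 2) :=
      Real.sin_nonneg_of_nonneg_of_le_pi (by linarith [hx.1]) (by linarith [hx.2])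
    have s2 : 0 ≤ Real.sin ((q - x) / 2) :=
      Real.sin_nonneg_of_nonneg_of_le_pi (by linarith [hx.2]) (by linarith [hx.1])
    have s3 := re_herglotz_kernel_pos hz x
    positivity)
  have i2 := hanti q (p + 2 * Real.pi) hqp.le (h.antitoneOn_clamp hp hq hpq) hWq hWp' (by
    intro x hx
    rw [hWs]
    have s1 : 0 ≤ Real.sin ((x - p) / 2) :=
      Real.sin_nonneg_of_nonneg_of_le_pi (by linarith [hx.1]) (by linarith [hx.2])
    have s2 : Real.sin ((q - x) / 2) ≤ 0 :=
      Real.sin_nonpos_of_nonpos_of_neg_pi_le (by linarith [hx.1]) (by linarith [hx.2])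
    have s3 := re_herglotz_kernel_pos hz x
    have s4 := mul_nonpos_of_nonneg_of_nonpos s1 s2
    nlinarith)
  have hper : Function.Periodic (fun θ => N θ * v θ) (2 * Real.pi) :=
    (weightDeriv_periodic l b z).mul h.periodic
  have hNw : ∀ s t, IntervalIntegrable (fun θ => N θ * w θ) volume s t := fun s t =>
    (hwi s t).continuousOn_mul hNc.continuousOn
  have hNd : ∀ s t, IntervalIntegrable (fun θ => N θ * (v θ - w θ)) volume s t := fun s t =>
    ((hvi s t).sub (hwi s t)).continuousOn_mul hNc.continuousOn
  have e1 : ∫ θ in (0 : ℝ)..2 * Real.pi, N θ * v θ = ∫ θ in p..p + 2 * Real.pi, N θ * v θ := by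
    have := hper.intervalIntegral_add_eq 0 p
    simpa using this
  have e2 : ∫ θ in p..p + 2 * Real.pi, N θ * v θ = (∫ θ in p..p + 2 * Real.pi, N θ * w θ) +
      ∫ θ in p..p + 2 * Real.pi, N θ * (v θ - w θ) := by
    rw [← intervalIntegral.integral_add (hNw _ _) (hNd _ _)]
    congr 1; ext θ; ring
  have e3 := intervalIntegral.integral_add_adjacent_intervals (hNw p q) (hNw q (p + 2 * Real.pi))
  have e4 : ∫ θ in p..p + 2 * Real.pi, N θ * (v θ - w θ) ≤ C * ε * |p + 2 * Real.pi - p| := by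
    refine (le_abs_self _).trans ?_
    rw [← Real.norm_eq_abs]
    refine intervalIntegral.norm_integral_le_of_norm_le_const_ae ?_
    filter_upwards [h.ae] with θ hθ _
    rw [norm_mul]
    exact mul_le_mul (abs_weightDeriv_le hl1 hb1 hz θ) (hdiff θ hθ) (norm_nonneg _) hC0
  rw [add_sub_cancel_left, abs_of_pos (by positivity)] at e4
  rw [e1, e2, ← e3]
  linarith

end NoInterlacing

/-- Limits of approximate solutions of `0 ≤ Im ((λ + 2 b z + \bar λ z²) d(z))`. -/
lemma exists_direction_of_tendsto {D : ℕ → ℂ → ℂ} {d : ℂ → ℂ} {e : ℕ → ℂ → ℝ} {A : Set ℝ}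
    (hA : IsCompact A)
    (hD : ∀ z ∈ ball (0 : ℂ) 1, Filter.Tendsto (fun n => D n z) Filter.atTop (nhds (d z)))
    (he : ∀ z ∈ ball (0 : ℂ) 1, Filter.Tendsto (fun n => e n z) Filter.atTop (nhds 0))
    (h : ∀ n, ∃ l : ℂ, ‖l‖ = 1 ∧ ∃ b ∈ A, ∀ z ∈ ball (0 : ℂ) 1,
      -e n z ≤ ((l + 2 * (b : ℝ) * z + conj l * z ^ 2) * D n z).im) :
    ∃ l : ℂ, ‖l‖ = 1 ∧ ∃ b ∈ A, ∀ z ∈ ball (0 : ℂ) 1,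
      0 ≤ ((l + 2 * (b : ℝ) * z + conj l * z ^ 2) * d z).im := by
  choose l hl b hb hlb using h
  obtain ⟨⟨l₀, b₀⟩, ⟨hl₀, hb₀⟩, φ, hφ, hlim⟩ := ((isCompact_sphere (0 : ℂ) 1).prod hA).tendsto_subseq
    (x := fun n => (l n, b n)) (fun n => ⟨by simpa using hl n, hb n⟩)
  refine ⟨l₀, by simpa using hl₀, b₀, hb₀, fun z hz => ?_⟩
  have h1 : Filter.Tendsto (fun n => l (φ n)) Filter.atTop (nhds l₀) :=
    (continuous_fst.tendsto _).comp hlim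
  have h2 : Filter.Tendsto (fun n => ((b (φ n) : ℝ) : ℂ)) Filter.atTop (nhds b₀) :=
    (continuous_ofReal.tendsto _).comp ((continuous_snd.tendsto _).comp hlim)
  have h3 := (hD z hz).comp hφ.tendsto_atTop
  have h4 := (he z hz).comp hφ.tendsto_atTop
  have h5 : Filter.Tendsto (fun n => ((l (φ n) + 2 * (b (φ n) : ℝ) * z + conj (l (φ n)) * z ^ 2) *
      D (φ n) z).im) Filter.atTop (nhds ((l₀ + 2 * (b₀ : ℝ) * z + conj l₀ * z ^ 2) * d z).im) := by
    refine (continuous_im.tendsto _).comp (Filter.Tendsto.mul ?_ h3)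
    exact (h1.add ((h2.const_mul 2).mul_const z)).add
      (((continuous_conj.tendsto _).comp h1).mul_const _)
  have h6 := h4.neg
  rw [neg_zero] at h6
  exact le_of_tendsto_of_tendsto' h6 h5 fun n => hlb _ z hz

open MeasureTheory in
lemma aestronglyMeasurable_radial_limit {u : ℂ → ℝ} (hu : ContinuousOn u (ball 0 1)) {v : ℝ → ℝ}
    (hv : ∀ᵐ θ, HasRadialLimit u θ (v θ)) : AEStronglyMeasurable v := by
  have hn : ∀ n : ℕ, 0 < 1 - 1 / ((n : ℝ) + 2) ∧ 1 - 1 / ((n : ℝ) + 2) < 1 := fun n => by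
    have h1 : (0 : ℝ) < (n : ℝ) + 2 := by positivity
    have h2 : 0 < 1 / ((n : ℝ) + 2) := by positivity
    have h3 : 1 / ((n : ℝ) + 2) < 1 := by
      rw [div_lt_one h1]; have : (0 : ℝ) ≤ n := Nat.cast_nonneg n
      linarith
    constructor <;> linarith
  have ht : Filter.Tendsto (fun n : ℕ => 1 - 1 / ((n : ℝ) + 2)) Filter.atTop
      (nhdsWithin 1 (Iio 1)) := by
    refine tendsto_nhdsWithin_iff.2 ⟨?_, .of_forall fun n => (hn n).2⟩
    have h1 : Filter.Tendsto (fun n : ℕ => 1 / ((n : ℝ) + 2)) Filter.atTop (nhds 0) := by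
      simp only [one_div]
      exact (Filter.tendsto_atTop_add_const_right _ _ tendsto_natCast_atTop_atTop).inv_tendsto_atTop
    simpa using h1.const_sub 1
  refine aestronglyMeasurable_of_tendsto_ae (μ := volume) (g := v) Filter.atTop
    (f := fun (n : ℕ) (θ : ℝ) => u ((1 - 1 / ((n : ℝ) + 2) : ℝ) * exp (θ * I))) (fun n => ?_) ?_
  · refine (hu.comp_continuous (by fun_prop) fun θ => ?_).aestronglyMeasurable
    rw [mem_ball_zero_iff, norm_mul, norm_exp_ofReal_mul_I, norm_real,
      Real.norm_of_nonneg (hn n).1.le, mul_one]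
    exact (hn n).2
  · filter_upwards [hv] with θ hθ
    exact hθ.comp ht

open MeasureTheory in
/-- The field `i (λ + 2 b z + \bar λ z²)` applied to a holomorphic function, in terms of the radial
limits of the real part. -/
lemma im_mul_deriv_eq_integral {G : ℂ → ℂ} (hG : DifferentiableOn ℂ G (ball 0 1)) {M : ℝ}
    (hM : ∀ z ∈ ball (0 : ℂ) 1, |(G z).re| ≤ M) {v : ℝ → ℝ}
    (hv : ∀ᵐ θ, HasRadialLimit (fun z => (G z).re) θ (v θ)) (hvM : ∀ᵐ θ, |v θ| ≤ M)
    {z : ℂ} (hz : z ∈ ball (0 : ℂ) 1) (l : ℂ) (b : ℝ) :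
    ((l + 2 * b * z + conj l * z ^ 2) * deriv G z).im =
      (2 * Real.pi)⁻¹ * ∫ θ in (0 : ℝ)..2 * Real.pi, weightDeriv l b z θ * v θ := by
  have hz1 := mem_ball_zero_iff.1 hz
  have hvm : AEStronglyMeasurable v := aestronglyMeasurable_radial_limit
    (continuous_re.comp_continuousOn hG.continuousOn) hv
  have hvi : IntervalIntegrable (fun θ => ((v θ : ℝ) : ℂ)) volume 0 (2 * Real.pi) := by
    rw [intervalIntegrable_iff]
    refine Measure.integrableOn_of_bounded (M := M)
      (by rw [uIoc_of_le (by positivity)]; exact measure_Ioc_lt_top.ne)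
      (continuous_ofReal.comp_aestronglyMeasurable hvm) (ae_restrict_of_ae ?_)
    filter_upwards [hvM] with θ hθ
    simpa using hθ
  set k := fun θ : ℝ => 2 * exp (θ * I) / (exp (θ * I) - z) ^ 2 with hk
  have hkc : Continuous k := continuous_variation_kernel hz1
  have hki := hvi.continuousOn_mul (g := k) hkc.continuousOn
  set P := l + 2 * b * z + conj l * z ^ 2 with hP
  have h1 : (P * deriv G z).im = -((I * P) * deriv G z).re := by
    rw [mul_assoc, mul_comm I, mul_I_re, neg_neg]
  rw [h1, deriv_eq_integral_radial_limit hG hM hv hz, mul_smul_comm, ← intervalIntegral.integral_const_mul, smul_re,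
    ← reCLM_apply, ← reCLM.intervalIntegral_comp_comm (hki.const_mul (I * P)), smul_eq_mul, ← mul_neg,
    ← intervalIntegral.integral_neg]
  congr 2
  ext θ
  simp only [reCLM_apply, weightDeriv]
  rw [← mul_assoc, mul_comm (I * P * _), re_ofReal_mul, neg_mul, mul_comm (v θ)]

/-- Radial boundary values without interlacing determine a hyperbolic or parabolic direction in which
the real part increases. -/
theorem exists_direction_of_noInterlacing {G : ℂ → ℂ} (hG : DifferentiableOn ℂ G (ball 0 1)) {M : ℝ}
    (hM : ∀ z ∈ ball (0 : ℂ) 1, |(G z).re| ≤ M) {S : Set ℝ} {v : ℝ → ℝ} (h : NoInterlacing S v)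
    (hS : ∀ θ ∈ S, HasRadialLimit (fun z => (G z).re) θ (v θ)) :
    ∃ l : ℂ, ‖l‖ = 1 ∧ ∃ b ∈ Icc (-1 : ℝ) 1, ∀ z ∈ ball (0 : ℂ) 1,
      0 ≤ ((l + 2 * (b : ℝ) * z + conj l * z ^ 2) * deriv G z).im := by
  have hv : ∀ᵐ θ, HasRadialLimit (fun z => (G z).re) θ (v θ) := h.ae.mono hS
  have hbd : ∀ θ ∈ S, |v θ| ≤ M := by
    intro θ hθ
    refine le_of_tendsto (hS θ hθ).abs ?_
    have : Ioo (0 : ℝ) 1 ∈ nhdsWithin 1 (Iio 1) := Ioo_mem_nhdsLT one_pos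
    filter_upwards [this] with r hr
    refine hM _ ?_
    rw [mem_ball_zero_iff, norm_mul, norm_exp_ofReal_mul_I, norm_real, Real.norm_of_nonneg hr.1.le,
      mul_one]
    exact hr.2
  have hvM : ∀ᵐ θ, |v θ| ≤ M := h.ae.mono hbd
  have hvm := aestronglyMeasurable_radial_limit (continuous_re.comp_continuousOn hG.continuousOn) hv
  have hformula := fun (z : ℂ) (hz : z ∈ ball (0 : ℂ) 1) =>
    im_mul_deriv_eq_integral hG hM hv hvM hz
  have hSne : S.Nonempty := by
    obtain ⟨θ, hθ⟩ := h.ae.exists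
    exact ⟨θ, hθ⟩
  have hbelow : BddBelow (v '' S) := ⟨-M, by
    rintro _ ⟨θ, hθ, rfl⟩; exact (abs_le.1 (hbd θ hθ)).1⟩
  have habove : BddAbove (v '' S) := ⟨M, by
    rintro _ ⟨θ, hθ, rfl⟩; exact (abs_le.1 (hbd θ hθ)).2⟩
  have hinf : ∀ θ ∈ S, sInf (v '' S) ≤ v θ := fun θ hθ => csInf_le hbelow ⟨θ, hθ, rfl⟩
  have hsup : ∀ θ ∈ S, v θ ≤ sSup (v '' S) := fun θ hθ => le_csSup habove ⟨θ, hθ, rfl⟩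
  have hpi := Real.pi_pos
  -- Constant boundary values leave no pair `p`, `q` to choose, but then every direction works: the
  -- integrand is a constant times the derivative of a periodic function.
  rcases le_or_gt (sSup (v '' S)) (sInf (v '' S)) with hle | hlt
  · have hconst : ∀ θ ∈ S, v θ = sInf (v '' S) := fun θ hθ =>
      le_antisymm ((hsup θ hθ).trans hle) (hinf θ hθ)
    refine ⟨1, norm_one, 0, by simp, fun z hz => ?_⟩
    have hz1 := mem_ball_zero_iff.1 hz
    rw [hformula z hz 1 0, intervalIntegral.integral_congr_ae
      (g := fun θ => weightDeriv 1 0 z θ * sInf (v '' S)) (by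
        filter_upwards [h.ae] with θ hθ _
        rw [hconst θ hθ]), intervalIntegral.integral_mul_const,
      intervalIntegral.integral_eq_sub_of_hasDerivAt
        (fun θ _ => hasDerivAt_herglotzWeight_re 1 0 hz1 θ)
        ((continuous_weightDeriv 1 0 hz1).intervalIntegrable _ _)]
    have : herglotzWeight 1 0 z (2 * Real.pi) = herglotzWeight 1 0 z 0 := by
      simp [herglotzWeight]
    rw [this]; simp
  · have key : ∀ ε > 0, ∃ l : ℂ, ‖l‖ = 1 ∧ ∃ b ∈ Icc (-1 : ℝ) 1, ∀ z ∈ ball (0 : ℂ) 1,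
        -(8 / (1 - ‖z‖) ^ 2 * ε) ≤ ((l + 2 * (b : ℝ) * z + conj l * z ^ 2) * deriv G z).im := by
      intro ε₀ hε₀
      -- Half of the oscillation guarantees `v p < v q₀`.
      set ε := min ε₀ ((sSup (v '' S) - sInf (v '' S)) / 2) with hε
      have hε0 : 0 < ε := lt_min hε₀ (by linarith)
      obtain ⟨_, ⟨p, hp, rfl⟩, hpv⟩ := exists_lt_of_csInf_lt (hSne.image v)
        (show sInf (v '' S) < sInf (v '' S) + ε by linarith)
      obtain ⟨_, ⟨q₀, hq₀, rfl⟩, hqv⟩ := exists_lt_of_lt_csSup (hSne.image v)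
        (show sSup (v '' S) - ε < sSup (v '' S) by linarith)
      have hpq : v p < v q₀ := by
        have := min_le_right ε₀ ((sSup (v '' S) - sInf (v '' S)) / 2)
        rw [← hε] at this
        linarith
      have h2pi : 0 < 2 * Real.pi := by linarith
      set q := toIocMod h2pi p q₀ with hq
      have hqe : q = q₀ - toIocDiv h2pi p q₀ • (2 * Real.pi) :=
        (self_sub_toIocDiv_zsmul h2pi p q₀).symm
      have hvq : v q = v q₀ := by rw [hqe]; exact h.periodic.sub_zsmul_eq _
      have hqS : q ∈ S := by
        rw [hqe]; exact (h.mem_periodic.sub_zsmul_eq (toIocDiv h2pi p q₀) (x := q₀)).mpr hq₀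
      obtain ⟨hq1, hq2⟩ := toIocMod_mem_Ioc h2pi p q₀
      rw [← hq] at hq1 hq2
      have hq3 : q < p + 2 * Real.pi := by
        refine lt_of_le_of_ne hq2 fun h' => ?_
        rw [h', h.periodic] at hvq
        exact hpq.ne hvq
      rw [← hvq] at hpq hqv
      -- The estimate bounds the integral from above; negating both `l` and `b` turns it into the
      -- lower bound.
      refine ⟨-exp (((p + q) / 2 : ℝ) * I), by rw [norm_neg]; exact norm_exp_ofReal_mul_I _,
        Real.cos ((q - p) / 2), ⟨Real.neg_one_le_cos _, Real.cos_le_one _⟩, fun z hz => ?_⟩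
      have hz1 := mem_ball_zero_iff.1 hz
      have hb := h.integral_weightDeriv_mul_le hvm hp hqS hq1 hq3 hpq (ε := ε)
        (fun θ hθ => ⟨by linarith [hinf θ hθ], by linarith [hsup θ hθ]⟩) hε0.le hz1
      have hf := hformula z hz (exp (((p + q) / 2 : ℝ) * I)) (-Real.cos ((q - p) / 2))
      have hneg : (-exp (((p + q) / 2 : ℝ) * I) + 2 * (Real.cos ((q - p) / 2) : ℝ) * z +
          conj (-exp (((p + q) / 2 : ℝ) * I)) * z ^ 2) * deriv G z =
          -((exp (((p + q) / 2 : ℝ) * I) + 2 * ((-Real.cos ((q - p) / 2) : ℝ) : ℂ) * z +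
          conj (exp (((p + q) / 2 : ℝ) * I)) * z ^ 2) * deriv G z) := by
        rw [map_neg, ofReal_neg]; ring
      rw [hneg, neg_im, hf, neg_le_neg_iff, inv_mul_le_iff₀ (by positivity)]
      refine hb.trans ?_
      have hεε : ε ≤ ε₀ := min_le_left _ _
      gcongr
    refine exists_direction_of_tendsto (D := fun _ => deriv G) (d := deriv G)
      (e := fun n z => 8 / (1 - ‖z‖) ^ 2 * (1 / ((n : ℝ) + 1))) isCompact_Icc
      (fun z _ => tendsto_const_nhds) (fun z _ => ?_) (fun n => key _ (by positivity))
    simpa using (tendsto_one_div_add_atTop_nhds_zero_nat (𝕜 := ℝ)).const_mul (8 / (1 - ‖z‖) ^ 2)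

/-- A bounded holomorphic function whose real part has path connected super- and sublevel sets and
radial limits almost everywhere has a direction in which the real part increases. -/
theorem exists_direction_of_connected_levels {G : ℂ → ℂ} (hG : DifferentiableOn ℂ G (ball 0 1))
    {M : ℝ} (hM : ∀ z ∈ ball (0 : ℂ) 1, |(G z).re| ≤ M)
    (hrad : ∀ᵐ θ, ∃ y, HasRadialLimit (fun z => (G z).re) θ y)
    (hup : ∀ c, ∀ z ∈ ball (0 : ℂ) 1, ∀ w ∈ ball (0 : ℂ) 1, c < (G z).re → c < (G w).re →
      JoinedIn {x ∈ ball (0 : ℂ) 1 | c < (G x).re} z w)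
    (hlo : ∀ c, ∀ z ∈ ball (0 : ℂ) 1, ∀ w ∈ ball (0 : ℂ) 1, (G z).re < c → (G w).re < c →
      JoinedIn {x ∈ ball (0 : ℂ) 1 | (G x).re < c} z w) :
    ∃ l : ℂ, ‖l‖ = 1 ∧ ∃ b ∈ Icc (-1 : ℝ) 1, ∀ z ∈ ball (0 : ℂ) 1,
      0 ≤ ((l + 2 * (b : ℝ) * z + conj l * z ^ 2) * deriv G z).im := by
  set u : ℂ → ℝ := fun z => (G z).re with hu
  have hexp : ∀ θ : ℝ, exp ((θ + 2 * Real.pi : ℝ) * I) = exp (θ * I) := fun θ => by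
    rw [← exp_periodic (θ * I)]; congr 1; push_cast; ring
  have hper : ∀ θ, HasRadialLimit u (θ + 2 * Real.pi) = HasRadialLimit u θ := fun θ => by
    ext y; simp only [HasRadialLimit, hexp]
  -- `limUnder` is the radial limit on `S` and an arbitrary value elsewhere; it depends on `θ` only
  -- through `e^{iθ}`, whence the periodicity.
  set v : ℝ → ℝ := fun θ =>
    Filter.limUnder (nhdsWithin (1 : ℝ) (Iio 1)) (fun r : ℝ => u (r * exp (θ * I))) with hv
  set S : Set ℝ := {θ | ∃ y, HasRadialLimit u θ y} with hS
  have hSv : ∀ θ ∈ S, HasRadialLimit u θ (v θ) := fun θ hθ => tendsto_nhds_limUnder hθ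
  refine exists_direction_of_noInterlacing hG hM (S := S) (v := v) ⟨hrad, ?_, ?_, ?_⟩ hSv
  · intro θ
    simp only [hS, mem_ofPred_eq, hper]
  · intro θ
    simp only [hv, hexp]
  · intro c θ₁ h1 θ₂ h2 θ₃ h3 θ₄ h4 h12 h23 h34 h41
    refine not_interlacing_radial_limits c (hup c) (hlo c) h12 h23 h34 h41 (v := v) ?_
    rintro θ (rfl | rfl | rfl | rfl)
    exacts [hSv _ h1, hSv _ h2, hSv _ h3, hSv _ h4]

/-! ### Radial limits of bounded univalent functions. -/

lemma det_smul_one_complex (c : ℂ) : (c • (1 : ℂ →L[ℝ] ℂ)).det = normSq c := by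
  rw [← Algebra.norm_complex_apply, Algebra.norm_apply, ContinuousLinearMap.det]
  rfl

open MeasureTheory in
/-- The area formula for an injective holomorphic map of the disc into itself. -/
lemma lintegral_normSq_deriv_lt_top {ψ : ℂ → ℂ} (hψ : DifferentiableOn ℂ ψ (ball 0 1))
    (hinj : InjOn ψ (ball 0 1)) (hm : MapsTo ψ (ball 0 1) (ball 0 1)) :
    ∫⁻ z in ball (0 : ℂ) 1, ENNReal.ofReal (normSq (deriv ψ z)) < ⊤ := by
  have h1 := lintegral_image_eq_lintegral_abs_det_fderiv_mul volume
    (measurableSet_ball (x := (0 : ℂ)) (ε := 1)) (f := ψ) (f' := fun z => deriv ψ z • 1)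
    (fun z hz => ((hψ.differentiableAt
      (isOpen_ball.mem_nhds hz)).hasDerivAt.complexToReal_fderiv).hasFDerivWithinAt) hinj
    (fun _ => 1)
  simp only [det_smul_one_complex, mul_one, abs_of_nonneg (normSq_nonneg _)] at h1
  rw [← h1]
  simp only [lintegral_const, one_mul, Measure.restrict_apply MeasurableSet.univ, univ_inter]
  exact (measure_mono hm.image_subset).trans_lt measure_ball_lt_top

-- Polar coordinates and Tonelli turn the finite area integral of `|ψ'|²` into finite radial
-- integrals for almost every angle. Restricting to `r > 1/2` removes the Jacobian factor `r` at the
-- cost of a factor `2`.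
open MeasureTheory in
lemma ae_lintegral_radial_lt_top {ψ : ℂ → ℂ} (hψ : DifferentiableOn ℂ ψ (ball 0 1))
    (hinj : InjOn ψ (ball 0 1)) (hm : MapsTo ψ (ball 0 1) (ball 0 1)) :
    ∀ᵐ θ : ℝ, θ ∈ Ioo (-Real.pi) Real.pi →
      ∫⁻ r in Ioo (1 / 2 : ℝ) 1, ENNReal.ofReal (normSq (deriv ψ (r * exp (θ * I)))) < ⊤ := by
  set F : ℂ → ENNReal := indicator (ball 0 1) fun z => ENNReal.ofReal (normSq (deriv ψ z)) with hF
  have hFm : Measurable F :=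
    (ENNReal.measurable_ofReal.comp (Complex.continuous_normSq.measurable.comp
      (measurable_deriv ψ))).indicator measurableSet_ball
  have h1 := Complex.lintegral_comp_polarCoord_symm F
  rw [hF, lintegral_indicator measurableSet_ball, ← hF] at h1
  have h2 := lintegral_normSq_deriv_lt_top hψ hinj hm
  rw [← h1, polarCoord_target] at h2
  have hmeas : Measurable fun p : ℝ × ℝ => ENNReal.ofReal p.1 • F (Complex.polarCoord.symm p) := by
    simp only [Complex.polarCoord_symm_apply]
    refine (ENNReal.measurable_ofReal.comp measurable_fst).smul (hFm.comp ?_)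
    exact Continuous.measurable (by fun_prop)
  rw [Measure.volume_eq_prod, setLIntegral_prod_symm _ hmeas.aemeasurable] at h2
  have h3 := ae_lt_top (hmeas.lintegral_prod_left') h2.ne
  rw [ae_restrict_iff' measurableSet_Ioo] at h3
  filter_upwards [h3] with θ hθ hθm
  have h4 := hθ hθm
  have h5 : ∀ r ∈ Ioo (1 / 2 : ℝ) 1, ENNReal.ofReal (normSq (deriv ψ (r * exp (θ * I)))) ≤
      2 * (ENNReal.ofReal r • F (Complex.polarCoord.symm (r, θ))) := by
    intro r hr
    have hmem : (r : ℂ) * exp (θ * I) ∈ ball (0 : ℂ) 1 := by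
      rw [mem_ball_zero_iff, norm_mul, norm_exp_ofReal_mul_I, norm_real,
        Real.norm_of_nonneg (by linarith [hr.1]), mul_one]
      exact hr.2
    have hz : Complex.polarCoord.symm (r, θ) = (r : ℂ) * exp (θ * I) := by
      rw [Complex.polarCoord_symm_apply, exp_mul_I, ofReal_cos, ofReal_sin]
    rw [hz, hF, indicator_of_mem hmem, smul_eq_mul, ← mul_assoc]
    have h6 : (1 : ENNReal) ≤ 2 * ENNReal.ofReal r := by
      rw [← ENNReal.ofReal_ofNat, ← ENNReal.ofReal_mul (by norm_num), ← ENNReal.ofReal_one]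
      exact ENNReal.ofReal_le_ofReal (by linarith [hr.1])
    calc _ = 1 * ENNReal.ofReal (normSq (deriv ψ (r * exp (θ * I)))) := (one_mul _).symm
      _ ≤ _ := by gcongr
  calc _ ≤ ∫⁻ r in Ioo (1 / 2 : ℝ) 1, 2 * (ENNReal.ofReal r • F (Complex.polarCoord.symm (r, θ))) :=
        setLIntegral_mono' measurableSet_Ioo h5
    _ ≤ ∫⁻ r in Ioi (0 : ℝ), 2 * (ENNReal.ofReal r • F (Complex.polarCoord.symm (r, θ))) :=
        lintegral_mono_set fun r hr => lt_trans (by norm_num) hr.1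
    _ = 2 * ∫⁻ r in Ioi (0 : ℝ), ENNReal.ofReal r • F (Complex.polarCoord.symm (r, θ)) :=
        lintegral_const_mul' _ _ (by simp)
    _ < ⊤ := ENNReal.mul_lt_top (by simp) h4

-- From `|ψ'| ≤ 1 + |ψ'|²` the derivative is integrable up to the end of the radius, and `ψ` is its
-- primitive.
open MeasureTheory in
lemma exists_radial_limit_of_lintegral_lt_top {ψ : ℂ → ℂ} (hψ : DifferentiableOn ℂ ψ (ball 0 1))
    {θ : ℝ}
    (h : ∫⁻ r in Ioo (1 / 2 : ℝ) 1, ENNReal.ofReal (normSq (deriv ψ (r * exp (θ * I)))) < ⊤) :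
    ∃ y, Filter.Tendsto (fun r : ℝ => ψ (r * exp (θ * I))) (nhdsWithin 1 (Iio 1)) (nhds y) := by
  set f : ℝ → ℂ := fun r => deriv ψ (r * exp (θ * I)) * exp (θ * I) with hf
  have hfm : Measurable f := ((measurable_deriv ψ).comp
    (Continuous.measurable (by fun_prop))).mul measurable_const
  have hn : ∀ r, ‖f r‖ ^ 2 = normSq (deriv ψ (r * exp (θ * I))) := fun r => by
    rw [hf, normSq_eq_norm_sq]; simp only [norm_mul, norm_exp_ofReal_mul_I, mul_one]
  have hint : IntegrableOn f (Ioo (1 / 2) 1) := by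
    refine ⟨hfm.aestronglyMeasurable, ?_⟩
    rw [hasFiniteIntegral_iff_norm]
    calc ∫⁻ r in Ioo (1 / 2 : ℝ) 1, ENNReal.ofReal ‖f r‖
        ≤ ∫⁻ r in Ioo (1 / 2 : ℝ) 1, (1 + ENNReal.ofReal (normSq (deriv ψ (r * exp (θ * I))))) := by
          refine lintegral_mono fun r => ?_
          rw [← ENNReal.ofReal_one, ← ENNReal.ofReal_add zero_le_one (normSq_nonneg _), ← hn]
          exact ENNReal.ofReal_le_ofReal (by nlinarith [sq_nonneg (‖f r‖ - 1), norm_nonneg (f r)])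
      _ = (∫⁻ r in Ioo (1 / 2 : ℝ) 1, 1) +
          ∫⁻ r in Ioo (1 / 2 : ℝ) 1, ENNReal.ofReal (normSq (deriv ψ (r * exp (θ * I)))) :=
          lintegral_add_left measurable_const _
      _ < ⊤ := ENNReal.add_lt_top.2 ⟨by simp, h⟩
  have hii : IntervalIntegrable f volume (1 / 2) 1 := by
    rw [intervalIntegrable_iff_integrableOn_Ioo_of_le (by norm_num)]; exact hint
  have hprim := intervalIntegral.continuousOn_primitive_interval' hii (a := 1 / 2) left_mem_uIcc
  rw [uIcc_of_le (by norm_num : (1 / 2 : ℝ) ≤ 1)] at hprim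
  have hlim : Filter.Tendsto (fun b => ∫ x in (1 / 2 : ℝ)..b, f x) (nhdsWithin 1 (Iio 1))
      (nhds (∫ x in (1 / 2 : ℝ)..1, f x)) := by
    have h1 := hprim 1 (by norm_num)
    refine h1.mono_left ?_
    rw [← nhdsWithin_Ico_eq_nhdsLT (show (1 / 2 : ℝ) < 1 by norm_num)]
    exact nhdsWithin_mono _ Ico_subset_Icc_self
  refine ⟨ψ ((1 / 2 : ℝ) * exp (θ * I)) + ∫ x in (1 / 2 : ℝ)..1, f x, ?_⟩
  refine (tendsto_const_nhds.add hlim).congr' ?_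
  have hev : Ioo (1 / 2 : ℝ) 1 ∈ nhdsWithin (1 : ℝ) (Iio 1) := Ioo_mem_nhdsLT (by norm_num)
  filter_upwards [hev] with r hr
  have hmem : ∀ x ∈ uIcc (1 / 2 : ℝ) r, (x : ℂ) * exp (θ * I) ∈ ball (0 : ℂ) 1 := fun x hx => by
    rw [uIcc_of_le hr.1.le] at hx
    rw [mem_ball_zero_iff, norm_mul, norm_exp_ofReal_mul_I, norm_real,
      Real.norm_of_nonneg (by linarith [hx.1]), mul_one]
    exact hx.2.trans_lt hr.2
  rw [intervalIntegral.integral_eq_sub_of_hasDerivAt (f := fun x : ℝ => ψ (x * exp (θ * I)))]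
  · ring
  · intro x hx
    have h1 := (hψ.differentiableAt (isOpen_ball.mem_nhds (hmem x hx))).hasDerivAt
    have h2 : HasDerivAt (fun x : ℝ => (x : ℂ) * exp (θ * I)) (exp (θ * I)) x := by
      simpa using ((hasDerivAt_id (x : ℂ)).mul_const (exp (θ * I))).comp_ofReal
    exact h1.comp x h2
  · refine hii.mono_set ?_
    rw [uIcc_of_le hr.1.le, uIcc_of_le (by norm_num)]
    exact Icc_subset_Icc_right hr.2.le

open MeasureTheory in
/-- An injective holomorphic map of the disc into itself has radial limits almost everywhere. -/
theorem ae_exists_radial_limit {ψ : ℂ → ℂ} (hψ : DifferentiableOn ℂ ψ (ball 0 1))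
    (hinj : InjOn ψ (ball 0 1)) (hm : MapsTo ψ (ball 0 1) (ball 0 1)) :
    ∀ᵐ θ : ℝ, ∃ y,
      Filter.Tendsto (fun r : ℝ => ψ (r * exp (θ * I))) (nhdsWithin 1 (Iio 1)) (nhds y) := by
  have h1 : ∀ᵐ θ : ℝ, θ ∈ Ioc (-Real.pi) Real.pi → ∃ y,
      Filter.Tendsto (fun r : ℝ => ψ (r * exp (θ * I))) (nhdsWithin 1 (Iio 1)) (nhds y) := by
    filter_upwards [ae_lintegral_radial_lt_top hψ hinj hm, Measure.ae_ne volume Real.pi]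
      with θ hθ hne hmem
    exact exists_radial_limit_of_lintegral_lt_top hψ (hθ ⟨hmem.1, lt_of_le_of_ne hmem.2 hne⟩)
  -- Polar coordinates cover one period; its countably many translates cover the line.
  have h2 : ∀ k : ℤ, ∀ᵐ θ : ℝ, θ + (-k * (2 * Real.pi)) ∈ Ioc (-Real.pi) Real.pi → ∃ y,
      Filter.Tendsto (fun r : ℝ => ψ (r * exp ((θ + (-k * (2 * Real.pi)) : ℝ) * I)))
        (nhdsWithin 1 (Iio 1)) (nhds y) := fun k =>
    (measurePreserving_add_right volume (-k * (2 * Real.pi) : ℝ)).quasiMeasurePreserving.tendsto_ae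
      h1
  filter_upwards [ae_all_iff.2 h2] with θ hθ
  have hpi : 0 < 2 * Real.pi := by positivity
  have h3 := toIocMod_mem_Ioc hpi (-Real.pi) θ
  rw [← self_sub_toIocDiv_zsmul] at h3
  obtain ⟨y, hy⟩ := hθ (toIocDiv hpi (-Real.pi) θ) (by
    rw [zsmul_eq_mul, show -Real.pi + 2 * Real.pi = Real.pi by ring] at h3
    rwa [neg_mul, ← sub_eq_add_neg])
  refine ⟨y, hy.congr fun r => ?_⟩
  congr 2
  rw [← exp_periodic.sub_int_mul_eq (toIocDiv hpi (-Real.pi) θ) (x := θ * I)]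
  congr 1; push_cast; ring

/-! ### Convex harmonic maps: exhaustion and the monotonicity direction. -/

/-- `h + \bar g` is a sense-preserving univalent harmonic map of the disc onto a convex domain that
fixes the origin. -/
structure IsConvexHarmonic (h g : ℂ → ℂ) : Prop where
  diff_h : DifferentiableOn ℂ h (ball 0 1)
  diff_g : DifferentiableOn ℂ g (ball 0 1)
  h_zero : h 0 = 0
  g_zero : g 0 = 0
  norm_deriv_lt : ∀ z ∈ ball (0 : ℂ) 1, ‖deriv g z‖ < ‖deriv h z‖
  injOn : InjOn (fun z => h z + conj (g z)) (ball 0 1)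
  convex : Convex ℝ ((fun z => h z + conj (g z)) '' ball 0 1)

/-- The inverse of an injective map that is open at every point of `U` is continuous. -/
lemma continuousOn_invFunOn {f : ℂ → ℂ} {U : Set ℂ} (hU : IsOpen U) (hinj : InjOn f U)
    (hf : ∀ z ∈ U, Filter.map f (nhds z) = nhds (f z)) :
    ContinuousOn (Function.invFunOn f U) (f '' U) := by
  rintro _ ⟨z, hz, rfl⟩
  refine ContinuousAt.continuousWithinAt ?_
  have hleft : ∀ x ∈ U, Function.invFunOn f U (f x) = x := fun x hx => hinj.leftInvOn_invFunOn hx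
  rw [ContinuousAt, hleft z hz, ← hf z hz, Filter.tendsto_map'_iff]
  refine Filter.tendsto_id.congr' ?_
  filter_upwards [hU.mem_nhds hz] with x hx
  exact (hleft x hx).symm

namespace IsConvexHarmonic
variable {h g : ℂ → ℂ}

lemma continuousOn (hc : IsConvexHarmonic h g) :
    ContinuousOn (fun z => h z + conj (g z)) (ball 0 1) :=
  hc.diff_h.continuousOn.add (continuous_conj.comp_continuousOn hc.diff_g.continuousOn)

/-- The real differential `v ↦ h' v + conj (g' v)` is injective because `|g'| < |h'|`, so the
inverse function theorem applies. -/
lemma map_nhds (hc : IsConvexHarmonic h g) {z : ℂ} (hz : z ∈ ball (0 : ℂ) 1) :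
    Filter.map (fun z => h z + conj (g z)) (nhds z) = nhds (h z + conj (g z)) := by
  have h1 := ((hc.diff_h.analyticOnNhd isOpen_ball z hz).hasStrictDerivAt).complexToReal_fderiv
  have h2 := ((hc.diff_g.analyticOnNhd isOpen_ball z hz).hasStrictDerivAt).complexToReal_fderiv
  have h3 := h1.add ((conjCLE : ℂ →L[ℝ] ℂ).hasStrictFDerivAt.comp z h2)
  refine h3.map_nhds_eq_of_surj ?_
  refine LinearMap.range_eq_top.2 (LinearMap.surjective_of_injective ?_)
  refine (injective_iff_map_eq_zero _).2 fun v hv => ?_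
  simp only [ContinuousLinearMap.coe_coe, add_apply,
    smul_apply, one_apply_eq_self, smul_eq_mul,
    ContinuousLinearMap.comp_apply, ContinuousLinearEquiv.coe_coe, conjCLE_apply] at hv
  have h4 := congrArg norm (eq_neg_of_add_eq_zero_left hv)
  rw [norm_neg, RCLike.norm_conj, norm_mul, norm_mul] at h4
  by_contra hne
  have h5 := hc.norm_deriv_lt z hz
  have h6 := norm_pos_iff.2 hne
  nlinarith

lemma isOpen_image (hc : IsConvexHarmonic h g) :
    IsOpen ((fun z => h z + conj (g z)) '' ball 0 1) := by
  rw [isOpen_iff_mem_nhds]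
  rintro _ ⟨z, hz, rfl⟩
  rw [← hc.map_nhds hz]
  exact Filter.image_mem_map (isOpen_ball.mem_nhds hz)

/-- Conformal parametrization of the preimages of the members of a convex exhaustion. -/
theorem exists_exhausting_map (hc : IsConvexHarmonic h g) {r : ℝ} (hr0 : 0 < r) (hr1 : r < 1) :
    ∃ (ψ : ℂ → ℂ) (K : Set ℂ), DifferentiableOn ℂ ψ (ball 0 1) ∧ InjOn ψ (ball 0 1) ∧
      IsCompact K ∧ K ⊆ ball 0 1 ∧ MapsTo ψ (ball 0 1) K ∧ ψ 0 = 0 ∧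
      (∃ t : ℝ, r ≤ t ∧ deriv ψ 0 = t) ∧
      ∀ P : Set ℂ, Convex ℝ P → ∀ z ∈ ball (0 : ℂ) 1, ∀ w ∈ ball (0 : ℂ) 1,
        h (ψ z) + conj (g (ψ z)) ∈ P → h (ψ w) + conj (g (ψ w)) ∈ P →
        JoinedIn {x ∈ ball (0 : ℂ) 1 | h (ψ x) + conj (g (ψ x)) ∈ P} z w := by
  set f : ℂ → ℂ := fun z => h z + conj (g z) with hf
  set Ω := f '' ball 0 1 with hΩ
  have hΩo : IsOpen Ω := hc.isOpen_image
  have hf0 : f 0 = 0 := by simp [hf, hc.h_zero, hc.g_zero]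
  have hΩ0 : (0 : ℂ) ∈ Ω := ⟨0, mem_ball_self one_pos, hf0⟩
  set fi := Function.invFunOn f (ball 0 1) with hfi
  have hfic : ContinuousOn fi Ω := continuousOn_invFunOn isOpen_ball hc.injOn fun z hz =>
    hc.map_nhds hz
  have hfif : ∀ z ∈ ball (0 : ℂ) 1, fi (f z) = z := fun z hz => hc.injOn.leftInvOn_invFunOn hz
  have hfim : ∀ w ∈ Ω, fi w ∈ ball (0 : ℂ) 1 := by
    rintro _ ⟨z, hz, rfl⟩; rw [hfif z hz]; exact hz
  have hffi : ∀ w ∈ Ω, f (fi w) = w := by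
    rintro _ ⟨z, hz, rfl⟩; rw [hfif z hz]
  have hsub1 : closedBall (0 : ℂ) r ⊆ ball 0 1 := closedBall_subset_ball hr1
  have hKr : IsCompact (f '' closedBall 0 r) :=
    (isCompact_closedBall 0 r).image_of_continuousOn (hc.continuousOn.mono hsub1)
  obtain ⟨δ, hδ, hδΩ⟩ := hKr.exists_thickening_subset_open hΩo (image_mono hsub1)
  obtain ⟨B, hB⟩ := hKr.isBounded.exists_norm_le
  have hB0 : 0 ≤ B := by
    have := hB 0 ⟨0, by simp [hr0.le], hf0⟩
    simpa using this
  -- the dilation factor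
  set s : ℝ := 1 + δ / (B + 1) / 2 with hs
  have hs1 : 1 < s := by rw [hs]; have : 0 < δ / (B + 1) / 2 := by positivity
                         linarith
  have hs0 : 0 < s := by linarith
  set R := s * B + 1 with hR
  -- Contracting by `s > 1` puts the closure inside `Ω`, and intersecting with a ball makes it
  -- compact, as `Ω` may be unbounded. The choice of `s` and `R` keeps `f` of the closed `r`-disc
  -- inside `Ω'`.
  set Ω' : Set ℂ := {w | (s : ℂ) * w ∈ Ω ∩ ball 0 R} with hΩ'
  have hΩ'o : IsOpen Ω' := (hΩo.inter isOpen_ball).preimage (by fun_prop)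
  have hΩ'c : Convex ℝ Ω' := by
    have : Ω' = (fun w : ℂ => s • w) ⁻¹' (Ω ∩ ball 0 R) := by
      ext w; simp [hΩ']
    rw [this]
    exact (hc.convex.inter (convex_ball 0 R)).linear_preimage (s • (LinearMap.id : ℂ →ₗ[ℝ] ℂ))
  have hmid : ∀ w : ℂ, (s : ℂ) * w ∈ closure Ω → w ∈ Ω := by
    intro w hw
    have h0 : (0 : ℂ) ∈ interior Ω := by rwa [hΩo.interior_eq]
    have := hc.convex.openSegment_interior_closure_subset_interior h0 hw
    rw [hΩo.interior_eq] at this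
    refine this ⟨1 - s⁻¹, s⁻¹, ?_, by positivity, by ring, ?_⟩
    · rw [sub_pos]; exact inv_lt_one_of_one_lt₀ hs1
    · rw [smul_zero, zero_add, real_smul, ofReal_inv]
      have : (s : ℂ) ≠ 0 := by exact_mod_cast hs0.ne'
      field_simp
  have hclos : closure Ω' ⊆ Ω := by
    intro w hw
    refine hmid w ?_
    have hcont : Continuous fun w : ℂ => (s : ℂ) * w := by fun_prop
    have h1 : (s : ℂ) * w ∈ closure (Ω ∩ ball 0 R) :=
      closure_minimal (t := (fun w : ℂ => (s : ℂ) * w) ⁻¹' closure (Ω ∩ ball 0 R))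
        (fun x hx => subset_closure hx) (isClosed_closure.preimage hcont) hw
    exact closure_mono inter_subset_left h1
  have hΩ'sub : Ω' ⊆ Ω := subset_closure.trans hclos
  have hcomp : IsCompact (closure Ω') := by
    refine isCompact_of_isClosed_isBounded isClosed_closure ?_
    refine Bornology.IsBounded.closure ((isBounded_ball (x := (0 : ℂ)) (r := R)).subset ?_)
    intro w hw
    have h1 : ‖(s : ℂ) * w‖ < R := mem_ball_zero_iff.1 hw.2
    rw [norm_mul, norm_real, Real.norm_of_nonneg hs0.le] at h1
    rw [mem_ball_zero_iff]
    nlinarith [norm_nonneg w]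
  have hrsub : ∀ z ∈ closedBall (0 : ℂ) r, f z ∈ Ω' := by
    intro z hz
    have hfz : ‖f z‖ ≤ B := hB _ ⟨z, hz, rfl⟩
    refine ⟨hδΩ ?_, ?_⟩
    · rw [mem_thickening_iff]
      refine ⟨f z, ⟨z, hz, rfl⟩, ?_⟩
      have : (s : ℂ) * f z - f z = ((δ / (B + 1) / 2 : ℝ) : ℂ) * f z := by
        rw [hs]; push_cast; ring
      rw [dist_eq_norm, this, norm_mul, norm_real, Real.norm_of_nonneg (by positivity)]
      calc δ / (B + 1) / 2 * ‖f z‖ ≤ δ / (B + 1) / 2 * (B + 1) := by gcongr; linarith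
        _ = δ / 2 := by field_simp
        _ < δ := by linarith
    · rw [mem_ball_zero_iff, norm_mul, norm_real, Real.norm_of_nonneg hs0.le, hR]
      nlinarith
  set U : Set ℂ := {z ∈ ball (0 : ℂ) 1 | f z ∈ Ω'} with hU
  have hUo : IsOpen U := hc.continuousOn.isOpen_inter_preimage isOpen_ball hΩ'o
  have h0U : (0 : ℂ) ∈ U := ⟨mem_ball_self one_pos, hrsub 0 (by simp [hr0.le])⟩
  have hfiU : ∀ w ∈ Ω', fi w ∈ U := fun w hw =>
    ⟨hfim w (hΩ'sub hw), by rw [hffi w (hΩ'sub hw)]; exact hw⟩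
  -- `U` need not be convex, but it is homeomorphic to the convex set `Ω'`, hence simply connected.
  let e : U ≃ₜ Ω' :=
    { toFun := fun z => ⟨f z, z.2.2⟩
      invFun := fun w => ⟨fi w, hfiU w w.2⟩
      left_inv := fun z => Subtype.ext (hfif z z.2.1)
      right_inv := fun w => Subtype.ext (hffi w (hΩ'sub w.2))
      continuous_toFun := by
        refine Continuous.subtype_mk ?_ _
        exact (hc.continuousOn.mono fun z hz => hz.1).domRestrict (s := U)
      continuous_invFun := by
        refine Continuous.subtype_mk ?_ _
        exact (hfic.mono hΩ'sub).domRestrict (s := Ω') }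
  have hUsc : IsSimplyConnected U := by
    have : ContractibleSpace Ω' := hΩ'c.contractibleSpace ⟨f 0, h0U.2⟩
    have := e.contractibleSpace
    exact inferInstanceAs (SimplyConnectedSpace U)
  have hrU : ball 0 r ⊆ U := fun z hz =>
    ⟨hsub1 (ball_subset_closedBall hz), hrsub z (ball_subset_closedBall hz)⟩
  obtain ⟨ψ, φ, hψd, hφc, hψm, hφm, hφψ, hψφ, hψ0, ht⟩ :=
    exists_riemann_map hUo hUsc h0U (fun z hz => hz.1) hr0 hrU
  have hψi : InjOn ψ (ball 0 1) := fun a ha b hb hab => by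
    rw [← hφψ a ha, ← hφψ b hb, hab]
  refine ⟨ψ, fi '' closure Ω', hψd, hψi, hcomp.image_of_continuousOn (hfic.mono hclos), ?_, ?_, hψ0,
    ht, ?_⟩
  · rintro _ ⟨w, hw, rfl⟩; exact hfim w (hclos hw)
  · intro z hz
    have := hψm hz
    exact ⟨f (ψ z), subset_closure this.2, hfif _ this.1⟩
  · intro P hP z hz w hw hzP hwP
    have hconv : Convex ℝ (Ω' ∩ P) := hΩ'c.inter hP
    -- The set in question is the continuous image of the convex set `Ω' ∩ P` under the inverse of
    -- `f ∘ ψ`.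
    have hzm : f (ψ z) ∈ Ω' ∩ P := ⟨(hψm hz).2, hzP⟩
    have hwm : f (ψ w) ∈ Ω' ∩ P := ⟨(hψm hw).2, hwP⟩
    have hcont : ContinuousOn (fun x => φ (fi x)) (Ω' ∩ P) :=
      hφc.comp (hfic.mono (inter_subset_left.trans hΩ'sub)) fun x hx => hfiU x hx.1
    have hpc := (hconv.isPathConnected ⟨_, hzm⟩).image' hcont
    have hback : ∀ x ∈ ball (0 : ℂ) 1, φ (fi (f (ψ x))) = x := fun x hx => by
      rw [hfif _ (hψm hx).1, hφψ x hx]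
    have hj := hpc.joinedIn z ⟨_, hzm, hback z hz⟩ w ⟨_, hwm, hback w hw⟩
    refine hj.mono ?_
    rintro _ ⟨x, hx, rfl⟩
    refine ⟨hφm (hfiU x hx.1), ?_⟩
    have : f (ψ (φ (fi x))) = x := by
      rw [hψφ _ (hfiU x hx.1), hffi x (hΩ'sub hx.1)]
    change f (ψ (φ (fi x))) ∈ P
    rw [this]; exact hx.2

end IsConvexHarmonic

/-- A holomorphic self-map of the disc fixing the origin with derivative close to `1` there is close
to the identity. -/
lemma norm_sub_self_le_of_deriv_zero {ψ : ℂ → ℂ} (hψ : DifferentiableOn ℂ ψ (ball 0 1))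
    (hm : MapsTo ψ (ball 0 1) (ball 0 1)) (h0 : ψ 0 = 0) {r t : ℝ} (hr : r < 1) (ht : r ≤ t)
    (hd : deriv ψ 0 = t) {z : ℂ} (hz : z ∈ ball (0 : ℂ) 1) :
    ‖ψ z - z‖ ≤ 3 * (1 - r) / (1 - ‖z‖) := by
  have hz1 : ‖z‖ < 1 := mem_ball_zero_iff.1 hz
  have hm' : MapsTo ψ (ball 0 1) (closedBall (ψ 0) 1) := fun w hw => by
    rw [h0]; exact ball_subset_closedBall (hm hw)
  have hk1 : ∀ w ∈ ball (0 : ℂ) 1, ‖dslope ψ 0 w‖ ≤ 1 := fun w hw => by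
    simpa using norm_dslope_le_div_of_mapsTo_ball hψ hm' hw
  have hk0 : dslope ψ 0 0 = t := by rw [dslope_same, hd]
  have ht1 : t ≤ 1 := by
    have := hk1 0 (mem_ball_self one_pos)
    rw [hk0, norm_real] at this
    exact (le_abs_self t).trans this
  have hkd : DifferentiableOn ℂ (dslope ψ 0) (ball 0 1) :=
    (differentiableOn_dslope (isOpen_ball.mem_nhds (mem_ball_self one_pos))).2 hψ
  -- By the Schwarz lemma `ψ(w)/w` has modulus at most `1`, and its value `t ≥ r` at the origin
  -- nearly attains this; Borel–Carathéodory bounds its deviation from `t`.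
  have hbc := borelCaratheodory_zero (f := fun w => dslope ψ 0 w - t) (M := 1 - r) (R := 1)
    (by linarith) (hkd.sub_const _) (fun w hw => by
      simp only [mem_ofPred_eq, sub_re, ofReal_re]
      have := (re_le_norm _).trans (hk1 w hw)
      linarith) one_pos hz (by rw [hk0, sub_self])
  have hψz : ψ z = z * dslope ψ 0 z := by
    have := sub_smul_dslope ψ 0 z
    simp only [sub_zero, h0, smul_eq_mul] at this
    exact this.symm
  have hpos : 0 < 1 - ‖z‖ := by linarith
  have e1 : ψ z - z = z * (dslope ψ 0 z - t) + z * ((t - 1 : ℝ) : ℂ) := by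
    rw [hψz]; push_cast; ring
  rw [e1]
  refine (norm_add_le _ _).trans ?_
  rw [norm_mul, norm_mul, norm_real, Real.norm_of_nonpos (by linarith)]
  have h2 : ‖z‖ * ‖dslope ψ 0 z - t‖ ≤ 2 * (1 - r) / (1 - ‖z‖) := by
    calc ‖z‖ * ‖dslope ψ 0 z - t‖ ≤ 1 * (2 * (1 - r) * ‖z‖ / (1 - ‖z‖)) := by
          gcongr
      _ ≤ 2 * (1 - r) / (1 - ‖z‖) := by
          rw [one_mul, div_le_div_iff_of_pos_right hpos]
          nlinarith [norm_nonneg z]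
  have h3 : ‖z‖ * -(t - 1) ≤ (1 - r) / (1 - ‖z‖) := by
    rw [le_div_iff₀ hpos]
    have : ‖z‖ * -(t - 1) ≤ 1 - r := by nlinarith [norm_nonneg z]
    nlinarith [norm_nonneg z, mul_nonneg (norm_nonneg z) (by linarith : 0 ≤ -(t - 1))]
  calc _ ≤ 2 * (1 - r) / (1 - ‖z‖) + (1 - r) / (1 - ‖z‖) := add_le_add h2 h3
    _ = _ := by ring

/-- For a convex harmonic map `h + \bar g` the real part of `h + g` increases in some hyperbolic or
parabolic direction. -/
theorem IsConvexHarmonic.exists_direction {h g : ℂ → ℂ} (hc : IsConvexHarmonic h g) :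
    ∃ l : ℂ, ‖l‖ = 1 ∧ ∃ b ∈ Icc (-1 : ℝ) 1, ∀ z ∈ ball (0 : ℂ) 1,
      0 ≤ ((l + 2 * (b : ℝ) * z + conj l * z ^ 2) * (deriv h z + deriv g z)).im := by
  -- `H` is holomorphic and has the same real part as the harmonic map.
  set H : ℂ → ℂ := fun z => h z + g z with hH
  have hHd : DifferentiableOn ℂ H (ball 0 1) := hc.diff_h.add hc.diff_g
  have hHderiv : ∀ z ∈ ball (0 : ℂ) 1, deriv H z = deriv h z + deriv g z := fun z hz =>
    deriv_add (hc.diff_h.differentiableAt (isOpen_ball.mem_nhds hz))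
      (hc.diff_g.differentiableAt (isOpen_ball.mem_nhds hz))
  have hre : ∀ z, (h z + conj (g z)).re = (H z).re := fun z => by simp [hH]
  set r : ℕ → ℝ := fun n => 1 - 1 / ((n : ℝ) + 2) with hr
  have hr01 : ∀ n : ℕ, 0 < r n ∧ r n < 1 := fun n => by
    have h1 : (0 : ℝ) < (n : ℝ) + 2 := by positivity
    have h2 : 0 < 1 / ((n : ℝ) + 2) := by positivity
    have h3 : 1 / ((n : ℝ) + 2) < 1 := by
      rw [div_lt_one h1]; have : (0 : ℝ) ≤ n := Nat.cast_nonneg n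
      linarith
    constructor <;> simp only [hr] <;> linarith
  have hrt : Filter.Tendsto (fun n => 1 - r n) Filter.atTop (nhds 0) := by
    simp only [hr, sub_sub_cancel, one_div]
    exact (Filter.tendsto_atTop_add_const_right _ _ tendsto_natCast_atTop_atTop).inv_tendsto_atTop
  choose ψ K hψd hψi hK hKsub hψK hψ0 ht hjoin using fun n =>
    hc.exists_exhausting_map (hr01 n).1 (hr01 n).2
  choose t htr htd using ht
  have hψm : ∀ n, MapsTo (ψ n) (ball 0 1) (ball 0 1) := fun n z hz => hKsub n (hψK n hz)
  have hbound := fun n => fun (z : ℂ) (hz : z ∈ ball (0 : ℂ) 1) =>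
    norm_sub_self_le_of_deriv_zero (hψd n) (hψm n) (hψ0 n) (hr01 n).2 (htr n) (htd n) hz
  have hlu : TendstoLocallyUniformlyOn ψ id Filter.atTop (ball 0 1) := by
    rw [Metric.tendstoLocallyUniformlyOn_iff]
    intro ε hε z hz
    have hz1 : ‖z‖ < 1 := mem_ball_zero_iff.1 hz
    refine ⟨ball 0 ((1 + ‖z‖) / 2), mem_nhdsWithin_of_mem_nhds
      (isOpen_ball.mem_nhds (by rw [mem_ball_zero_iff]; linarith)), ?_⟩
    have hev := (hrt.const_mul 3).eventually (gt_mem_nhds (show 3 * 0 < ε * ((1 - ‖z‖) / 2) by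
      have : 0 < 1 - ‖z‖ := by linarith
      rw [mul_zero]; positivity))
    filter_upwards [hev] with n hn w hw
    rw [mem_ball_zero_iff] at hw
    have hw1 : w ∈ ball (0 : ℂ) 1 := by rw [mem_ball_zero_iff]; linarith
    rw [dist_comm, dist_eq_norm]
    refine (hbound n w hw1).trans_lt ?_
    rw [div_lt_iff₀ (by linarith)]
    refine hn.trans_le ?_
    gcongr
    linarith
  have hderiv := hlu.deriv (.of_forall hψd) isOpen_ball
  set G : ℕ → ℂ → ℂ := fun n z => H (ψ n z) with hG
  have hGd : ∀ n, DifferentiableOn ℂ (G n) (ball 0 1) := fun n => hHd.comp (hψd n) (hψm n)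
  have hGderiv : ∀ n, ∀ z ∈ ball (0 : ℂ) 1, deriv (G n) z = deriv H (ψ n z) * deriv (ψ n) z :=
    fun n z hz => ((hHd.differentiableAt (isOpen_ball.mem_nhds (hψm n hz))).hasDerivAt.comp z
      ((hψd n).differentiableAt (isOpen_ball.mem_nhds hz)).hasDerivAt).deriv
  have hdir : ∀ n, ∃ l : ℂ, ‖l‖ = 1 ∧ ∃ b ∈ Icc (-1 : ℝ) 1, ∀ z ∈ ball (0 : ℂ) 1,
      0 ≤ ((l + 2 * (b : ℝ) * z + conj l * z ^ 2) * deriv (G n) z).im := by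
    intro n
    obtain ⟨M, hM⟩ := (hK n).exists_bound_of_continuousOn (hHd.continuousOn.mono (hKsub n))
    refine exists_direction_of_connected_levels (hGd n) (M := M)
      (fun z hz => (abs_re_le_norm _).trans (hM _ (hψK n hz))) ?_ ?_ ?_
    · filter_upwards [ae_exists_radial_limit (hψd n) (hψi n) (hψm n)] with θ hθ
      obtain ⟨y, hy⟩ := hθ
      -- The radial limit of `ψ n` stays in a compact subset of the open disc, where `H` is
      -- continuous; so `H ∘ ψ n` has a radial limit too.
      have hyK : y ∈ K n := by
        refine (hK n).isClosed.mem_of_tendsto hy ?_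
        have : Ioo (0 : ℝ) 1 ∈ nhdsWithin 1 (Iio 1) := Ioo_mem_nhdsLT one_pos
        filter_upwards [this] with s hs
        refine hψK n ?_
        rw [mem_ball_zero_iff, norm_mul, norm_exp_ofReal_mul_I, norm_real,
          Real.norm_of_nonneg hs.1.le, mul_one]
        exact hs.2
      have hcont : ContinuousAt H y :=
        hHd.continuousOn.continuousAt (isOpen_ball.mem_nhds (hKsub n hyK))
      exact ⟨(H y).re, (continuous_re.tendsto _).comp (hcont.tendsto.comp hy)⟩
    · intro c z hz w hw hcz hcw
      have := hjoin n {x | c < x.re} (convex_halfSpace_re_gt c) z hz w hw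
        (by simpa [hre] using hcz) (by simpa [hre] using hcw)
      simpa only [mem_ofPred_eq, hre] using this
    · intro c z hz w hw hcz hcw
      have := hjoin n {x | x.re < c} (convex_halfSpace_re_lt c) z hz w hw
        (by simpa [hre] using hcz) (by simpa [hre] using hcw)
      simpa only [mem_ofPred_eq, hre] using this
  obtain ⟨l, hl, b, hb, hlb⟩ := exists_direction_of_tendsto (D := fun n => deriv (G n))
    (d := deriv H) (e := fun _ _ => 0) isCompact_Icc
    (fun z hz => by
      have h1 := hlu.tendsto_at hz
      have h2 := hderiv.tendsto_at hz
      have h3 : ContinuousAt (deriv H) z :=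
        ((hHd.deriv isOpen_ball).continuousOn).continuousAt (isOpen_ball.mem_nhds hz)
      have h4 := (h3.tendsto.comp h1).mul h2
      rw [deriv_id, mul_one] at h4
      exact h4.congr fun n => (hGderiv n z hz).symm)
    (fun z _ => tendsto_const_nhds) (fun n => by simpa only [neg_zero] using hdir n)
  exact ⟨l, hl, b, hb, fun z hz => by rw [← hHderiv z hz]; exact hlb z hz⟩

/-! ### Carathéodory's coefficient bound and Taylor series as formal power series. -/

/-- The coefficients of a holomorphic function with nonnegative real part on the disc are bounded by
twice the real part of its value at the origin. -/
lemma norm_taylorCoeffZero_le_of_re_nonneg {Q : ℂ → ℂ} (hQ : DifferentiableOn ℂ Q (ball 0 1))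
    (hre : ∀ z ∈ ball (0 : ℂ) 1, 0 ≤ (Q z).re) {n : ℕ} (hn : n ≠ 0) :
    ‖taylorCoeffZero Q n‖ ≤ 2 * (Q 0).re := by
  have key : ∀ r : ℝ, 0 < r → r < 1 → ‖taylorCoeffZero Q n‖ * r ^ n ≤ 2 * (Q 0).re := by
    intro r hr0 hr1
    have hsub : closedBall (0 : ℂ) r ⊆ ball 0 1 := closedBall_subset_ball hr1
    have hQr : DifferentiableOn ℂ Q (closedBall 0 r) := hQ.mono hsub
    have hmap : ∀ θ : ℝ, circleMap 0 r θ ∈ closedBall (0 : ℂ) r :=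
      fun θ => circleMap_mem_closedBall 0 hr0.le θ
    have hnorm : ∀ θ : ℝ, ‖circleMap 0 r θ‖ = r := fun θ => by
      simp [abs_of_pos hr0]
    have hne : ∀ θ : ℝ, circleMap 0 r θ ≠ 0 := fun θ h => by
      have := hnorm θ; rw [h, norm_zero] at this; exact hr0.ne this
    have hQc : Continuous fun θ : ℝ => Q (circleMap 0 r θ) :=
      hQr.continuousOn.comp_continuous (continuous_circleMap 0 r) hmap
    have hA : (2 * Real.pi : ℝ)⁻¹ • ∫ θ in (0 : ℝ)..2 * Real.pi,
        (circleMap 0 r θ ^ n)⁻¹ * Q (circleMap 0 r θ) = taylorCoeffZero Q n := by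
      have h1 := Real.circleAverage_eq_circleIntegral (F := ℂ) (c := 0)
        (f := fun z => (z ^ n)⁻¹ * Q z) hr0.ne'
      rw [Real.circleAverage_def] at h1
      rw [h1]
      have h2 := hQr.circleIntegral_one_div_sub_center_pow_smul hr0 n
      have h3 : (fun z : ℂ => (z - 0)⁻¹ • ((z ^ n)⁻¹ * Q z)) =
          fun z => (1 / (z - 0) ^ (n + 1)) • Q z := by
        ext z
        simp only [sub_zero, smul_eq_mul, one_div, pow_succ, mul_inv]
        ring
      rw [h3, h2, taylorCoeffZero, smul_eq_mul, smul_eq_mul]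
      have := Real.pi_ne_zero
      have hf : (n.factorial : ℂ) ≠ 0 := by exact_mod_cast n.factorial_ne_zero
      field_simp
    have hB : (2 * Real.pi : ℝ)⁻¹ • ∫ θ in (0 : ℝ)..2 * Real.pi,
        circleMap 0 r θ ^ n * Q (circleMap 0 r θ) = 0 := by
      have hd : DiffContOnCl ℂ (fun z => z ^ n * Q z) (ball 0 |r|) := by
        rw [abs_of_pos hr0]
        refine DifferentiableOn.diffContOnCl ?_
        rw [closure_ball _ hr0.ne']
        exact (differentiable_id.pow n).differentiableOn.mul hQr
      have h1 := hd.circleAverage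
      rw [Real.circleAverage_def] at h1
      simpa [hn] using h1
    -- The conjugate of `Q` has no frequency `n > 0`. Adding this zero replaces `Q` by `2 Re Q ≥ 0`
    -- in the coefficient integral, whose modulus is then controlled by the mean of `Re Q`.
    have hB' : ∫ θ in (0 : ℝ)..2 * Real.pi,
        (circleMap 0 r θ ^ n)⁻¹ * conj (Q (circleMap 0 r θ)) = 0 := by
      have h1 : ∫ θ in (0 : ℝ)..2 * Real.pi, circleMap 0 r θ ^ n * Q (circleMap 0 r θ) = 0 :=
        (smul_eq_zero.1 hB).resolve_left (inv_ne_zero (by positivity))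
      have h2 := congrArg (fun w => ((r ^ (2 * n) : ℝ) : ℂ)⁻¹ * conj w) h1
      simp only [map_zero, mul_zero] at h2
      have h3 := ((conjCLE : ℂ ≃L[ℝ] ℂ) : ℂ →L[ℝ] ℂ).intervalIntegral_comp_comm
        ((((continuous_circleMap 0 r).pow n).mul hQc).intervalIntegrable
          (μ := MeasureTheory.volume) 0 (2 * Real.pi))
      simp only [ContinuousLinearEquiv.coe_coe, conjCLE_apply] at h3
      refine Eq.trans ?_ ((congrArg (fun w => ((r ^ (2 * n) : ℝ) : ℂ)⁻¹ * w) h3).trans h2)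
      rw [← intervalIntegral.integral_const_mul]
      refine intervalIntegral.integral_congr fun θ _ => ?_
      simp only [Pi.mul_apply, Pi.pow_apply, map_mul, map_pow]
      have h4 : ((r ^ (2 * n) : ℝ) : ℂ) = circleMap 0 r θ ^ n * conj (circleMap 0 r θ) ^ n := by
        rw [← mul_pow, mul_conj, normSq_eq_norm_sq, hnorm]; push_cast; ring
      have h5 := pow_ne_zero n (hne θ)
      have h6 := pow_ne_zero n ((map_ne_zero (starRingEnd ℂ)).2 (hne θ))
      rw [h4]
      field_simp
    have hre0 : (2 * Real.pi : ℝ)⁻¹ * ∫ θ in (0 : ℝ)..2 * Real.pi, (Q (circleMap 0 r θ)).re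
        = (Q 0).re := by
      have hd : DiffContOnCl ℂ Q (ball 0 |r|) := by
        rw [abs_of_pos hr0]
        refine DifferentiableOn.diffContOnCl ?_
        rwa [closure_ball _ hr0.ne']
      have h1 := hd.circleAverage
      rw [Real.circleAverage_def] at h1
      rw [← h1, real_smul, re_ofReal_mul]
      congr 1
      exact reCLM.intervalIntegral_comp_comm (hQc.intervalIntegrable _ _)
    have hic : Continuous fun θ : ℝ => (circleMap 0 r θ ^ n)⁻¹ :=
      ((continuous_circleMap 0 r).pow n).inv₀ fun θ => pow_ne_zero n (hne θ)
    have hA' : (2 * Real.pi : ℝ)⁻¹ • ∫ θ in (0 : ℝ)..2 * Real.pi,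
        (circleMap 0 r θ ^ n)⁻¹ * ((2 * (Q (circleMap 0 r θ)).re : ℝ) : ℂ)
          = taylorCoeffZero Q n := by
      rw [← hA]
      congr 1
      refine Eq.trans ?_ ((congrArg _ hB').trans (add_zero _))
      refine Eq.trans ?_ (intervalIntegral.integral_add ((hic.mul hQc).intervalIntegrable _ _)
          ((hic.mul (continuous_conj.comp hQc)).intervalIntegrable _ _))
      refine intervalIntegral.integral_congr fun θ _ => ?_
      rw [← mul_add, add_conj]
    rw [← hA', norm_smul, Real.norm_of_nonneg (by positivity), ← hre0]
    have hle : ‖∫ θ in (0 : ℝ)..2 * Real.pi,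
        (circleMap 0 r θ ^ n)⁻¹ * ((2 * (Q (circleMap 0 r θ)).re : ℝ) : ℂ)‖ ≤
        ∫ θ in (0 : ℝ)..2 * Real.pi, (r ^ n)⁻¹ * 2 * (Q (circleMap 0 r θ)).re := by
      refine (intervalIntegral.norm_integral_le_integral_norm (by positivity)).trans_eq ?_
      refine intervalIntegral.integral_congr fun θ _ => ?_
      rw [norm_mul, norm_inv, norm_pow, hnorm, norm_real, Real.norm_of_nonneg, mul_assoc]
      have := hre _ (hsub (hmap θ))
      positivity
    rw [intervalIntegral.integral_const_mul] at hle
    have hr' : (r ^ n)⁻¹ * r ^ n = 1 := inv_mul_cancel₀ (pow_pos hr0 n).ne'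
    calc _ ≤ (2 * Real.pi)⁻¹ * ((r ^ n)⁻¹ * 2 *
          ∫ θ in (0 : ℝ)..2 * Real.pi, (Q (circleMap 0 r θ)).re) * r ^ n := by gcongr
      _ = ((r ^ n)⁻¹ * r ^ n) * (2 * ((2 * Real.pi)⁻¹ *
          ∫ θ in (0 : ℝ)..2 * Real.pi, (Q (circleMap 0 r θ)).re)) := by ring
      _ = _ := by rw [hr', one_mul]
  have hlim : Filter.Tendsto (fun r : ℝ => ‖taylorCoeffZero Q n‖ * r ^ n)
      (nhdsWithin 1 (Iio 1)) (nhds (‖taylorCoeffZero Q n‖ * 1 ^ n)) :=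
    ((continuous_const.mul (continuous_id.pow n)).tendsto 1).mono_left nhdsWithin_le_nhds
  rw [one_pow, mul_one] at hlim
  refine le_of_tendsto hlim ?_
  filter_upwards [Ioo_mem_nhdsLT (zero_lt_one' ℝ)] with r hr using key r hr.1 hr.2

/-- The Taylor series at the origin as a formal power series. -/
noncomputable def taylorPowerSeries (p : ℂ → ℂ) : PowerSeries ℂ := PowerSeries.mk (taylorCoeffZero p)

lemma coeff_taylorPowerSeries (p : ℂ → ℂ) (n : ℕ) :
    PowerSeries.coeff n (taylorPowerSeries p) = taylorCoeffZero p n := PowerSeries.coeff_mk _ _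

lemma taylorCoeffZero_zero (p : ℂ → ℂ) : taylorCoeffZero p 0 = p 0 := by simp [taylorCoeffZero]

lemma taylorCoeffZero_one (p : ℂ → ℂ) : taylorCoeffZero p 1 = deriv p 0 := by
  simp [taylorCoeffZero]

lemma taylorCoeffZero_congr {p q : ℂ → ℂ} (h : EqOn p q (ball 0 1)) (n : ℕ) :
    taylorCoeffZero p n = taylorCoeffZero q n := by
  have : p =ᶠ[nhds 0] q := h.eventuallyEq_of_mem (isOpen_ball.mem_nhds (mem_ball_self one_pos))
  rw [taylorCoeffZero, taylorCoeffZero, this.iteratedDeriv_eq]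

lemma taylorCoeffZero_deriv (p : ℂ → ℂ) (n : ℕ) :
    taylorCoeffZero (deriv p) n = (n + 1) * taylorCoeffZero p (n + 1) := by
  have h1 : (n.factorial : ℂ) ≠ 0 := by exact_mod_cast n.factorial_ne_zero
  have h2 : (n : ℂ) + 1 ≠ 0 := by exact_mod_cast n.succ_ne_zero
  rw [taylorCoeffZero, taylorCoeffZero, iteratedDeriv_succ', Nat.factorial_succ]
  push_cast
  field_simp

lemma taylorPowerSeries_congr {p q : ℂ → ℂ} (h : EqOn p q (ball 0 1)) :
    taylorPowerSeries p = taylorPowerSeries q := by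
  ext n
  rw [coeff_taylorPowerSeries, coeff_taylorPowerSeries, taylorCoeffZero_congr h]

section
variable {p q : ℂ → ℂ}

lemma DifferentiableOn.analyticAt_zero (hp : DifferentiableOn ℂ p (ball 0 1)) :
    AnalyticAt ℂ p 0 := hp.analyticAt (isOpen_ball.mem_nhds (mem_ball_self one_pos))

lemma taylorPowerSeries_mul (hp : DifferentiableOn ℂ p (ball 0 1))
    (hq : DifferentiableOn ℂ q (ball 0 1)) :
    taylorPowerSeries (fun z => p z * q z) = taylorPowerSeries p * taylorPowerSeries q := by
  ext n
  have : (fun z => p z * q z) = p * q := rfl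
  rw [coeff_taylorPowerSeries, PowerSeries.coeff_mul, taylorCoeffZero, this,
    iteratedDeriv_mul hp.analyticAt_zero.contDiffAt hq.analyticAt_zero.contDiffAt,
    Finset.sum_div, Finset.Nat.sum_antidiagonal_eq_sum_range_succ_mk]
  refine Finset.sum_congr rfl fun i hi => ?_
  simp only [coeff_taylorPowerSeries, taylorCoeffZero]
  rw [Nat.cast_choose _ (Nat.lt_succ_iff.1 (Finset.mem_range.1 hi))]
  have h1 : (n.factorial : ℂ) ≠ 0 := by exact_mod_cast n.factorial_ne_zero
  field_simp

lemma taylorPowerSeries_add (hp : DifferentiableOn ℂ p (ball 0 1))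
    (hq : DifferentiableOn ℂ q (ball 0 1)) :
    taylorPowerSeries (fun z => p z + q z) = taylorPowerSeries p + taylorPowerSeries q := by
  ext n
  have : (fun z => p z + q z) = p + q := rfl
  rw [map_add]
  simp only [coeff_taylorPowerSeries, taylorCoeffZero]
  rw [this, iteratedDeriv_add hp.analyticAt_zero.contDiffAt hq.analyticAt_zero.contDiffAt, add_div]

lemma taylorPowerSeries_const (c : ℂ) : taylorPowerSeries (fun _ => c) = PowerSeries.C c := by
  ext n
  rw [coeff_taylorPowerSeries, taylorCoeffZero, iteratedDeriv_const, PowerSeries.coeff_C]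
  split_ifs with h
  · subst h; simp
  · simp

lemma taylorPowerSeries_id : taylorPowerSeries (fun z => z) = PowerSeries.X := by
  ext n
  rw [coeff_taylorPowerSeries, PowerSeries.coeff_X]
  rcases n with _ | _ | n
  · simp [taylorCoeffZero]
  · simp [taylorCoeffZero]
  · rw [taylorCoeffZero, iteratedDeriv_succ', iteratedDeriv_succ']
    simp

lemma taylorPowerSeries_const_mul (c : ℂ) (hp : DifferentiableOn ℂ p (ball 0 1)) :
    taylorPowerSeries (fun z => c * p z) = PowerSeries.C c * taylorPowerSeries p := by
  rw [taylorPowerSeries_mul (differentiableOn_const c) hp, taylorPowerSeries_const]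

lemma taylorPowerSeries_quadratic_mul (l b : ℂ) (hp : DifferentiableOn ℂ p (ball 0 1)) :
    taylorPowerSeries (fun z => (l + b * z + conj l * z ^ 2) * p z) =
      (PowerSeries.C l + PowerSeries.C b * PowerSeries.X
        + PowerSeries.C (conj l) * PowerSeries.X ^ 2) * taylorPowerSeries p := by
  have hid : DifferentiableOn ℂ (fun z : ℂ => z) (ball 0 1) := differentiableOn_id
  have h2 : DifferentiableOn ℂ (fun z : ℂ => z * z) (ball 0 1) := hid.mul hid
  have e : (fun z => (l + b * z + conj l * z ^ 2) * p z) =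
      fun z => (l + b * z + conj l * (z * z)) * p z := by ext; ring
  have h3 : DifferentiableOn ℂ (fun z : ℂ => l + b * z) (ball 0 1) :=
    (differentiableOn_const l).add (hid.const_mul b)
  have h4 : DifferentiableOn ℂ (fun z : ℂ => l + b * z + conj l * (z * z)) (ball 0 1) :=
    h3.add (h2.const_mul _)
  rw [e, taylorPowerSeries_mul h4 hp, taylorPowerSeries_add h3 (h2.const_mul _),
    taylorPowerSeries_add (differentiableOn_const l) (hid.const_mul b),
    taylorPowerSeries_const, taylorPowerSeries_const_mul _ hid, taylorPowerSeries_const_mul _ h2,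
    taylorPowerSeries_mul hid hid, taylorPowerSeries_id, pow_two]

end

/-! ### Rotations and the coefficient bounds for convex harmonic maps. -/

namespace IsConvexHarmonic
variable {h g : ℂ → ℂ}

lemma rotate (hc : IsConvexHarmonic h g) {u : ℂ} (hu : ‖u‖ = 1) :
    IsConvexHarmonic (fun z => u * h z) (fun z => conj u * g z) := by
  have hu0 : u ≠ 0 := norm_ne_zero_iff.1 (by rw [hu]; exact one_ne_zero)
  have he : (fun z => u * h z + conj (conj u * g z)) = fun z => u * (h z + conj (g z)) := by
    ext z; simp only [map_mul, conj_conj]; ring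
  refine ⟨hc.diff_h.const_mul u, hc.diff_g.const_mul _, ?_, ?_, fun z hz => ?_, ?_, ?_⟩
  · simp [hc.h_zero]
  · simp [hc.g_zero]
  · rw [deriv_const_mul_field, deriv_const_mul_field, norm_mul, norm_mul, RCLike.norm_conj, hu,
      one_mul, one_mul]
    exact hc.norm_deriv_lt z hz
  · rw [he]
    exact fun x hx y hy hxy => hc.injOn hx hy (mul_left_cancel₀ hu0 hxy)
  · rw [he, ← image_image (fun w => u * w)]
    exact hc.convex.linear_image (LinearMap.mulLeft ℝ u)

/-- The direction `(l, b)` is one in which the real part of `conj u * h + u * g` increases. -/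
def IsDirection (h g : ℂ → ℂ) (u l : ℂ) (b : ℝ) : Prop :=
  ‖l‖ = 1 ∧ ∀ z ∈ ball (0 : ℂ) 1,
    0 ≤ ((l + 2 * (b : ℝ) * z + conj l * z ^ 2) * (conj u * deriv h z + u * deriv g z)).im

lemma exists_isDirection (hc : IsConvexHarmonic h g) {u : ℂ} (hu : ‖u‖ = 1) :
    ∃ l, ∃ b ∈ Icc (-1 : ℝ) 1, IsDirection h g u l b := by
  obtain ⟨l, hl, b, hb, H⟩ := (hc.rotate (u := conj u) (by rwa [RCLike.norm_conj])).exists_direction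
  refine ⟨l, b, hb, hl, fun z hz => ?_⟩
  have := H z hz
  rwa [deriv_const_mul_field, deriv_const_mul_field, conj_conj] at this

lemma IsDirection.neg {u l : ℂ} {b : ℝ} (H : IsDirection h g u l b) :
    IsDirection h g (-u) (-l) (-b) := by
  refine ⟨by rw [norm_neg, H.1], fun z hz => (H.2 z hz).trans_eq ?_⟩
  congr 1
  push_cast
  simp only [map_neg]
  ring

lemma isClosed_setOf_isDirection {A : Set ℝ} (hA : IsCompact A) :
    IsClosed {t : ℝ | ∃ l, ∃ b ∈ A, IsDirection h g (exp (t * I)) l b} := by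
  refine IsSeqClosed.isClosed fun t t₀ ht hlim => ?_
  have hu : Filter.Tendsto (fun n => exp (t n * I)) Filter.atTop (nhds (exp (t₀ * I))) :=
    ((by fun_prop : Continuous fun s : ℝ => exp (s * I)).tendsto t₀).comp hlim
  obtain ⟨l, hl, b, hb, H⟩ := exists_direction_of_tendsto (A := A)
    (D := fun n z => conj (exp (t n * I)) * deriv h z + exp (t n * I) * deriv g z)
    (d := fun z => conj (exp (t₀ * I)) * deriv h z + exp (t₀ * I) * deriv g z)
    (e := fun _ _ => 0) hA
    (fun z _ => (((continuous_conj.tendsto _).comp hu).mul_const _).add (hu.mul_const _))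
    (fun _ _ => tendsto_const_nhds)
    (fun n => by
      obtain ⟨l, b, hb, hl, H⟩ := ht n
      exact ⟨l, hl, b, hb, fun z hz => by simpa using H z hz⟩)
  exact ⟨l, b, hb, hl, H⟩

/-- The angles admitting a direction with `b ≥ 0`, and those with `b ≤ 0`, form two closed sets
covering the line. Both are nonempty because the angles `0` and `π` have opposite directions. By
connectedness they meet. -/
lemma exists_two_isDirection (hc : IsConvexHarmonic h g) :
    ∃ u : ℂ, ‖u‖ = 1 ∧ (∃ l, ∃ b ∈ Icc (0 : ℝ) 1, IsDirection h g u l b) ∧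
      ∃ l, ∃ b ∈ Icc (-1 : ℝ) 0, IsDirection h g u l b := by
  set P := {t : ℝ | ∃ l, ∃ b ∈ Icc (0 : ℝ) 1, IsDirection h g (exp (t * I)) l b} with hP
  set N := {t : ℝ | ∃ l, ∃ b ∈ Icc (-1 : ℝ) 0, IsDirection h g (exp (t * I)) l b} with hN
  have hcov : ∀ t : ℝ, t ∈ P ∨ t ∈ N := fun t => by
    obtain ⟨l, b, hb, H⟩ := hc.exists_isDirection (norm_exp_ofReal_mul_I t)
    rcases le_total 0 b with h0 | h0
    · exact Or.inl ⟨l, b, ⟨h0, hb.2⟩, H⟩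
    · exact Or.inr ⟨l, b, ⟨hb.1, h0⟩, H⟩
  have hpi : exp ((Real.pi : ℝ) * I) = -exp ((0 : ℝ) * I) := by simp
  have h0 : exp ((0 : ℝ) * I) = -exp ((Real.pi : ℝ) * I) := by simp
  have hne : P.Nonempty ∧ N.Nonempty := by
    rcases hcov 0 with h1 | h1
    · obtain ⟨l, b, hb, H⟩ := h1
      exact ⟨⟨0, l, b, hb, H⟩, ⟨Real.pi, -l, -b, ⟨neg_le_neg hb.2, neg_nonpos.2 hb.1⟩, by
        rw [hpi]; exact H.neg⟩⟩
    · obtain ⟨l, b, hb, H⟩ := h1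
      exact ⟨⟨Real.pi, -l, -b, ⟨neg_nonneg.2 hb.2, by linarith [hb.1]⟩, by
        rw [hpi]; exact H.neg⟩, ⟨0, l, b, hb, H⟩⟩
  obtain ⟨t, -, htP, htN⟩ := isPreconnected_closed_iff.1 (isPreconnected_univ (α := ℝ)) P N
    (isClosed_setOf_isDirection isCompact_Icc) (isClosed_setOf_isDirection isCompact_Icc)
    (fun t _ => hcov t) (by simpa using hne.1) (by simpa using hne.2)
  exact ⟨exp (t * I), norm_exp_ofReal_mul_I t, htP, htN⟩

/-- Some rotation has either a parabolic direction with `b = 0`, or a derivative of the form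
`c / (l + 2bz + conj l z²)`. -/
lemma exists_isDirection_zero_or_const (hc : IsConvexHarmonic h g) :
    ∃ u : ℂ, ‖u‖ = 1 ∧ ((∃ l, IsDirection h g u l 0) ∨
      ∃ l : ℂ, ‖l‖ = 1 ∧ ∃ b ∈ Icc (-1 : ℝ) 1, ∀ z ∈ ball (0 : ℂ) 1,
        ((l + 2 * (b : ℝ) * z + conj l * z ^ 2) * (conj u * deriv h z + u * deriv g z)).im = 0) := by
  obtain ⟨u, hu, ⟨l₁, b₁, hb₁, h₁⟩, l₂, b₂, hb₂, h₂⟩ := hc.exists_two_isDirection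
  refine ⟨u, hu, ?_⟩
  rcases eq_or_ne b₁ 0 with h0 | h0
  · exact Or.inl ⟨l₁, h0 ▸ h₁⟩
  rcases eq_or_ne b₂ 0 with h0' | h0'
  · exact Or.inl ⟨l₂, h0' ▸ h₂⟩
  have hp₁ : 0 < b₁ := lt_of_le_of_ne hb₁.1 h0.symm
  have hp₂ : 0 < -b₂ := neg_pos.2 (lt_of_le_of_ne hb₂.2 h0')
  -- The positive weights `-b₂` and `b₁` cancel the linear terms `2bz`.
  set l := ((-b₂ : ℝ) : ℂ) * l₁ + (b₁ : ℂ) * l₂ with hl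
  have hsum : ∀ z ∈ ball (0 : ℂ) 1,
      0 ≤ ((l + conj l * z ^ 2) * (conj u * deriv h z + u * deriv g z)).im := fun z hz => by
    have e1 := mul_nonneg hp₂.le (h₁.2 z hz)
    have e2 := mul_nonneg hp₁.le (h₂.2 z hz)
    have e3 := add_nonneg e1 e2
    rw [← im_ofReal_mul, ← im_ofReal_mul, ← add_im] at e3
    refine e3.trans_eq (congrArg im ?_)
    rw [hl]
    simp only [map_add, map_mul, conj_ofReal]
    push_cast
    ring
  -- If the constant terms cancel as well, the two directions are opposite and both inequalities are
  -- equalities; otherwise normalizing `l` gives a direction with `b = 0`.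
  rcases eq_or_ne l 0 with hl0 | hl0
  · right
    have e1 : ((-b₂ : ℝ) : ℂ) * l₁ = -((b₁ : ℂ) * l₂) := eq_neg_of_add_eq_zero_left hl0
    have e2 := congrArg norm e1
    rw [norm_neg, norm_mul, norm_mul, h₁.1, h₂.1, norm_real, norm_real,
      Real.norm_of_nonneg hp₂.le, Real.norm_of_nonneg hp₁.le, mul_one, mul_one] at e2
    have e3 : l₂ = -l₁ := by
      rw [e2] at e1
      have : (b₁ : ℂ) ≠ 0 := ofReal_ne_zero.2 h0
      have e4 := mul_left_cancel₀ this (e1.trans (mul_neg _ _).symm)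
      rw [e4, neg_neg]
    refine ⟨l₁, h₁.1, b₁, ⟨by linarith [hb₁.1], hb₁.2⟩, fun z hz => le_antisymm ?_ (h₁.2 z hz)⟩
    have e5 := h₂.2 z hz
    have e6 : b₂ = -b₁ := by linarith
    rw [e3, e6] at e5
    have e7 : ((-l₁ + 2 * ((-b₁ : ℝ) : ℂ) * z + conj (-l₁) * z ^ 2) *
        (conj u * deriv h z + u * deriv g z)) = -((l₁ + 2 * (b₁ : ℝ) * z + conj l₁ * z ^ 2) *
        (conj u * deriv h z + u * deriv g z)) := by
      simp only [map_neg]; push_cast; ring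
    rw [e7, neg_im] at e5
    linarith
  · left
    have hn : 0 < ‖l‖ := norm_pos_iff.2 hl0
    refine ⟨((‖l‖⁻¹ : ℝ) : ℂ) * l, ?_, fun z hz => ?_⟩
    · rw [norm_mul, norm_real, norm_inv, norm_norm, inv_mul_cancel₀ hn.ne']
    · have e1 := mul_nonneg (inv_nonneg.2 hn.le) (hsum z hz)
      rw [← im_ofReal_mul] at e1
      refine e1.trans_eq (congrArg im ?_)
      simp only [map_mul, conj_ofReal, ofReal_zero]
      ring

end IsConvexHarmonic

lemma coeff_succ_one_sub_C_mul_X_mul (q : ℂ) (F : PowerSeries ℂ) (n : ℕ) :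
    PowerSeries.coeff (n + 1) ((1 - PowerSeries.C q * PowerSeries.X) * F) =
      PowerSeries.coeff (n + 1) F - q * PowerSeries.coeff n F := by
  rw [sub_mul, one_mul, mul_assoc, map_sub, PowerSeries.coeff_C_mul, PowerSeries.coeff_succ_X_mul]

/-- The coefficients of `k / ((1 - pX)(1 - qX))` are at most those of `1 / (1 - X)²`. -/
lemma norm_coeff_le_of_mul_eq_C {p q k : ℂ} (hp : ‖p‖ = 1) (hq : ‖q‖ = 1) (hk : ‖k‖ = 1)
    {F : PowerSeries ℂ} (hF : (1 - PowerSeries.C p * PowerSeries.X) *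
      ((1 - PowerSeries.C q * PowerSeries.X) * F) = PowerSeries.C k) (n : ℕ) :
    ‖PowerSeries.coeff n F‖ ≤ n + 1 := by
  have hE : ∀ m, ‖PowerSeries.coeff m ((1 - PowerSeries.C q * PowerSeries.X) * F)‖ = 1 := by
    intro m
    induction m with
    | zero =>
      have := congrArg (PowerSeries.coeff 0) hF
      rw [← hk]
      simpa using congrArg norm this
    | succ m ih =>
      have := congrArg (PowerSeries.coeff (m + 1)) hF
      rw [coeff_succ_one_sub_C_mul_X_mul, PowerSeries.coeff_C, if_neg m.succ_ne_zero,
        sub_eq_zero] at this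
      rw [this, norm_mul, hp, ih, one_mul]
  induction n with
  | zero =>
    have := hE 0
    simp at this
    simp [this]
  | succ m ih =>
    have h1 := hE (m + 1)
    rw [coeff_succ_one_sub_C_mul_X_mul] at h1
    have h2 : PowerSeries.coeff (m + 1) F =
        (PowerSeries.coeff (m + 1) F - q * PowerSeries.coeff m F) + q * PowerSeries.coeff m F := by
      ring
    rw [h2]
    refine (norm_add_le _ _).trans ?_
    rw [h1, norm_mul, hq, one_mul]
    push_cast
    linarith

/-- Since `|b| ≤ 1`, one can write `-b = cos t`, and `l + 2bz + \bar l z² = l(1 - pz)(1 - qz)` with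
`p, q = \bar l e^{±it}` unimodular. -/
lemma norm_taylorCoeffZero_le_of_mul_eqOn_const {l : ℂ} {b : ℝ} (hl : ‖l‖ = 1)
    (hb : b ∈ Icc (-1 : ℝ) 1) {F : ℂ → ℂ} (hF : DifferentiableOn ℂ F (ball 0 1)) {k : ℂ}
    (hk : ‖k‖ = 1)
    (hc : EqOn (fun z => (l + 2 * (b : ℝ) * z + conj l * z ^ 2) * F z) (fun _ => k) (ball 0 1))
    (n : ℕ) : ‖taylorCoeffZero F n‖ ≤ n + 1 := by
  have h1 := taylorPowerSeries_congr hc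
  rw [taylorPowerSeries_quadratic_mul l (2 * (b : ℝ)) hF, taylorPowerSeries_const] at h1
  set t := Real.arccos (-b) with ht
  have hcos : Real.cos t = -b := Real.cos_arccos (by linarith [hb.2]) (by linarith [hb.1])
  have hll : l * conj l = 1 := by
    rw [mul_conj, normSq_eq_norm_sq, hl]; simp
  have hee : exp (t * I) * exp (-t * I) = 1 := by rw [← exp_add]; simp
  have hs : exp (t * I) + exp (-t * I) = -2 * (b : ℝ) := by
    have := Complex.two_cos (t : ℂ)
    rw [← this, ← ofReal_cos, hcos]; push_cast; ring
  rw [← coeff_taylorPowerSeries]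
  refine norm_coeff_le_of_mul_eq_C (p := conj l * exp (t * I)) (q := conj l * exp (-t * I))
    (k := conj l * k) ?_ ?_ ?_ ?_ n
  · rw [norm_mul, RCLike.norm_conj, hl, norm_exp_ofReal_mul_I, one_mul]
  · rw [norm_mul, RCLike.norm_conj, hl, ← ofReal_neg, norm_exp_ofReal_mul_I, one_mul]
  · rw [norm_mul, RCLike.norm_conj, hl, hk, one_mul]
  · rw [map_mul PowerSeries.C (conj l) k, ← h1, ← mul_assoc, ← mul_assoc]
    congr 1
    have e1 : PowerSeries.C (conj l) * PowerSeries.C l = 1 := by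
      rw [← map_mul, mul_comm, hll, map_one]
    have e2 : PowerSeries.C (exp (t * I)) * PowerSeries.C (exp (-t * I)) = 1 := by
      rw [← map_mul, hee, map_one]
    have e3 : PowerSeries.C (exp (t * I)) + PowerSeries.C (exp (-t * I)) =
        -PowerSeries.C (2 * ((b : ℝ) : ℂ)) := by
      rw [← map_add, hs, ← map_neg]; congr 1; ring
    rw [map_mul PowerSeries.C (conj l), map_mul PowerSeries.C (conj l)]
    linear_combination (-1 : PowerSeries ℂ) * e1 + PowerSeries.C (conj l) ^ 2 * PowerSeries.X ^ 2 * e2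
      - PowerSeries.C (conj l) * PowerSeries.X * e3

/-- The function `-i(l + \bar l z²)F` has nonnegative real part and modulus `1` at the origin, so
its later coefficients are at most `2`. Comparison gives `|F_{m+2}| ≤ 2 + |F_m|`, starting from
`|F_0| = 1` and `|F_1| ≤ 2`. This is why `b = 0` is wanted: a linear term would weaken the
comparison already at `n = 1`, to `2 + 2|b|`. -/
lemma norm_taylorCoeffZero_le_of_parabolic {l : ℂ} (hl : ‖l‖ = 1) {F : ℂ → ℂ}
    (hF : DifferentiableOn ℂ F (ball 0 1)) (h0 : ‖F 0‖ = 1)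
    (him : ∀ z ∈ ball (0 : ℂ) 1, 0 ≤ ((l + conj l * z ^ 2) * F z).im) (n : ℕ) :
    ‖taylorCoeffZero F n‖ ≤ n + 1 := by
  have hid : DifferentiableOn ℂ (fun z : ℂ => l + 0 * z + conj l * z ^ 2) (ball 0 1) := by fun_prop
  have hid' : DifferentiableOn ℂ (fun z : ℂ => (l + 0 * z + conj l * z ^ 2) * F z) (ball 0 1) :=
    hid.mul hF
  have hQd := hid'.const_mul (-I)
  have hQ : ∀ m, m ≠ 0 → ‖PowerSeries.coeff m ((PowerSeries.C l + PowerSeries.C 0 * PowerSeries.X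
      + PowerSeries.C (conj l) * PowerSeries.X ^ 2) * taylorPowerSeries F)‖ ≤ 2 := by
    intro m hm
    have h1 := norm_taylorCoeffZero_le_of_re_nonneg hQd (fun z hz => by
      have := him z hz
      simpa using this) hm
    have h2 := taylorPowerSeries_const_mul (-I) hid'
    have h3 := taylorPowerSeries_quadratic_mul l 0 hF
    have h4 := congrArg (PowerSeries.coeff m) h2
    rw [coeff_taylorPowerSeries, PowerSeries.coeff_C_mul] at h4
    rw [← h3]
    have h5 := congrArg norm h4
    rw [norm_mul, norm_neg, norm_I, one_mul] at h5
    refine h5.symm.le.trans (h1.trans ?_)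
    have h6 := re_le_norm (-I * ((l + 0 * 0 + conj l * 0 ^ 2) * F 0))
    have h7 : ‖-I * ((l + 0 * 0 + conj l * 0 ^ 2) * F 0)‖ = 1 := by
      simp [hl, h0]
    linarith
  simp only [map_zero, zero_mul, add_zero] at hQ
  rw [← coeff_taylorPowerSeries]
  have hexp : ∀ m, PowerSeries.coeff (m + 2) ((PowerSeries.C l +
      PowerSeries.C (conj l) * PowerSeries.X ^ 2) * taylorPowerSeries F) =
      l * PowerSeries.coeff (m + 2) (taylorPowerSeries F) +
        conj l * PowerSeries.coeff m (taylorPowerSeries F) := by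
    intro m
    rw [add_mul, map_add, PowerSeries.coeff_C_mul, mul_assoc, PowerSeries.coeff_C_mul,
      PowerSeries.coeff_X_pow_mul]
  induction n using Nat.twoStepInduction with
  | zero =>
    rw [coeff_taylorPowerSeries, taylorCoeffZero_zero, h0]; simp
  | one =>
    have h1 := hQ 1 one_ne_zero
    have : PowerSeries.coeff 1 ((PowerSeries.C l +
      PowerSeries.C (conj l) * PowerSeries.X ^ 2) * taylorPowerSeries F) =
      l * PowerSeries.coeff 1 (taylorPowerSeries F) := by
      rw [add_mul, map_add, PowerSeries.coeff_C_mul, mul_assoc, PowerSeries.coeff_C_mul,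
        PowerSeries.coeff_X_pow_mul', if_neg (by norm_num), mul_zero, add_zero]
    rw [this, norm_mul, hl, one_mul] at h1
    push_cast
    linarith
  | more m ih _ =>
    have h1 := hQ (m + 2) (by omega)
    rw [hexp] at h1
    have h2 := norm_sub_norm_le (l * PowerSeries.coeff (m + 2) (taylorPowerSeries F))
      (-(conj l * PowerSeries.coeff m (taylorPowerSeries F)))
    rw [sub_neg_eq_add, norm_neg, norm_mul, norm_mul, RCLike.norm_conj, hl, one_mul, one_mul] at h2
    push_cast
    linarith

namespace IsConvexHarmonic
variable {h g : ℂ → ℂ}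

lemma exists_norm_taylorCoeffZero_le (hc : IsConvexHarmonic h g) (hh : deriv h 0 = 1)
    (hg : deriv g 0 = 0) : ∃ u : ℂ, ‖u‖ = 1 ∧
      ∀ n, ‖taylorCoeffZero (fun z => conj u * deriv h z + u * deriv g z) n‖ ≤ n + 1 := by
  obtain ⟨u, hu, H⟩ := hc.exists_isDirection_zero_or_const
  refine ⟨u, hu, ?_⟩
  have hF : DifferentiableOn ℂ (fun z => conj u * deriv h z + u * deriv g z) (ball 0 1) :=
    ((hc.diff_h.deriv isOpen_ball).const_mul _).add ((hc.diff_g.deriv isOpen_ball).const_mul _)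
  have h0 : ‖conj u * deriv h 0 + u * deriv g 0‖ = 1 := by simp [hh, hg, hu]
  rcases H with ⟨l, hl, H⟩ | ⟨l, hl, b, hb, H⟩
  · exact norm_taylorCoeffZero_le_of_parabolic hl hF h0 fun z hz => by simpa using H z hz
  · have hd : DifferentiableOn ℂ (fun z => (l + 2 * (b : ℝ) * z + conj l * z ^ 2) *
        (conj u * deriv h z + u * deriv g z)) (ball 0 1) :=
      DifferentiableOn.mul (by fun_prop) hF
    obtain ⟨c, hc⟩ := (hd.analyticOnNhd isOpen_ball).eq_const_of_im_eq_const H isOpen_ball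
      ⟨nonempty_ball.2 one_pos, (convex_ball (0 : ℂ) 1).isPreconnected⟩
    refine norm_taylorCoeffZero_le_of_mul_eqOn_const hl hb hF (k := c) ?_ hc
    rw [← hc 0 (mem_ball_self one_pos)]
    simp only [mul_zero, add_zero, norm_mul, h0, hl, mul_one, zero_pow two_ne_zero]

/-- Coefficient bounds for the derivatives of a normalized convex harmonic map. -/
lemma norm_taylorCoeffZero_deriv_le (hc : IsConvexHarmonic h g) (hh : deriv h 0 = 1)
    (hg : deriv g 0 = 0) (n : ℕ) :
    ‖taylorCoeffZero (deriv h) n‖ ≤ (n + 1) * (n + 2) / 2 ∧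
      ‖taylorCoeffZero (deriv g) n‖ ≤ n * (n + 1) / 2 := by
  obtain ⟨u, hu, hS⟩ := hc.exists_norm_taylorCoeffZero_le hh hg
  have hd1 : DifferentiableOn ℂ (fun z => conj u * deriv h z) (ball 0 1) :=
    (hc.diff_h.deriv isOpen_ball).const_mul _
  have hd2 : DifferentiableOn ℂ (fun z => u * deriv g z) (ball 0 1) :=
    (hc.diff_g.deriv isOpen_ball).const_mul _
  have hn1 : ∀ z, ‖conj u * deriv h z‖ = ‖deriv h z‖ := fun z => by
    rw [norm_mul, RCLike.norm_conj, hu, one_mul]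
  have hn2 : ∀ z, ‖u * deriv g z‖ = ‖deriv g z‖ := fun z => by rw [norm_mul, hu, one_mul]
  have hlt : ∀ z ∈ ball (0 : ℂ) 1, ‖u * deriv g z‖ < ‖conj u * deriv h z‖ := fun z hz => by
    rw [hn1, hn2]; exact hc.norm_deriv_lt z hz
  have hu0 : u ≠ 0 := norm_ne_zero_iff.1 (by rw [hu]; exact one_ne_zero)
  set A : ℂ → ℂ := fun z => conj u * deriv h z with hA
  set B : ℂ → ℂ := fun z => u * deriv g z with hB
  have hne : ∀ z ∈ ball (0 : ℂ) 1, A z + B z ≠ 0 := fun z hz h0 => by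
    have := hlt z hz
    have h1 := congrArg norm (eq_neg_of_add_eq_zero_left h0)
    rw [norm_neg] at h1
    exact this.ne h1.symm
  have hSd : DifferentiableOn ℂ (fun z => A z + B z) (ball 0 1) := hd1.add hd2
  -- The real part of this quotient has the sign of `|A|² - |B|²`.
  have hQd : DifferentiableOn ℂ (fun z => (A z - B z) / (A z + B z)) (ball 0 1) :=
    (hd1.sub hd2).div hSd hne
  have hQ0 : (A 0 - B 0) / (A 0 + B 0) = 1 := by
    simp [hA, hB, hh, hg, hu0]
  have hQ : ∀ m, m ≠ 0 → ‖taylorCoeffZero (fun z => (A z - B z) / (A z + B z)) m‖ ≤ 2 := by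
    intro m hm
    refine (norm_taylorCoeffZero_le_of_re_nonneg hQd (fun z hz => ?_) hm).trans_eq ?_
    · rw [div_eq_mul_inv, inv_def, ← mul_assoc, re_mul_ofReal]
      refine mul_nonneg ?_ (inv_nonneg.2 (normSq_nonneg _))
      have h1 := (hlt z hz).le
      have h2 := mul_self_le_mul_self (norm_nonneg _) h1
      rw [norm_mul_self_eq_normSq, norm_mul_self_eq_normSq, normSq_apply, normSq_apply] at h2
      simp only [mul_re, sub_re, sub_im, map_add, add_re, add_im, conj_re, conj_im]
      nlinarith
    · simp only [hQ0]; simp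
  set T := taylorPowerSeries (fun z => (A z - B z) / (A z + B z)) with hT
  set S := taylorPowerSeries (fun z => A z + B z) with hSdef
  have hTc : ∀ m, m ≠ 0 → ‖PowerSeries.coeff m T‖ ≤ 2 := fun m hm => by
    rw [hT, coeff_taylorPowerSeries]; exact hQ m hm
  have hT0 : PowerSeries.coeff 0 T = 1 := by
    rw [hT, coeff_taylorPowerSeries, taylorCoeffZero_zero, hQ0]
  have hSc : ∀ m, ‖PowerSeries.coeff m S‖ ≤ m + 1 := fun m => by
    rw [hSdef, coeff_taylorPowerSeries]; exact hS m
  have hST : S * T = taylorPowerSeries A + PowerSeries.C (-1) * taylorPowerSeries B := by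
    rw [hSdef, hT, ← taylorPowerSeries_mul hSd hQd, ← taylorPowerSeries_const_mul _ hd2,
      ← taylorPowerSeries_add hd1 (hd2.const_mul _)]
    refine taylorPowerSeries_congr fun z hz => ?_
    have := hne z hz
    rw [mul_div_cancel₀ _ this]
    ring
  have hS' : S = taylorPowerSeries A + taylorPowerSeries B := taylorPowerSeries_add hd1 hd2
  have hC : (PowerSeries.C (-1) : PowerSeries ℂ) = -1 := by simp
  rw [hC] at hST
  -- `S` is the sum and `S * T` the difference of the two series, so `A` and `B` are recovered from
  -- factors with known coefficient bounds.
  have hA2 : PowerSeries.C 2 * taylorPowerSeries A = S * (1 + T) := by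
    have : (PowerSeries.C (2 : ℂ) : PowerSeries ℂ) = 2 := rfl
    rw [mul_add, mul_one, hST, hS', this]; ring
  have hB2 : PowerSeries.C 2 * taylorPowerSeries B = S * (1 - T) := by
    have : (PowerSeries.C (2 : ℂ) : PowerSeries ℂ) = 2 := rfl
    rw [mul_sub, mul_one, hST, hS', this]; ring
  have hgauss : ∀ m : ℕ, ∑ i ∈ Finset.range m, ((i : ℝ) + 1) = m * (m + 1) / 2 := by
    intro m
    induction m with
    | zero => simp
    | succ m ih => rw [Finset.sum_range_succ, ih]; push_cast; ring
  have h1 : ∀ m, ‖PowerSeries.coeff m (1 + T)‖ ≤ 2 := fun m => by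
    rcases eq_or_ne m 0 with rfl | hm
    · rw [map_add, hT0]; norm_num
    · rw [map_add, PowerSeries.coeff_one, if_neg hm, zero_add]; exact hTc m hm
  have h2 : ∀ m, m ≠ 0 → ‖PowerSeries.coeff m (1 - T)‖ ≤ 2 := fun m hm => by
    rw [map_sub, PowerSeries.coeff_one, if_neg hm, zero_sub, norm_neg]; exact hTc m hm
  have h3 : PowerSeries.coeff 0 (1 - T) = 0 := by rw [map_sub, hT0]; simp
  have e1 : ‖taylorCoeffZero (deriv h) n‖ = ‖PowerSeries.coeff n (taylorPowerSeries A)‖ := by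
    rw [hA, taylorPowerSeries_const_mul _ (hc.diff_h.deriv isOpen_ball), PowerSeries.coeff_C_mul,
      norm_mul, RCLike.norm_conj, hu, one_mul, coeff_taylorPowerSeries]
  have e2 : ‖taylorCoeffZero (deriv g) n‖ = ‖PowerSeries.coeff n (taylorPowerSeries B)‖ := by
    rw [hB, taylorPowerSeries_const_mul _ (hc.diff_g.deriv isOpen_ball), PowerSeries.coeff_C_mul,
      norm_mul, hu, one_mul, coeff_taylorPowerSeries]
  rw [e1, e2]
  constructor
  · have h4 := congrArg (fun F => ‖PowerSeries.coeff n F‖) hA2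
    beta_reduce at h4
    rw [PowerSeries.coeff_C_mul, norm_mul, PowerSeries.coeff_mul,
      Finset.Nat.sum_antidiagonal_eq_sum_range_succ_mk] at h4
    have h5 : ‖∑ k ∈ Finset.range n.succ, PowerSeries.coeff k S * PowerSeries.coeff (n - k) (1 + T)‖
        ≤ ∑ k ∈ Finset.range n.succ, ((k : ℝ) + 1) * 2 := by
      refine norm_sum_le_of_le _ fun k _ => ?_
      rw [norm_mul]
      exact mul_le_mul (hSc k) (h1 _) (norm_nonneg _) (by positivity)
    rw [← h4, ← Finset.sum_mul, hgauss, norm_ofNat] at h5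
    push_cast at h5
    linarith
  · have h4 := congrArg (fun F => ‖PowerSeries.coeff n F‖) hB2
    beta_reduce at h4
    rw [PowerSeries.coeff_C_mul, norm_mul, PowerSeries.coeff_mul,
      Finset.Nat.sum_antidiagonal_eq_sum_range_succ_mk] at h4
    -- The constant term of `1 - T` vanishes, which removes the last summand and makes the bound for
    -- `g` smaller than that for `h`.
    rw [Finset.sum_range_succ, Nat.sub_self, h3, mul_zero, add_zero] at h4
    have h5 : ‖∑ k ∈ Finset.range n, PowerSeries.coeff k S * PowerSeries.coeff (n - k) (1 - T)‖
        ≤ ∑ k ∈ Finset.range n, ((k : ℝ) + 1) * 2 := by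
      refine norm_sum_le_of_le _ fun k hk => ?_
      rw [norm_mul]
      have := Finset.mem_range.1 hk
      exact mul_le_mul (hSc k) (h2 _ (by omega)) (norm_nonneg _) (by positivity)
    rw [← h4, ← Finset.sum_mul, hgauss, norm_ofNat] at h5
    linarith

/-- Coefficient bounds for normalized convex harmonic maps. -/
theorem norm_taylorCoeffZero_le (hc : IsConvexHarmonic h g) (hh : deriv h 0 = 1)
    (hg : deriv g 0 = 0) {n : ℕ} (hn : n ≠ 0) :
    ‖taylorCoeffZero h n‖ ≤ ((n : ℝ) + 1) / 2 ∧ ‖taylorCoeffZero g n‖ ≤ ((n : ℝ) - 1) / 2 := by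
  obtain ⟨m, rfl⟩ := Nat.exists_eq_succ_of_ne_zero hn
  have hm : (0 : ℝ) < m + 1 := by positivity
  have key := hc.norm_taylorCoeffZero_deriv_le hh hg m
  have e : ∀ p : ℂ → ℂ, ‖taylorCoeffZero (deriv p) m‖ = (m + 1) * ‖taylorCoeffZero p (m + 1)‖ := by
    intro p
    rw [taylorCoeffZero_deriv, norm_mul]
    congr 1
    exact_mod_cast norm_natCast (m + 1)
  rw [e, e] at key
  simp only [Nat.succ_eq_add_one, Nat.cast_add, Nat.cast_one]
  constructor
  · refine le_of_mul_le_mul_left (key.1.trans_eq ?_) hm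
    ring
  · refine le_of_mul_le_mul_left (key.2.trans_eq ?_) hm
    ring

end IsConvexHarmonic

/-! ### Entire series and the Wright functions. -/

/-- The power series with coefficients `c` converges on the whole plane. -/
def IsEntireSeries (c : ℕ → ℂ) : Prop :=
  ∀ r : ℝ, 0 ≤ r → Summable fun n => ‖c n‖ * r ^ n

namespace IsEntireSeries
variable {c : ℕ → ℂ}

lemma hasFPowerSeriesOnBall (hc : IsEntireSeries c) :
    HasFPowerSeriesOnBall (fun z => ∑' n, c n * z ^ n)
      (FormalMultilinearSeries.ofScalars ℂ c) 0 ⊤ := by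
  have hr : (FormalMultilinearSeries.ofScalars ℂ c).radius = ⊤ :=
    FormalMultilinearSeries.radius_eq_top_of_summable_norm _ fun r => by
      simpa only [FormalMultilinearSeries.ofScalars_norm] using hc r r.2
  have h := (FormalMultilinearSeries.ofScalars ℂ c).hasFPowerSeriesOnBall (by rw [hr]; simp)
  rw [hr] at h
  refine h.congr fun z _ => ?_
  have := FormalMultilinearSeries.ofScalars_sum_eq (E := ℂ) c z
  simpa [FormalMultilinearSeries.ofScalarsSum] using this

lemma differentiable (hc : IsEntireSeries c) : Differentiable ℂ fun z => ∑' n, c n * z ^ n :=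
  fun z => (hc.hasFPowerSeriesOnBall.differentiableOn z (by simp)).differentiableAt (by simp)

lemma taylorCoeffZero_tsum (hc : IsEntireSeries c) (n : ℕ) :
    taylorCoeffZero (fun z => ∑' n, c n * z ^ n) n = c n := by
  have h := hc.hasFPowerSeriesOnBall.factorial_smul 1 n
  have hf : (n.factorial : ℂ) ≠ 0 := by exact_mod_cast n.factorial_ne_zero
  rw [taylorCoeffZero, iteratedDeriv_eq_iteratedFDeriv, div_eq_iff hf, ← h]
  simp [FormalMultilinearSeries.ofScalars, mul_comm]

lemma of_norm_le {d : ℕ → ℂ} (hc : IsEntireSeries c) {q : ℝ} (hq : 0 ≤ q)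
    (h : ∀ n, ‖d n‖ ≤ q ^ n * ‖c n‖) : IsEntireSeries d := fun r hr => by
  refine Summable.of_nonneg_of_le (fun n => by positivity) (fun n => ?_) (hc (q * r) (by positivity))
  calc ‖d n‖ * r ^ n ≤ q ^ n * ‖c n‖ * r ^ n := by gcongr; exact h n
    _ = _ := by rw [mul_pow]; ring

end IsEntireSeries

lemma taylorCoeffZero_iteratedDeriv (p : ℂ → ℂ) (k n : ℕ) :
    taylorCoeffZero (iteratedDeriv k p) n =
      ((n + k).descFactorial k : ℂ) * taylorCoeffZero p (n + k) := by
  have h1 : (n.factorial : ℂ) ≠ 0 := by exact_mod_cast n.factorial_ne_zero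
  have h2 : ((n + k).factorial : ℂ) ≠ 0 := by exact_mod_cast (n + k).factorial_ne_zero
  have h3 : (n.factorial : ℂ) * ((n + k).descFactorial k : ℂ) = (n + k).factorial := by
    have := Nat.factorial_mul_descFactorial (Nat.le_add_left k n)
    rw [Nat.add_sub_cancel] at this
    exact_mod_cast this
  have h4 : iteratedDeriv n (iteratedDeriv k p) = iteratedDeriv (n + k) p := by
    rw [iteratedDeriv_eq_iterate, iteratedDeriv_eq_iterate, iteratedDeriv_eq_iterate,
      Function.iterate_add_apply]
  rw [taylorCoeffZero, taylorCoeffZero, h4, ← h3]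
  field_simp

lemma Differentiable.iteratedDeriv {p : ℂ → ℂ} (hp : Differentiable ℂ p) (k : ℕ) :
    Differentiable ℂ (iteratedDeriv k p) := by
  induction k with
  | zero => simpa using hp
  | succ k ih =>
    rw [iteratedDeriv_succ]
    exact differentiableOn_univ.1 (ih.differentiableOn.deriv isOpen_univ)

lemma hasSum_descFactorial_mul_taylorCoeffZero {p : ℂ → ℂ} (hp : Differentiable ℂ p) (k : ℕ)
    (z : ℂ) : HasSum (fun n : ℕ => (n.descFactorial k : ℂ) * taylorCoeffZero p n * z ^ n)
      (z ^ k * iteratedDeriv k p z) := by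
  have h1 := (hasSum_taylorSeries_of_entire (hp.iteratedDeriv k) 0 z).mul_left (z ^ k)
  have h2 : ∑ i ∈ Finset.range k, (i.descFactorial k : ℂ) * taylorCoeffZero p i * z ^ i = 0 :=
    Finset.sum_eq_zero fun i hi => by
      rw [Nat.descFactorial_eq_zero_iff_lt.2 (Finset.mem_range.1 hi)]; simp
  rw [← hasSum_nat_add_iff' k, h2, sub_zero]
  convert! h1 using 2 with n
  have h3 := taylorCoeffZero_iteratedDeriv p k n
  rw [← h3, taylorCoeffZero, smul_eq_mul, smul_eq_mul, sub_zero]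
  ring

/-- Keep only `[S, S + 1]` in the Gamma integral; for `x < 1` use `Γ(x + 1) = x Γ(x)`. As the base
`S` is arbitrary, this growth is enough for infinite radius of convergence. -/
lemma le_Gamma {x S : ℝ} (hx : 0 < x) (hS : 1 ≤ S) :
    S ^ (x - 1) * Real.exp (-(S + 1)) ≤ Real.Gamma x := by
  have hS0 : 0 < S := by linarith
  have key : ∀ y : ℝ, 1 ≤ y → S ^ (y - 1) * Real.exp (-(S + 1)) ≤ Real.Gamma y := by
    intro y hy
    have hy0 : 0 < y := by linarith
    rw [Real.Gamma_eq_integral hy0]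
    have hsub : Icc S (S + 1) ⊆ Ioi (0 : ℝ) := fun t ht => hS0.trans_le ht.1
    have hint := Real.GammaIntegral_convergent hy0
    have h1 : ∫ t in Icc S (S + 1), Real.exp (-t) * t ^ (y - 1) ≤
        ∫ t in Ioi (0 : ℝ), Real.exp (-t) * t ^ (y - 1) := by
      refine MeasureTheory.setIntegral_mono_set hint ?_ hsub.eventuallyLE
      filter_upwards [MeasureTheory.self_mem_ae_restrict measurableSet_Ioi] with t ht
      have : (0 : ℝ) < t := ht
      simp only [Pi.zero_apply]
      positivity
    refine le_trans ?_ h1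
    have h2 : ∫ _ in Icc S (S + 1), S ^ (y - 1) * Real.exp (-(S + 1)) =
        S ^ (y - 1) * Real.exp (-(S + 1)) := by
      simp
    rw [← h2]
    refine MeasureTheory.setIntegral_mono_on (MeasureTheory.integrableOn_const (by simp)) (hint.mono_set hsub) measurableSet_Icc
      fun t ht => ?_
    rw [mul_comm]
    have : S ^ (y - 1) ≤ t ^ (y - 1) := Real.rpow_le_rpow hS0.le ht.1 (by linarith)
    have h3 : Real.exp (-(S + 1)) ≤ Real.exp (-t) := Real.exp_le_exp.2 (by linarith [ht.2])
    gcongr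
  rcases le_or_gt 1 x with h | h
  · exact key x h
  · have h1 := key (x + 1) (by linarith)
    rw [Real.Gamma_add_one hx.ne'] at h1
    have h2 : S ^ (x - 1) ≤ S ^ (x + 1 - 1) := Real.rpow_le_rpow_of_exponent_le hS (by linarith)
    have h3 := Real.Gamma_pos_of_pos hx
    calc S ^ (x - 1) * Real.exp (-(S + 1)) ≤ S ^ (x + 1 - 1) * Real.exp (-(S + 1)) := by gcongr
      _ ≤ x * Real.Gamma x := h1
      _ ≤ Real.Gamma x := by nlinarith

/-- The coefficients of the normalized Wright function. -/
noncomputable def wrightCoeff (α β γ δ : ℝ) : ℕ → ℝ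
  | 0 => 0
  | n + 1 => Real.Gamma α * Real.Gamma γ / (Real.Gamma (α + n * β) * Real.Gamma (γ + n * δ))

section wright
variable {α β γ δ : ℝ}

lemma wrightCoeff_nonneg (hα : 0 < α) (hγ : 0 < γ) (hβ : 0 ≤ β) (hδ : 0 ≤ δ) (n : ℕ) :
    0 ≤ wrightCoeff α β γ δ n := by
  rcases n with _ | n
  · exact le_rfl
  · have h1 := Real.Gamma_pos_of_pos hα
    have h2 := Real.Gamma_pos_of_pos hγ
    have h3 := Real.Gamma_pos_of_pos (by positivity : 0 < α + n * β)
    have h4 := Real.Gamma_pos_of_pos (by positivity : 0 < γ + n * δ)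
    simp only [wrightCoeff]
    positivity

lemma wrightCoeff_one (hα : 0 < α) (hγ : 0 < γ) : wrightCoeff α β γ δ 1 = 1 := by
  have h1 := (Real.Gamma_pos_of_pos hα).ne'
  have h2 := (Real.Gamma_pos_of_pos hγ).ne'
  simp [wrightCoeff, h1, h2]

lemma isEntireSeries_wrightCoeff (hα : 0 < α) (hγ : 0 < γ) (hβ : 0 ≤ β) (hδ : 0 ≤ δ)
    (hβδ : 0 < β + δ) : IsEntireSeries fun n => (wrightCoeff α β γ δ n : ℂ) := by
  intro r hr
  -- Chosen so that `S^{β+δ} ≥ 2r`: the product of the two Gamma factors grows at least like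
  -- `(2r)^n`, and the series at radius `r` is dominated by a geometric one with ratio `1/2`.
  set S : ℝ := max 1 ((2 * r) ^ (β + δ)⁻¹) with hS
  have hS1 : 1 ≤ S := le_max_left _ _
  have hS0 : 0 < S := by linarith
  have hSr : 2 * r ≤ S ^ (β + δ) := by
    calc 2 * r = ((2 * r) ^ (β + δ)⁻¹) ^ (β + δ) := by
          rw [← Real.rpow_mul (by positivity), inv_mul_cancel₀ hβδ.ne', Real.rpow_one]
      _ ≤ S ^ (β + δ) := Real.rpow_le_rpow (by positivity) (le_max_right _ _) hβδ.le
  have hSp : 0 < S ^ (β + δ) := Real.rpow_pos_of_pos hS0 _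
  set K : ℝ := S ^ (α - 1) * S ^ (γ - 1) * Real.exp (-(S + 1)) ^ 2 with hK
  have hK0 : 0 < K := by positivity
  have h1 := Real.Gamma_pos_of_pos hα
  have h2 := Real.Gamma_pos_of_pos hγ
  rw [← summable_nat_add_iff 1]
  refine Summable.of_nonneg_of_le (fun n => by positivity) (fun n => ?_)
    ((summable_geometric_two).mul_left (Real.Gamma α * Real.Gamma γ * r / K))
  have h5 : (0 : ℝ) < α + n * β := by positivity
  have h6 : (0 : ℝ) < γ + n * δ := by positivity
  have h3 := le_Gamma h5 hS1
  have h4 := le_Gamma h6 hS1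
  have h7 : K * (S ^ (β + δ)) ^ n ≤ Real.Gamma (α + n * β) * Real.Gamma (γ + n * δ) := by
    refine le_trans (le_of_eq ?_) (mul_le_mul h3 h4 (by positivity)
      (Real.Gamma_pos_of_pos h5).le)
    have e1 : S ^ (α + n * β - 1) = S ^ (α - 1) * S ^ (n * β) := by
      rw [← Real.rpow_add hS0]; ring_nf
    have e2 : S ^ (γ + n * δ - 1) = S ^ (γ - 1) * S ^ (n * δ) := by
      rw [← Real.rpow_add hS0]; ring_nf
    have e3 : (S ^ (β + δ)) ^ n = S ^ (n * β) * S ^ (n * δ) := by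
      rw [← Real.rpow_add hS0, ← Real.rpow_mul_natCast hS0.le]; ring_nf
    rw [e1, e2, e3, hK]; ring
  rw [norm_real, Real.norm_of_nonneg (wrightCoeff_nonneg hα hγ hβ hδ _)]
  simp only [wrightCoeff]
  have h8 : 0 < K * (S ^ (β + δ)) ^ n := by positivity
  calc Real.Gamma α * Real.Gamma γ / (Real.Gamma (α + n * β) * Real.Gamma (γ + n * δ)) * r ^ (n + 1)
      ≤ Real.Gamma α * Real.Gamma γ / (K * (S ^ (β + δ)) ^ n) * r ^ (n + 1) := by gcongr
    _ = Real.Gamma α * Real.Gamma γ * r / K * (r / S ^ (β + δ)) ^ n := by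
        rw [div_pow, pow_succ]; field_simp
    _ ≤ Real.Gamma α * Real.Gamma γ * r / K * (1 / 2) ^ n := by
        refine mul_le_mul_of_nonneg_left (pow_le_pow_left₀ (by positivity) ?_ n) (by positivity)
        rw [div_le_div_iff₀ hSp two_pos]; linarith

lemma wrightNormalized_eq_tsum (hα : 0 < α) (hγ : 0 < γ) (hβ : 0 ≤ β) (hδ : 0 ≤ δ)
    (hβδ : 0 < β + δ) :
    wrightNormalized α β γ δ = fun z => ∑' n, (wrightCoeff α β γ δ n : ℂ) * z ^ n := by
  ext z
  have hs : Summable fun n => (wrightCoeff α β γ δ n : ℂ) * z ^ n :=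
    Summable.of_norm (by
      simpa only [norm_mul, norm_pow] using
        isEntireSeries_wrightCoeff hα hγ hβ hδ hβδ ‖z‖ (norm_nonneg z))
  rw [hs.tsum_eq_zero_add, wrightNormalized, wright, ← tsum_mul_left]
  simp only [wrightCoeff, ofReal_zero, zero_mul, zero_add]
  refine tsum_congr fun n => ?_
  push_cast
  ring

end wright

/-! ### The coefficient criterion for harmonic convexity of order `a`. -/

/-- A nonvanishing curve has a differentiable argument, whose derivative is the imaginary part of the
logarithmic derivative. -/
lemma exists_differentiable_argument {T T' : ℝ → ℂ} (hT : ∀ θ, HasDerivAt T (T' θ) θ)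
    (hc : Continuous T') (h0 : ∀ θ, T θ ≠ 0) :
    ∃ φ : ℝ → ℝ, Differentiable ℝ φ ∧ (∀ θ, T θ = ‖T θ‖ * exp (φ θ * I)) ∧
      ∀ θ, deriv φ θ = (T' θ / T θ).im := by
  have hTc : Continuous T := continuous_iff_continuousAt.2 fun θ => (hT θ).continuousAt
  have hq : Continuous fun θ => T' θ / T θ := hc.div hTc h0
  set Φ : ℝ → ℂ := fun θ => ∫ t in (0 : ℝ)..θ, T' t / T t with hΦ
  have hΦd : ∀ θ, HasDerivAt Φ (T' θ / T θ) θ := fun θ => hq.integral_hasStrictDerivAt 0 θ |>.hasDerivAt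
  have hΦ0 : Φ 0 = 0 := by simp [hΦ]
  have hφd : ∀ θ, HasDerivAt (fun θ => arg (T 0) + (Φ θ).im) (T' θ / T θ).im θ := fun θ =>
    (imCLM.hasFDerivAt.comp_hasDerivAt θ (hΦd θ)).const_add _
  have hconst : ∀ θ, T θ * exp (-Φ θ) = T 0 := by
    intro θ
    have hd : ∀ t, HasDerivAt (fun t => T t * exp (-Φ t)) 0 t := fun t => by
      have h1 := (hT t).mul (hΦd t).neg.cexp
      refine h1.congr_deriv ?_
      have := h0 t
      simp only [Pi.neg_apply]
      field_simp
      ring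
    have h2 := is_const_of_deriv_eq_zero (fun t => (hd t).differentiableAt) (fun t => (hd t).deriv)
      θ 0
    rw [h2, hΦ0]; simp
  have hTΦ : ∀ θ, T θ = T 0 * exp (Φ θ) := fun θ => by
    rw [← hconst θ, mul_assoc, ← exp_add]; simp
  refine ⟨_, fun θ => (hφd θ).differentiableAt, fun θ => ?_, fun θ => (hφd θ).deriv⟩
  have h1 : ‖T θ‖ = ‖T 0‖ * Real.exp (Φ θ).re := by rw [hTΦ θ, norm_mul, norm_exp]
  have h2 : exp (Φ θ) = Real.exp (Φ θ).re * exp ((Φ θ).im * I) := by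
    rw [ofReal_exp, ← exp_add, re_add_im]
  rw [h1]
  conv_lhs => rw [hTΦ θ, h2, ← norm_mul_exp_arg_mul_I (T 0)]
  push_cast
  rw [add_mul, exp_add]
  ring

/-- If `|Y - X| < |Y + (1 - 2a)X|` then `Re (Y / X) > a`. -/
lemma lt_re_div_of_norm_sub_lt {a : ℝ} (ha1 : a < 1) {X Y : ℂ}
    (h : ‖Y - X‖ < ‖Y + ((1 - 2 * a : ℝ) : ℂ) * X‖) : X ≠ 0 ∧ a < (Y / X).re := by
  have hX : X ≠ 0 := by
    rintro rfl
    simp at h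
  refine ⟨hX, ?_⟩
  have hX2 : 0 < normSq X := normSq_pos.2 hX
  have h1 := mul_self_lt_mul_self (norm_nonneg _) h
  rw [norm_mul_self_eq_normSq, norm_mul_self_eq_normSq, normSq_apply, normSq_apply] at h1
  simp only [sub_re, sub_im, add_re, add_im, re_ofReal_mul, im_ofReal_mul] at h1
  rw [div_eq_mul_inv, inv_def, ← mul_assoc, re_mul_ofReal, ← div_eq_mul_inv, lt_div_iff₀ hX2]
  simp only [mul_re, conj_re, conj_im]
  rw [normSq_apply]
  have h2 : 0 < (1 - a) * ((Y.re * X.re - Y.im * -X.im) - a * (X.re * X.re + X.im * X.im)) := by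
    nlinarith
  have h3 := (mul_pos_iff_of_pos_left (by linarith : 0 < 1 - a)).1 h2
  linarith

section criterion
variable {a : ℝ} {c d : ℕ → ℂ}

/-- The coefficient condition for harmonic convexity of order `a`. -/
structure CoeffCondition (a : ℝ) (c d : ℕ → ℂ) : Prop where
  nonneg : 0 ≤ a
  lt_one : a < 1
  entire_c : IsEntireSeries c
  entire_d : IsEntireSeries d
  c_zero : c 0 = 0
  c_one : c 1 = 1
  d_zero : d 0 = 0
  d_one : d 1 = 0
  summable : Summable fun n : ℕ => ((n : ℝ) + 2) * (n + 2 - a) * ‖c (n + 2)‖ +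
    ((n : ℝ) + 2) * (n + 2 + a) * ‖d (n + 2)‖
  tsum_le : ∑' n : ℕ, (((n : ℝ) + 2) * (n + 2 - a) * ‖c (n + 2)‖ +
    ((n : ℝ) + 2) * (n + 2 + a) * ‖d (n + 2)‖) ≤ 1 - a

namespace CoeffCondition

/-- In the application `p₁ = zp'`, `p₂ = z²p''` and likewise for `q`. With `X = p₁ - \bar q₁` and
`Y` the other bracket, the terms of `Y - X` and the terms with `n ≥ 2` of `Y + (1-2a)X` have
majorants that add up to `2n(n-a)|c_n| + 2n(n+a)|d_n|`. Their total is at most `2(1-a)|z|²`, which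
is less than the modulus `2(1-a)|z|` of the leading term. -/
lemma norm_sub_lt (H : CoeffCondition a c d) {z : ℂ} (hz0 : z ≠ 0) (hz1 : ‖z‖ < 1)
    {p₁ p₂ q₁ q₂ : ℂ} (hp₁ : HasSum (fun n : ℕ => (n : ℂ) * c n * z ^ n) p₁)
    (hp₂ : HasSum (fun n : ℕ => ((n : ℂ) * (n - 1)) * c n * z ^ n) p₂)
    (hq₁ : HasSum (fun n : ℕ => (n : ℂ) * d n * z ^ n) q₁)
    (hq₂ : HasSum (fun n : ℕ => ((n : ℂ) * (n - 1)) * d n * z ^ n) q₂) :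
    ‖((p₁ + p₂) + conj (q₁ + q₂)) - (p₁ - conj q₁)‖ <
      ‖((p₁ + p₂) + conj (q₁ + q₂)) + ((1 - 2 * a : ℝ) : ℂ) * (p₁ - conj q₁)‖ := by
  have ha0 := H.nonneg
  have ha1 := H.lt_one
  have hr0 : 0 < ‖z‖ := norm_pos_iff.2 hz0
  have h1 : HasSum (fun n : ℕ => (((n : ℝ) * (n - 1) : ℝ) : ℂ) * c n * z ^ n +
      conj ((((n : ℝ) * (n + 1) : ℝ) : ℂ) * d n * z ^ n))
      (((p₁ + p₂) + conj (q₁ + q₂)) - (p₁ - conj q₁)) := by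
    have e := hp₂.add ((hq₁.mul_left 2).add hq₂).star
    convert! e using 1
    · ext n
      simp only [star_def]
      push_cast
      congr 2
      ring
    · simp only [star_def, map_add, map_mul, map_ofNat]; ring
  have h2 : HasSum (fun n : ℕ => (((n : ℝ) * (n + 1 - 2 * a) : ℝ) : ℂ) * c n * z ^ n +
      conj ((((n : ℝ) * (n - 1 + 2 * a) : ℝ) : ℂ) * d n * z ^ n))
      (((p₁ + p₂) + conj (q₁ + q₂)) + ((1 - 2 * a : ℝ) : ℂ) * (p₁ - conj q₁)) := by
    have e := ((hp₁.mul_left ((2 - 2 * a : ℝ) : ℂ)).add hp₂).add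
      ((hq₁.mul_left ((2 * a : ℝ) : ℂ)).add hq₂).star
    convert! e using 1
    · ext n
      simp only [star_def]
      push_cast
      congr 1
      · ring
      · congr 1; ring
    · simp only [star_def, map_add, map_mul, conj_ofReal]; push_cast; ring
  rw [← hasSum_nat_add_iff' 2] at h1 h2
  simp only [Finset.sum_range_succ, Finset.sum_range_zero, H.c_zero, H.c_one, H.d_zero, H.d_one,
    Nat.cast_zero, Nat.cast_one, mul_zero, zero_mul, map_zero, add_zero, zero_add, sub_self,
    ofReal_zero, sub_zero, one_mul, mul_one, pow_one, Nat.cast_add, Nat.cast_ofNat] at h1 h2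
  set r := ‖z‖ with hr
  have hpow : ∀ n : ℕ, r ^ (n + 2) ≤ r ^ 2 := fun n =>
    pow_le_pow_of_le_one hr0.le hz1.le (by omega)
  have bound : ∀ (x y : ℝ) (n : ℕ), 0 ≤ x → 0 ≤ y →
      ‖(x : ℂ) * c (n + 2) * z ^ (n + 2) + conj ((y : ℂ) * d (n + 2) * z ^ (n + 2))‖ ≤
        r ^ 2 * (x * ‖c (n + 2)‖ + y * ‖d (n + 2)‖) := by
    intro x y n hx hy
    refine (norm_add_le _ _).trans ?_
    rw [RCLike.norm_conj, norm_mul, norm_mul, norm_mul, norm_mul, norm_pow, norm_real, norm_real,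
      Real.norm_of_nonneg hx, Real.norm_of_nonneg hy, ← hr]
    have e1 := mul_le_mul_of_nonneg_left (hpow n) (by positivity : 0 ≤ x * ‖c (n + 2)‖)
    have e2 := mul_le_mul_of_nonneg_left (hpow n) (by positivity : 0 ≤ y * ‖d (n + 2)‖)
    linarith
  set m1 : ℕ → ℝ := fun n => r ^ 2 * ((((n : ℝ) + 2) * (n + 2 - 1)) * ‖c (n + 2)‖ +
    (((n : ℝ) + 2) * (n + 2 + 1)) * ‖d (n + 2)‖) with hm1
  set m2 : ℕ → ℝ := fun n => r ^ 2 * ((((n : ℝ) + 2) * (n + 2 + 1 - 2 * a)) * ‖c (n + 2)‖ +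
    (((n : ℝ) + 2) * (n + 2 - 1 + 2 * a)) * ‖d (n + 2)‖) with hm2
  have hn : ∀ n : ℕ, (0 : ℝ) ≤ n := fun n => Nat.cast_nonneg n
  have x1 : ∀ n : ℕ, (0 : ℝ) ≤ ((n : ℝ) + 2) * (n + 2 - 1) := fun n => by
    have := hn n; exact mul_nonneg (by linarith) (by linarith)
  have x2 : ∀ n : ℕ, (0 : ℝ) ≤ ((n : ℝ) + 2) * (n + 2 + 1) := fun n => by
    have := hn n; exact mul_nonneg (by linarith) (by linarith)
  have x3 : ∀ n : ℕ, (0 : ℝ) ≤ ((n : ℝ) + 2) * (n + 2 + 1 - 2 * a) := fun n => by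
    have := hn n; exact mul_nonneg (by linarith) (by linarith)
  have x4 : ∀ n : ℕ, (0 : ℝ) ≤ ((n : ℝ) + 2) * (n + 2 - 1 + 2 * a) := fun n => by
    have := hn n; exact mul_nonneg (by linarith) (by linarith)
  have n1 : ∀ n, 0 ≤ m1 n := fun n => mul_nonneg (by positivity)
    (add_nonneg (mul_nonneg (x1 n) (norm_nonneg _)) (mul_nonneg (x2 n) (norm_nonneg _)))
  have n2 : ∀ n, 0 ≤ m2 n := fun n => mul_nonneg (by positivity)
    (add_nonneg (mul_nonneg (x3 n) (norm_nonneg _)) (mul_nonneg (x4 n) (norm_nonneg _)))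
  have hadd : ∀ n, m1 n + m2 n = 2 * r ^ 2 * (((n : ℝ) + 2) * (n + 2 - a) * ‖c (n + 2)‖ +
      ((n : ℝ) + 2) * (n + 2 + a) * ‖d (n + 2)‖) := fun n => by
    simp only [hm1, hm2]; ring
  have hS := H.summable.mul_left (2 * r ^ 2)
  have s1 : Summable m1 := Summable.of_nonneg_of_le n1 (fun n => by
    rw [← hadd n]; linarith [n2 n]) hS
  have s2 : Summable m2 := Summable.of_nonneg_of_le n2 (fun n => by
    rw [← hadd n]; linarith [n1 n]) hS
  have hle : ∑' n, m1 n + ∑' n, m2 n ≤ 2 * r ^ 2 * (1 - a) := by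
    rw [← s1.tsum_add s2, tsum_congr hadd, tsum_mul_left]
    exact mul_le_mul_of_nonneg_left H.tsum_le (by positivity)
  have b1 := tsum_of_norm_bounded s1.hasSum fun n => bound _ _ n (x1 n) (x2 n)
  have b2 := tsum_of_norm_bounded s2.hasSum fun n => bound _ _ n (x3 n) (x4 n)
  rw [h1.tsum_eq] at b1
  rw [h2.tsum_eq] at b2
  have b3 := norm_sub_norm_le (((1 + 1 - 2 * a : ℝ) : ℂ) * z) (((p₁ + p₂) + conj (q₁ + q₂)) +
    ((1 - 2 * a : ℝ) : ℂ) * (p₁ - conj q₁))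
  rw [norm_sub_rev, norm_mul, norm_real, Real.norm_of_nonneg (by linarith), ← hr] at b3
  have b4 : r ^ 2 * (1 - a) < r * (1 - a) := by
    refine mul_lt_mul_of_pos_right ?_ (by linarith)
    rw [pow_two]; exact mul_lt_of_lt_one_left hr0 hz1
  linarith

theorem mem_classHK (H : CoeffCondition a c d) :
    (fun z => ∑' n, c n * z ^ n + conj (∑' n, d n * z ^ n)) ∈ ClassHK a := by
  set p : ℂ → ℂ := fun z => ∑' n, c n * z ^ n with hp
  set q : ℂ → ℂ := fun z => ∑' n, d n * z ^ n with hq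
  have hpd : Differentiable ℂ p := H.entire_c.differentiable
  have hqd : Differentiable ℂ q := H.entire_d.differentiable
  have hpc : ∀ n, taylorCoeffZero p n = c n := H.entire_c.taylorCoeffZero_tsum
  have hqc : ∀ n, taylorCoeffZero q n = d n := H.entire_d.taylorCoeffZero_tsum
  refine ⟨⟨p, q, hpd.differentiableOn, hqd.differentiableOn, ?_, ?_, ?_, ?_, fun _ _ => rfl⟩, ?_⟩
  · rw [← taylorCoeffZero_zero p, hpc, H.c_zero]
  · rw [← taylorCoeffZero_one, hpc, H.c_one]
  · rw [← taylorCoeffZero_zero q, hqc, H.d_zero]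
  · rw [← taylorCoeffZero_one, hqc, H.d_one]; simp
  intro r hr0 hr1
  have hdesc : ∀ n : ℕ, ((n.descFactorial 2 : ℕ) : ℂ) = (n : ℂ) * (n - 1) := fun n => by
    rcases n with _ | n
    · simp
    · simp [Nat.descFactorial_succ, mul_comm]
  have hs1 : ∀ {e : ℕ → ℂ} {f : ℂ → ℂ}, Differentiable ℂ f → (∀ n, taylorCoeffZero f n = e n) →
      ∀ z, HasSum (fun n : ℕ => (n : ℂ) * e n * z ^ n) (z * deriv f z) := by
    intro e f hf he z
    have := hasSum_descFactorial_mul_taylorCoeffZero hf 1 z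
    simpa only [he, Nat.descFactorial_one, pow_one, iteratedDeriv_one] using this
  have hs2 : ∀ {e : ℕ → ℂ} {f : ℂ → ℂ}, Differentiable ℂ f → (∀ n, taylorCoeffZero f n = e n) →
      ∀ z, HasSum (fun n : ℕ => ((n : ℂ) * (n - 1)) * e n * z ^ n)
        (z ^ 2 * deriv (deriv f) z) := by
    intro e f hf he z
    have := hasSum_descFactorial_mul_taylorCoeffZero hf 2 z
    simpa only [he, hdesc, iteratedDeriv_succ, iteratedDeriv_zero] using this
  have hd1 : ∀ {f : ℂ → ℂ}, Differentiable ℂ f → Differentiable ℂ (deriv f) := fun hf => by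
    have := hf.iteratedDeriv 1
    rwa [iteratedDeriv_one] at this
  have hcirc : ∀ {f : ℂ → ℂ}, Differentiable ℂ f → ∀ θ : ℝ,
      HasDerivAt (fun t : ℝ => f (r * exp (t * I)))
        (I * (r * exp (θ * I) * deriv f (r * exp (θ * I)))) θ := by
    intro f hf θ
    have h1 : HasDerivAt (fun w : ℂ => (r : ℂ) * exp (w * I)) (r * (exp (θ * I) * I)) (θ : ℂ) := by
      simpa using (((hasDerivAt_id (θ : ℂ)).mul_const I).cexp).const_mul (r : ℂ)
    have h2 := ((hf (r * exp (θ * I))).hasDerivAt.comp (θ : ℂ) h1).comp_ofReal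
    refine h2.congr_deriv ?_
    ring
  have hcirc2 : ∀ {f : ℂ → ℂ}, Differentiable ℂ f → ∀ θ : ℝ,
      HasDerivAt (fun t : ℝ => r * exp (t * I) * deriv f (r * exp (t * I)))
        (I * (r * exp (θ * I) * deriv f (r * exp (θ * I)) +
          (r * exp (θ * I)) ^ 2 * deriv (deriv f) (r * exp (θ * I)))) θ := by
    intro f hf θ
    have h1 := hcirc (f := fun w => w * deriv f w) (differentiable_id.mul (hd1 hf)) θ
    refine h1.congr_deriv ?_
    have h2 : HasDerivAt (fun w => w * deriv f w) (1 * deriv f (r * exp (θ * I)) +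
        r * exp (θ * I) * deriv (deriv f) (r * exp (θ * I))) (r * exp (θ * I)) :=
      (hasDerivAt_id _).mul ((hd1 hf) _).hasDerivAt
    rw [h2.deriv]
    ring
  set Z : ℝ → ℂ := fun θ => r * exp (θ * I) with hZ
  set X : ℝ → ℂ := fun θ => Z θ * deriv p (Z θ) - conj (Z θ * deriv q (Z θ)) with hX
  set Y : ℝ → ℂ := fun θ => (Z θ * deriv p (Z θ) + Z θ ^ 2 * deriv (deriv p) (Z θ)) +
    conj (Z θ * deriv q (Z θ) + Z θ ^ 2 * deriv (deriv q) (Z θ)) with hY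
  have hF : ∀ θ, HasDerivAt (fun t : ℝ => p (Z t) + conj (q (Z t))) (I * X θ) θ := by
    intro θ
    have h1 := (hcirc hpd θ).add (hcirc hqd θ).star
    refine h1.congr_deriv ?_
    change I * (Z θ * deriv p (Z θ)) + conj (I * (Z θ * deriv q (Z θ))) = _
    simp only [hX, map_mul, conj_I]
    ring
  have hXd : ∀ θ, HasDerivAt X (I * Y θ) θ := by
    intro θ
    have h1 := (hcirc2 hpd θ).sub (hcirc2 hqd θ).star
    refine h1.congr_deriv ?_
    change I * (Z θ * deriv p (Z θ) + Z θ ^ 2 * deriv (deriv p) (Z θ)) -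
      conj (I * (Z θ * deriv q (Z θ) + Z θ ^ 2 * deriv (deriv q) (Z θ))) = _
    simp only [hY, map_mul, map_add, conj_I]
    ring
  have hXY : ∀ θ, X θ ≠ 0 ∧ a < (Y θ / X θ).re := by
    intro θ
    have hZn : ‖Z θ‖ = r := by
      simp only [hZ]
      rw [norm_mul, norm_exp_ofReal_mul_I, mul_one, norm_real, Real.norm_of_nonneg hr0.le]
    refine lt_re_div_of_norm_sub_lt H.lt_one (H.norm_sub_lt (z := Z θ)
      (norm_pos_iff.1 (by rw [hZn]; exact hr0)) (by rw [hZn]; exact hr1)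
      (hs1 hpd hpc _) (hs2 hpd hpc _) (hs1 hqd hqc _) (hs2 hqd hqc _))
  have htan : ∀ θ, circleTangent (fun z => p z + conj (q z)) r θ = I * X θ := fun θ => (hF θ).deriv
  have hne : ∀ θ, I * X θ ≠ 0 := fun θ => mul_ne_zero I_ne_zero (hXY θ).1
  refine ⟨fun θ => by rw [htan]; exact hne θ, ?_⟩
  have hZc : Continuous Z := by simp only [hZ]; fun_prop
  have hYc : Continuous Y := by
    have h1 := (hd1 hpd).continuous.comp hZc
    have h2 := (hd1 hqd).continuous.comp hZc
    have h3 := (hd1 (hd1 hpd)).continuous.comp hZc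
    have h4 := (hd1 (hd1 hqd)).continuous.comp hZc
    exact ((hZc.mul h1).add ((hZc.pow 2).mul h3)).add
      (continuous_conj.comp ((hZc.mul h2).add ((hZc.pow 2).mul h4)))
  obtain ⟨φ, hφ, hφT, hφd⟩ := exists_differentiable_argument (T := fun θ => I * X θ)
    (T' := fun θ => I * (I * Y θ)) (fun θ => (hXd θ).const_mul I)
    (continuous_const.mul (continuous_const.mul hYc)) hne
  refine ⟨φ, hφ, fun θ => by rw [htan]; exact hφT θ, fun θ => ?_⟩
  -- The tangent is `iX` with derivative `i·iY`, so its logarithmic derivative is `iY/X`, with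
  -- imaginary part `Re(Y/X)`.
  rw [hφd, mul_div_mul_left _ _ I_ne_zero, mul_div_assoc, I_mul_im]
  exact (hXY θ).2

end CoeffCondition
end criterion

/-! ### Uniqueness of the decomposition and the final estimate. -/

/-- The analytic and co-analytic parts of a harmonic map are determined by their values at the
origin. -/
lemma IsHarmonicDecomposition.eqOn {f h g h' g' : ℂ → ℂ} (H : IsHarmonicDecomposition f h g)
    (H' : IsHarmonicDecomposition f h' g') : EqOn h h' (ball 0 1) ∧ EqOn g g' (ball 0 1) := by
  have hconn : IsConnected (ball (0 : ℂ) 1) :=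
    ⟨nonempty_ball.2 one_pos, (convex_ball (0 : ℂ) 1).isPreconnected⟩
  have h0 : (0 : ℂ) ∈ ball (0 : ℂ) 1 := mem_ball_self one_pos
  -- Two holomorphic functions are conjugate to each other, so their sum is real and their
  -- difference imaginary; both are constant.
  have key : ∀ z ∈ ball (0 : ℂ) 1, h z - h' z = conj (g' z - g z) := fun z hz => by
    rw [map_sub, sub_eq_sub_iff_add_eq_add, ← H.eq_on_disc z hz, H'.eq_on_disc z hz, add_comm]
  have hk := H.analytic_h.sub H'.analytic_h
  have hl := H'.analytic_g.sub H.analytic_g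
  obtain ⟨c, hc⟩ := ((hk.add hl).analyticOnNhd isOpen_ball).eq_const_of_im_eq_const (c₀ := 0)
    (fun z hz => by
      have := congrArg im (key z hz)
      simp only [Pi.add_apply, Pi.sub_apply, sub_im, add_im, conj_im] at this ⊢
      linarith) isOpen_ball hconn
  obtain ⟨d, hd⟩ := ((hk.sub hl).analyticOnNhd isOpen_ball).eq_const_of_re_eq_const (c₀ := 0)
    (fun z hz => by
      have := congrArg re (key z hz)
      simp only [Pi.sub_apply, sub_re, conj_re] at this ⊢
      linarith) isOpen_ball hconn
  have hc0 := hc 0 h0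
  have hd0 := hd 0 h0
  simp only [Pi.add_apply, Pi.sub_apply, H.h_zero, H'.h_zero, H.g_zero, H'.g_zero, sub_zero,
    add_zero] at hc0 hd0 hc hd
  refine ⟨fun z hz => ?_, fun z hz => ?_⟩
  · linear_combination (hc z hz + hd z hz - hc0 - hd0) / 2
  · linear_combination (hd z hz - hc z hz + hc0 - hd0) / 2

/-- Membership in `ClassKHo` in terms of a given decomposition. -/
lemma IsHarmonicDecomposition.isConvexHarmonic {f h g : ℂ → ℂ} (H : IsHarmonicDecomposition f h g)
    (hf : f ∈ ClassKHo) : IsConvexHarmonic h g ∧ deriv g 0 = 0 := by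
  obtain ⟨⟨hinj, h', g', H', hlt, hg'⟩, hconv⟩ := hf
  obtain ⟨hh, hg⟩ := H.eqOn H'
  have hderiv : ∀ {p q : ℂ → ℂ}, EqOn p q (ball 0 1) → ∀ z ∈ ball (0 : ℂ) 1,
      deriv p z = deriv q z := fun he z hz =>
    (he.eventuallyEq_of_mem (isOpen_ball.mem_nhds hz)).deriv_eq
  have hfe : EqOn f (fun z => h z + conj (g z)) (ball 0 1) := H.eq_on_disc
  refine ⟨⟨H.analytic_h, H.analytic_g, H.h_zero, H.g_zero, fun z hz => ?_, hinj.congr hfe, ?_⟩, ?_⟩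
  · rw [hderiv hh z hz, hderiv hg z hz]; exact hlt z hz
  · rw [← hfe.image_eq]; exact hconv
  · rw [hderiv hg 0 (mem_ball_self one_pos), hg']

lemma hasSum_descFactorial_mul_wrightCoeff {α β γ δ : ℝ} (hα : 0 < α) (hγ : 0 < γ) (hβ : 0 ≤ β)
    (hδ : 0 ≤ δ) (hβδ : 0 < β + δ) (k : ℕ) :
    HasSum (fun n : ℕ => (n.descFactorial k : ℝ) * wrightCoeff α β γ δ n)
      (iteratedDeriv k (wrightNormalized α β γ δ) 1).re := by
  have hent := isEntireSeries_wrightCoeff hα hγ hβ hδ hβδ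
  rw [wrightNormalized_eq_tsum hα hγ hβ hδ hβδ]
  have := reCLM.hasSum (hasSum_descFactorial_mul_taylorCoeffZero hent.differentiable k 1)
  simp only [hent.taylorCoeffZero_tsum, one_pow, mul_one, one_mul, reCLM_apply] at this
  convert! this using 2 with n
  rw [← ofReal_natCast, ← ofReal_mul, ofReal_re]

theorem mainTheorem5
    (a : ℝ) (ha0 : 0 ≤ a) (ha1 : a < 1)
    (α₁ β₁ γ₁ δ₁ α₂ β₂ γ₂ δ₂ : ℝ)
    (hα₁ : 0 < α₁) (hγ₁ : 0 < γ₁) (hα₂ : 0 < α₂) (hγ₂ : 0 < γ₂)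
    (hβ₁ : 0 ≤ β₁) (hδ₁ : 0 ≤ δ₁) (hβ₂ : 0 ≤ β₂) (hδ₂ : 0 ≤ δ₂)
    -- the two Wright series converge on all of `ℂ`
    (hβδ₁ : 0 < β₁ + δ₁) (hβδ₂ : 0 < β₂ + δ₂)
    (σ : ℂ) (hσ : ‖σ‖ < 1)
    (W₁ W₂ : ℂ → ℂ)
    (hW₁ : W₁ = wrightNormalized α₁ β₁ γ₁ δ₁)
    (hW₂ : W₂ = wrightNormalized α₂ β₂ γ₂ δ₂)
    (f h g : ℂ → ℂ) (hfhg : IsHarmonicDecomposition f h g) (hf : f ∈ ClassKHo)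
    -- the derivatives of `W₁` and `W₂` at `1` are real numbers
    (hineq :
      ((iteratedDeriv 3 W₁ 1).re + (4 - a) * (iteratedDeriv 2 W₁ 1).re
          + 2 * (1 - a) * ((deriv W₁ 1).re - 1))
        + ‖σ‖ * ((iteratedDeriv 3 W₂ 1).re + (2 + a) * (iteratedDeriv 2 W₂ 1).re)
      ≤ 2 * (1 - a)) :
    convOperator W₁ W₂ σ h g ∈ ClassHK a := by
  obtain ⟨hconv, hg'⟩ := hfhg.isConvexHarmonic hf
  have hbound := fun {n : ℕ} (hn : n ≠ 0) => hconv.norm_taylorCoeffZero_le hfhg.deriv_h_zero hg' hn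
  set w₁ := wrightCoeff α₁ β₁ γ₁ δ₁ with hw₁
  set w₂ := wrightCoeff α₂ β₂ γ₂ δ₂ with hw₂
  have hent₁ : IsEntireSeries fun n => (w₁ n : ℂ) := isEntireSeries_wrightCoeff hα₁ hγ₁ hβ₁ hδ₁ hβδ₁
  have hent₂ : IsEntireSeries fun n => (w₂ n : ℂ) := isEntireSeries_wrightCoeff hα₂ hγ₂ hβ₂ hδ₂ hβδ₂
  have hnn₁ : ∀ n, 0 ≤ w₁ n := wrightCoeff_nonneg hα₁ hγ₁ hβ₁ hδ₁
  have hnn₂ : ∀ n, 0 ≤ w₂ n := wrightCoeff_nonneg hα₂ hγ₂ hβ₂ hδ₂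
  have hone₁ : w₁ 1 = 1 := wrightCoeff_one hα₁ hγ₁
  have htc₁ : ∀ n, taylorCoeffZero W₁ n = w₁ n := fun n => by
    rw [hW₁, wrightNormalized_eq_tsum hα₁ hγ₁ hβ₁ hδ₁ hβδ₁, hent₁.taylorCoeffZero_tsum]
  have htc₂ : ∀ n, taylorCoeffZero W₂ n = w₂ n := fun n => by
    rw [hW₂, wrightNormalized_eq_tsum hα₂ hγ₂ hβ₂ hδ₂ hβδ₂, hent₂.taylorCoeffZero_tsum]
  set c : ℕ → ℂ := fun n => taylorCoeffZero h n * w₁ n with hc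
  set d : ℕ → ℂ := fun n => σ * (taylorCoeffZero g n * w₂ n) with hd
  have hL : convOperator W₁ W₂ σ h g =
      fun z => ∑' n, c n * z ^ n + conj (∑' n, d n * z ^ n) := by
    ext z
    simp only [convOperator, hadamardConv, htc₁, htc₂, hc, hd]
    rw [← tsum_mul_left]
    simp only [mul_assoc]
  have hcn : ∀ n, ‖c n‖ = ‖taylorCoeffZero h n‖ * w₁ n := fun n => by
    rw [hc, norm_mul, norm_real, Real.norm_of_nonneg (hnn₁ n)]
  have hdn : ∀ n, ‖d n‖ = ‖σ‖ * (‖taylorCoeffZero g n‖ * w₂ n) := fun n => by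
    rw [hd, norm_mul, norm_mul, norm_real, Real.norm_of_nonneg (hnn₂ n)]
  have hc0 : c 0 = 0 := by simp [hc, taylorCoeffZero_zero, hfhg.h_zero]
  have hd0 : d 0 = 0 := by simp [hd, taylorCoeffZero_zero, hfhg.g_zero]
  have hc1 : c 1 = 1 := by simp [hc, taylorCoeffZero_one, hfhg.deriv_h_zero, hone₁]
  have hd1 : d 1 = 0 := by simp [hd, taylorCoeffZero_one, hg']
  -- Coefficients growing linearly cost only a geometric factor, which does not affect convergence
  -- on the whole plane.
  have htwo : ∀ n : ℕ, (n : ℝ) + 1 ≤ 2 ^ n := fun n => by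
    exact_mod_cast Nat.lt_two_pow_self (n := n)
  have hcE : IsEntireSeries c := hent₁.of_norm_le zero_le_two fun n => by
    rcases eq_or_ne n 0 with rfl | hn
    · rw [hc0]; simp
    · rw [hcn, norm_real, Real.norm_of_nonneg (hnn₁ n)]
      refine mul_le_mul_of_nonneg_right ?_ (hnn₁ n)
      have h1 := (hbound hn).1
      have h2 := htwo n
      have h3 : (0 : ℝ) ≤ n := n.cast_nonneg
      linarith
  have hdE : IsEntireSeries d := hent₂.of_norm_le zero_le_two fun n => by
    rcases eq_or_ne n 0 with rfl | hn
    · rw [hd0]; simp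
    · rw [hdn, norm_real, Real.norm_of_nonneg (hnn₂ n), ← mul_assoc]
      refine mul_le_mul_of_nonneg_right ?_ (hnn₂ n)
      have h1 := (hbound hn).2
      have h2 := htwo n
      have h3 : (0 : ℝ) ≤ n := n.cast_nonneg
      nlinarith [norm_nonneg σ, norm_nonneg (taylorCoeffZero g n)]
  have hdesc2 : ∀ n : ℕ, (((n + 2).descFactorial 2 : ℕ) : ℝ) = (n + 2) * (n + 1) := fun n => by
    simp [Nat.descFactorial_succ]; ring
  have hdesc3 : ∀ n : ℕ, (((n + 2).descFactorial 3 : ℕ) : ℝ) = (n + 2) * (n + 1) * n := fun n => by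
    simp [Nat.descFactorial_succ]; ring
  -- With `m = n + 2`: `m(m-1)(m-2) + (4-a)m(m-1) + 2(1-a)m = m(m+1)(m-a)`. Subtracting `1` from
  -- `W₁'(1)` removes the term `m = 1`.
  have hs₁ : HasSum (fun n : ℕ => ((n : ℝ) + 2) * (n + 3) * (n + 2 - a) * w₁ (n + 2))
      ((iteratedDeriv 3 W₁ 1).re + (4 - a) * (iteratedDeriv 2 W₁ 1).re
          + 2 * (1 - a) * ((deriv W₁ 1).re - 1)) := by
    have S := hasSum_descFactorial_mul_wrightCoeff hα₁ hγ₁ hβ₁ hδ₁ hβδ₁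
    have e := ((S 3).add ((S 2).mul_left (4 - a))).add ((S 1).mul_left (2 * (1 - a)))
    rw [← hasSum_nat_add_iff' 2] at e
    simp only [← hw₁, ← hW₁, iteratedDeriv_one, hdesc2, hdesc3, Finset.sum_range_succ,
      Finset.sum_range_zero] at e
    convert! e using 1
    · ext n; simp only [Nat.descFactorial_one]; push_cast; ring
    · simp [Nat.descFactorial_succ, hone₁]; ring
  -- Here `m(m-1)(m-2) + (2+a)m(m-1) = m(m-1)(m+a)`, which vanishes at `m = 1`, so no correction is
  -- needed.
  have hs₂ : HasSum (fun n : ℕ => ((n : ℝ) + 2) * (n + 1) * (n + 2 + a) * w₂ (n + 2))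
      ((iteratedDeriv 3 W₂ 1).re + (2 + a) * (iteratedDeriv 2 W₂ 1).re) := by
    have S := hasSum_descFactorial_mul_wrightCoeff hα₂ hγ₂ hβ₂ hδ₂ hβδ₂
    have e := (S 3).add ((S 2).mul_left (2 + a))
    rw [← hasSum_nat_add_iff' 2] at e
    simp only [← hw₂, ← hW₂, hdesc2, hdesc3, Finset.sum_range_succ, Finset.sum_range_zero] at e
    convert! e using 1
    · ext n; ring
    · simp [Nat.descFactorial_succ]
  -- The factor `1/2` is the one in the coefficient bounds `(m+1)/2` and `(m-1)/2`; it turns the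
  -- hypothesis `≤ 2(1-a)` into the `1 - a` of the criterion.
  have hs := (hs₁.add (hs₂.mul_left ‖σ‖)).mul_left (1 / 2)
  have hterm : ∀ n : ℕ, ((n : ℝ) + 2) * (n + 2 - a) * ‖c (n + 2)‖ +
      ((n : ℝ) + 2) * (n + 2 + a) * ‖d (n + 2)‖ ≤
      1 / 2 * (((n : ℝ) + 2) * (n + 3) * (n + 2 - a) * w₁ (n + 2) +
        ‖σ‖ * (((n : ℝ) + 2) * (n + 1) * (n + 2 + a) * w₂ (n + 2))) := fun n => by
    obtain ⟨h1, h2⟩ := hbound (n := n + 2) (by omega)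
    push_cast at h1 h2
    have hn : (0 : ℝ) ≤ n := n.cast_nonneg
    have e1 : ‖c (n + 2)‖ ≤ ((n : ℝ) + 2 + 1) / 2 * w₁ (n + 2) := by
      rw [hcn]; exact mul_le_mul_of_nonneg_right h1 (hnn₁ _)
    have e2 : ‖d (n + 2)‖ ≤ ‖σ‖ * (((n : ℝ) + 2 - 1) / 2 * w₂ (n + 2)) := by
      rw [hdn]
      exact mul_le_mul_of_nonneg_left (mul_le_mul_of_nonneg_right h2 (hnn₂ _)) (norm_nonneg _)
    have e3 := mul_le_mul_of_nonneg_left e1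
      (mul_nonneg (by linarith) (by linarith) : 0 ≤ ((n : ℝ) + 2) * (n + 2 - a))
    have e4 := mul_le_mul_of_nonneg_left e2
      (mul_nonneg (by linarith) (by linarith) : 0 ≤ ((n : ℝ) + 2) * (n + 2 + a))
    refine (add_le_add e3 e4).trans_eq ?_
    ring
  have hsum : Summable fun n : ℕ => ((n : ℝ) + 2) * (n + 2 - a) * ‖c (n + 2)‖ +
      ((n : ℝ) + 2) * (n + 2 + a) * ‖d (n + 2)‖ :=
    Summable.of_nonneg_of_le (fun n => by
      have hn : (0 : ℝ) ≤ n := n.cast_nonneg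
      have h1 : 0 ≤ (n : ℝ) + 2 - a := by linarith
      positivity) hterm hs.summable
  rw [hL]
  exact CoeffCondition.mem_classHK ⟨ha0, ha1, hcE, hdE, hc0, hc1, hd0, hd1, hsum,
    (hasSum_le hterm hsum.hasSum hs).trans (by linarith)⟩
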